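/- Setting. Let $D\subseteq\mathbb R^k$ be open (for instance $D=\mathbb R^k$), let $\Omega\subset\mathbb R^d$ be compact, and let $\varphi:D\times\Omega\to\mathbb R$ be twice differentiable in $\theta$ with $\nabla_\theta\nabla_\theta\varphi(\theta,x)$ Lipschitz in $\theta$ on $D$, uniformly in $x\in\Omega$. Given data points $x_1,\dots,x_n\in\Omega$ ($n\ge1$), $\hat\nu=\frac1n\sum_{l}\delta_{x_l}$, a target function $f_*$, $\lambda\in\mathbb R$ and $r\in C^2(D)$, put $$F(\theta)=\int f_*\,\varphi(\theta,\cdot)\,d\hat\nu-\lambda r(\theta),\qquad K(\theta,\theta')=\int\varphi(\theta,\cdot)\varphi(\theta',\cdot)\,d\hat\nu,$$ $$\nabla V(\theta,\mu)=-\nabla F(\theta)+\int\nabla K(\theta,\theta')\,\mu(d\theta'),\qquad \nabla\nabla V(\theta,\mu)=-\nabla\nabla F(\theta)+\int\nabla\nabla K(\theta,\theta')\,\mu(d\theta'),$$ where $\nabla$ acts on the first argument of $K$ and $\nabla'$ on the second. Let $\mu_0$ be a probability measure on $D$ with compact support in $D$, let $\tau\ge0$, and suppose that the mean-field flow exists on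 $[0,\tau]$: $(t,\theta)\mapsto\Theta_t(\theta)\in D$ is continuous on $[0,\tau]\times\operatorname{supp}\mu_0$ and $$\dot\Theta_t(\theta)=-\nabla V(\Theta_t(\theta),\mu_t),\qquad \Theta_0(\theta)=\theta,\qquad \mu_t=(\Theta_t)_*\mu_0 .$$ Let $\theta_1^0,\theta_2^0,\dots$ be i.i.d. with law $\mu_0$ under $\mathbb P_0$, and for each $m$ let $\theta_1,\dots,\theta_m$ solve, almost surely on $[0,\tau]$ and with values in $D$, $$\dot\theta_i=-\nabla V(\theta_i,\mu^{(m)}_t),\qquad \theta_i(0)=\theta_i^0,\qquad \mu_t^{(m)}=\tfrac1m\sum_{i=1}^m\delta_{\theta_i(t)} .$$ Put $f_t^{(m)}(x)=\int\varphi(\theta,x)\,\mu^{(m)}_t(d\theta)$, $f_t(x)=\int\varphi(\theta,x)\,\mu_t(d\theta)$ and $g_t^{(m)}=m^{1/2}(f_t^{(m)}-f_t)$. Let $\omega_0$ be a Gaussian random measure with mean zero and covariance $\mathbb E[\omega_0(d\theta)\omega_0(d\theta')]=\mu_0(d\theta)\delta_\theta(d\theta')-\mu_0(d\theta)\mu_0(d\theta')$,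 that is, a centered jointly Gaussian family $\int\chi\,d\omega_0$, $\chi\in L^2(\mu_0)$, with covariances $\int\chi\chi'd\mu_0-\int\chi\,d\mu_0\int\chi'd\mu_0$, on some probability space $(S',\mathbb P')$. Statement. There is a field $T_t(\theta)\in L^2(\mathbb P';\mathbb R^k)$, continuous in $(t,\theta)\in[0,\tau]\times\operatorname{supp}\mu_0$, that satisfies $T_0=0$ and, with derivatives in time taken in $L^2(\mathbb P')$, $$\dot T_t(\theta)=-\nabla\nabla V(\Theta_t(\theta),\mu_t)T_t(\theta)-\int\nabla\nabla'K(\Theta_t(\theta),\Theta_t(\theta'))T_t(\theta')\,\mu_0(d\theta')-\int\nabla K(\Theta_t(\theta),\Theta_t(\theta'))\,\omega_0(d\theta').$$ For every such $T$, every $t\in[0,\tau]$ and every $x\in\Omega$, as $m\to\infty$, $g_t^{(m)}(x)$ converges in law to $$g_t(x)=\int\varphi(\theta,x)\,\omega_t(d\theta)=\int\varphi(\Theta_t(\theta),x)\,\omega_0(d\theta)+\int\nabla\varphi(\Theta_t(\theta),x)\cdot T_t(\theta)\,\mu_0(d\theta),$$ where $\omega_t$ is defined on test functions by $\int\chi\,d\omega_t=\int\chi(\Theta_t(\theta))\,\omega_0(d\theta)+\int\nabla\chi(\Theta_t(\theta))\cdot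 T_t(\theta)\,\mu_0(d\theta)$. -/

import Mathlib

open MeasureTheory ProbabilityTheory Set Filter Topology
open scoped Gradient ENNReal

noncomputable section

namespace MeanField

/-- The Euclidean space `ℝᵏ`. -/
abbrev Euc (k : ℕ) : Type := EuclideanSpace ℝ (Fin k)

/-- The data of the empirical risk minimization problem: a parameter domain `D ⊆ ℝᵏ`, an input
domain `Ω ⊆ ℝᵈ`, a model `φ(θ, x)`, a target function `f_*`, `n` data points `x_l`, and a
regularization term `lam * r(θ)`. -/
structure Model (k d n : ℕ) where
  D : Set (Euc k)
  Ω : Set (Euc d)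
  φ : Euc k → Euc d → ℝ
  fstar : Euc d → ℝ
  x : Fin n → Euc d
  lam : ℝ
  r : Euc k → ℝ

/-- The Hessian `∇∇f(θ)`, as a linear operator. -/
def hess {k : ℕ} (f : Euc k → ℝ) (θ : Euc k) : Euc k →L[ℝ] Euc k :=
  fderiv ℝ (∇ f) θ

/-- The empirical measure `(1/m) ∑ᵢ δ_{vᵢ}`. -/
def empiricalMeasure {k m : ℕ} (v : Fin m → Euc k) : Measure (Euc k) :=
  (m : ℝ≥0∞)⁻¹ • ∑ i, Measure.dirac (v i)

namespace Model

variable {k d n : ℕ} (M : Model k d n)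

/-- Standing regularity assumptions: `Ω` is compact and contains the (at least one) data points,
`D` is open, `φ(·, x)` is twice differentiable on `D` with a Hessian that is Lipschitz, uniformly
in `x ∈ Ω`, and `r` is `C²` on `D`. -/
structure Regular : Prop where
  data_pos : 0 < n
  isCompact_Ω : IsCompact M.Ω
  data_mem : ∀ l, M.x l ∈ M.Ω
  isOpen_D : IsOpen M.D
  φ_diff : ∀ x ∈ M.Ω, DifferentiableOn ℝ (fun θ => M.φ θ x) M.D
  grad_φ_diff : ∀ x ∈ M.Ω, DifferentiableOn ℝ (∇ (fun θ => M.φ θ x)) M.D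
  hess_φ_lipschitz : ∃ L, ∀ x ∈ M.Ω, LipschitzOnWith L (hess (fun θ => M.φ θ x)) M.D
  r_contDiff : ContDiffOn ℝ 2 M.r M.D

/-- `F(θ) = ∫ f_*(x) φ(θ, x) ν̂(dx) - lam * r(θ)`, with `ν̂ = (1/n) ∑ δ_{x_l}`. -/
def F (θ : Euc k) : ℝ :=
  (n : ℝ)⁻¹ * ∑ l, M.fstar (M.x l) * M.φ θ (M.x l) - M.lam * M.r θ

/-- `K(θ, θ') = ∫ φ(θ, x) φ(θ', x) ν̂(dx)`, with `ν̂ = (1/n) ∑ δ_{x_l}`. -/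
def K (θ θ' : Euc k) : ℝ :=
  (n : ℝ)⁻¹ * ∑ l, M.φ θ (M.x l) * M.φ θ' (M.x l)

/-- `∇K(θ, θ')`: the gradient of `K` in its first argument. -/
def gradK (θ θ' : Euc k) : Euc k :=
  ∇ (fun η => M.K η θ') θ

/-- `∇∇K(θ, θ')`: the Hessian of `K` in its first argument. -/
def hessK (θ θ' : Euc k) : Euc k →L[ℝ] Euc k :=
  hess (fun η => M.K η θ') θ

/-- `∇∇'K(θ, θ')`: the mixed second derivative of `K`, that is, the derivative of `∇K(θ, θ')` in
`θ'`; in coordinates `(∇∇'K v)ᵢ = ∑ⱼ (∂²K/∂θᵢ∂θ'ⱼ) vⱼ`. -/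
def crossHessK (θ θ' : Euc k) : Euc k →L[ℝ] Euc k :=
  fderiv ℝ (fun η' => M.gradK θ η') θ'

/-- `∇V(θ, μ) = -∇F(θ) + ∫ ∇K(θ, θ') μ(dθ')`. -/
def gradV (θ : Euc k) (μ : Measure (Euc k)) : Euc k :=
  -∇ M.F θ + ∫ θ', M.gradK θ θ' ∂μ

/-- `∇∇V(θ, μ) = -∇∇F(θ) + ∫ ∇∇K(θ, θ') μ(dθ')`. -/
def hessV (θ : Euc k) (μ : Measure (Euc k)) : Euc k →L[ℝ] Euc k :=
  -hess M.F θ + ∫ θ', M.hessK θ θ' ∂μ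

/-- The function represented by a measure: `f[μ](x) = ∫ φ(θ, x) μ(dθ)`. -/
def f (μ : Measure (Euc k)) (x : Euc d) : ℝ :=
  ∫ θ, M.φ θ x ∂μ

/-- `Θ` is the characteristic flow of the mean-field gradient flow on `[0, τ]`: with
`μ_t = (Θ_t)_* μ₀`, it solves `dΘ_t(θ)/dt = -∇V(Θ_t(θ), μ_t)`, `Θ_0(θ) = θ`. Only starting points
in the support of `μ₀` matter. -/
structure IsMeanFieldFlow (μ₀ : Measure (Euc k)) (τ : ℝ) (Θ : ℝ → Euc k → Euc k) : Prop where
  continuousOn : ContinuousOn (fun p : ℝ × Euc k => Θ p.1 p.2) (Icc 0 τ ×ˢ μ₀.support)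
  init : ∀ θ ∈ μ₀.support, Θ 0 θ = θ
  mem : ∀ t ∈ Icc 0 τ, ∀ θ ∈ μ₀.support, Θ t θ ∈ M.D
  ode : ∀ t ∈ Icc 0 τ, ∀ θ ∈ μ₀.support,
    HasDerivWithinAt (fun s => Θ s θ) (-M.gradV (Θ t θ) (μ₀.map (Θ t))) (Icc 0 τ) t

/-- The random vectors `ϑ i t`, `i < m`, solve the particle gradient flow
`dθᵢ/dt = -∇V(θᵢ, μ_t^{(m)})` on `[0, τ]`, `μ_t^{(m)}` being their empirical measure, with random
initial conditions `θ₀ i`. -/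
structure IsParticleFlow {S : Type*} [MeasurableSpace S] (P : Measure S) (τ : ℝ)
    (θ₀ : ℕ → S → Euc k) (m : ℕ) (ϑ : Fin m → ℝ → S → Euc k) : Prop where
  aemeasurable : ∀ i, ∀ t ∈ Icc 0 τ, AEMeasurable (ϑ i t) P
  init : ∀ᵐ ω ∂P, ∀ i, ϑ i 0 ω = θ₀ i ω
  mem : ∀ᵐ ω ∂P, ∀ t ∈ Icc 0 τ, ∀ i, ϑ i t ω ∈ M.D
  ode : ∀ᵐ ω ∂P, ∀ t ∈ Icc 0 τ, ∀ i,
    HasDerivWithinAt (fun s => ϑ i s ω)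
      (-M.gradV (ϑ i t ω) (empiricalMeasure fun j => ϑ j t ω)) (Icc 0 τ) t

end Model

section Noise

variable {k : ℕ} {S' : Type*} [MeasurableSpace S']

/-- The Gaussian random measure `ω₀` with mean zero and covariance
`E[ω₀(dθ) ω₀(dθ')] = μ₀(dθ) δ_θ(dθ') - μ₀(dθ) μ₀(dθ')`, given through its integrals
`ω₀ χ = ∫ χ dω₀ ∈ L²(P')` against test functions `χ ∈ L²(μ₀)`. -/
structure IsGaussianFluctuation (μ₀ : Measure (Euc k)) (P' : Measure S')
    (ω₀ : Lp ℝ 2 μ₀ → Lp ℝ 2 P') : Prop where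
  gaussian : IsGaussianProcess (fun χ (s : S') => ω₀ χ s) P'
  mean : ∀ χ, ∫ s, ω₀ χ s ∂P' = 0
  covariance : ∀ χ χ', ∫ s, ω₀ χ s * ω₀ χ' s ∂P'
    = ∫ θ, χ θ * χ' θ ∂μ₀ - (∫ θ, χ θ ∂μ₀) * ∫ θ, χ' θ ∂μ₀

open Classical in
/-- `∫ χ(θ) ω₀(dθ)` for a square-integrable function `χ`. -/
def noiseIntegral {μ₀ : Measure (Euc k)} {P' : Measure S'}
    (ω₀ : Lp ℝ 2 μ₀ → Lp ℝ 2 P') (χ : Euc k → ℝ) : Lp ℝ 2 P' :=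
  if h : MemLp χ 2 μ₀ then ω₀ h.toLp else 0

/-- `∫ h(θ) ω₀(dθ)` for a vector-valued function `h`, coordinate by coordinate. -/
def noiseIntegralVec {μ₀ : Measure (Euc k)} {P' : Measure S'}
    (ω₀ : Lp ℝ 2 μ₀ → Lp ℝ 2 P') (h : Euc k → Euc k) : Lp (Euc k) 2 P' :=
  ∑ i, (ContinuousLinearMap.toSpanSingleton ℝ (EuclideanSpace.single i (1 : ℝ))).compLp
    (noiseIntegral ω₀ fun θ => h θ i)

end Noise

namespace Model

variable {k d n : ℕ} (M : Model k d n) {S' : Type*} [MeasurableSpace S']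

/-- `T_t(θ)`, a field of square-integrable random vectors, is a solution on `[0, τ]` of the
linearized flow (derivatives in time and integrals over `μ₀` are taken in `L²(P')`, where the
integrals against `ω₀` live)
`dT_t(θ)/dt = -∇∇V(Θ_t(θ), μ_t) T_t(θ) - ∫ ∇∇'K(Θ_t(θ), Θ_t(θ')) T_t(θ') μ₀(dθ')
  - ∫ ∇K(Θ_t(θ), Θ_t(θ')) ω₀(dθ')`, with `T_0 = 0`. -/
structure IsTangentFlow (μ₀ : Measure (Euc k)) (τ : ℝ) (Θ : ℝ → Euc k → Euc k)
    {P' : Measure S'} (ω₀ : Lp ℝ 2 μ₀ → Lp ℝ 2 P')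
    (T : ℝ → Euc k → Lp (Euc k) 2 P') : Prop where
  continuousOn : ContinuousOn (fun p : ℝ × Euc k => T p.1 p.2) (Icc 0 τ ×ˢ μ₀.support)
  init : ∀ θ ∈ μ₀.support, T 0 θ = 0
  ode : ∀ t ∈ Icc 0 τ, ∀ θ ∈ μ₀.support,
    HasDerivWithinAt (fun s => T s θ)
      (-(M.hessV (Θ t θ) (μ₀.map (Θ t))).compLp (T t θ)
        - ∫ θ', (M.crossHessK (Θ t θ) (Θ t θ')).compLp (T t θ') ∂μ₀
        - noiseIntegralVec ω₀ (fun θ' => M.gradK (Θ t θ) (Θ t θ')))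
      (Icc 0 τ) t

end Model

/-- The limiting fluctuation `ω_t` tested against `χ`:
`∫ χ dω_t = ∫ χ(Θ_t(θ)) ω₀(dθ) + ∫ ∇χ(Θ_t(θ)) · T_t(θ) μ₀(dθ)`, a random variable. -/
def limitFluctuation {k : ℕ} {S' : Type*} [MeasurableSpace S'] {μ₀ : Measure (Euc k)}
    {P' : Measure S'} (Θ : ℝ → Euc k → Euc k) (ω₀ : Lp ℝ 2 μ₀ → Lp ℝ 2 P')
    (T : ℝ → Euc k → Lp (Euc k) 2 P') (t : ℝ) (χ : Euc k → ℝ) : Lp ℝ 2 P' :=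
  noiseIntegral ω₀ (fun θ => χ (Θ t θ))
    + ∫ θ, (innerSL ℝ (∇ χ (Θ t θ))).compLp (T t θ) ∂μ₀

end MeanField

end

/-!
# Gaussian fluctuations of interacting particles around the mean-field limit

The proof rests on duality, so that neither the law of the whole fluctuation process nor the uniqueness
of the tangent flow is needed. Since `K` is a sum over the data points, the linearized mean-field flow
has finite-rank interactions, and its adjoint is a linear equation in `ℝᵏ` that is solved backwards from
the terminal value `∇φ(Θ_τ(θ), x)` (`Model.IsAdjointFlow`, `IsSetting.exists_adjointFlow`). With its
solution `p` and `c_l(s) = ∫ ∇φ(Θ_s(θ), x_l) · p_s(θ) μ₀(dθ)` one forms the influence function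
`h(θ) = φ(Θ_τ(θ), x) - ∫_0^τ n⁻¹ ∑_l c_l(s) φ(Θ_s(θ), x_l) ds` (`Model.influence`), which represents the
derivative of the output at `x` and time `τ` with respect to the initial measure. Both sides of the
convergence are then expressed through `h`.

*The particles.* Compare each particle with the mean-field trajectory of the same starting point. A
Gronwall argument bounds the displacements by the sampling errors of the outputs
(`IsSetting.norm_displacement_le`). The pairing of the displacements with `p` evolves, up to quadratic
errors, only through the sampling errors (`IsSetting.norm_pairing_deriv_le`), and integrating it in time
shows that the output of the particle system deviates from `f_τ(x)` by
`(1/m) ∑ᵢ h(θᵢ⁰) - ∫ h dμ₀`, up to an error that is small compared with the sampling errors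
(`IsSetting.exists_abs_expansion_le`). These are of order `m^{-1/2}` in probability
(`exists_measure_sampleDev_gt_le`), so the central limit theorem for `h(θᵢ⁰)` and Slutsky's theorem give
convergence in law to a centered Gaussian with variance `Var h` (`IsSetting.tendstoInDistribution_output`).

*The limit.* The covariance of `ω₀` makes it a contraction from `L²(μ₀)` to `L²(P')` that is linear
(`IsGaussianFluctuation.toCLM`), so the equation for `T` is a linear equation in a Banach space, and its
solution exists (`exists_linear_field`, `IsSetting.exists_tangentFlow`). For any solution `T`, the
derivative of `⟨p_s(θ), T_s(θ)⟩`, averaged over `μ₀`, contains only the noise terms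
`-n⁻¹ ∑_l c_l(s) ∫ φ(Θ_s(θ), x_l) ω₀(dθ)`, whence `∫ φ(·, x) dω_τ = ∫ h dω₀`
(`IsSetting.limitFluctuation_eq`), which is a centered Gaussian with the same variance `Var h`.
-/

namespace MeanField

/-! ### Linear differential equations for fields over a compact set -/

/-- Global existence for a differential equation with a uniformly Lipschitz right-hand side, in
any Banach space. The Picard map is a contraction for the norm `sup_t e^{-ct} ‖y t‖` once `c` exceeds
the Lipschitz constant; below it is written for `z t = e^{-ct} y t` and the usual sup norm. -/
theorem exists_hasDerivWithinAt_of_lipschitzWith {X : Type*} [NormedAddCommGroup X]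
    [NormedSpace ℝ X] [CompleteSpace X] {τ : ℝ} (hτ : 0 ≤ τ) {f : ℝ → X → X} {L : NNReal}
    (hlip : ∀ t, LipschitzWith L (f t)) (hcont : ∀ x, Continuous fun t => f t x) (x₀ : X) :
    ∃ y : ℝ → X, y 0 = x₀ ∧ ∀ t ∈ Icc 0 τ, HasDerivWithinAt y (f t (y t)) (Icc 0 τ) t := by
  have hf : Continuous fun p : ℝ × X => f p.1 p.2 :=
    continuous_prod_of_continuous_lipschitzWith' _ L hlip hcont
  set c : ℝ := 2 * L + 1 with hc
  have hc0 : 0 < c := by positivity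
  -- the integrand of the Picard map
  let G : C(Icc 0 τ, X) → ℝ → X := fun z s => f s (Real.exp (c * s) • z (projIcc 0 τ hτ s))
  have hG : ∀ z, Continuous (G z) := fun z => by
    have : Continuous fun s => Real.exp (c * s) • z (projIcc 0 τ hτ s) := by
      have : Continuous (projIcc 0 τ hτ) := continuous_projIcc
      fun_prop
    exact hf.comp (continuous_id.prodMk this)
  have hI : ∀ z, Continuous fun t : ℝ => ∫ s in (0 : ℝ)..t, G z s := fun z =>
    intervalIntegral.continuous_primitive (fun a b => (hG z).intervalIntegrable a b) 0
  let Φ : C(Icc 0 τ, X) → C(Icc 0 τ, X) := fun z =>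
    ⟨fun t => Real.exp (-(c * t)) • (x₀ + ∫ s in (0 : ℝ)..t, G z s), by
      have := hI z
      fun_prop⟩
  have hΦ : ContractingWith (1 / 2) Φ := by
    refine ⟨by norm_num, LipschitzWith.of_dist_le_mul fun z w => ?_⟩
    rw [ContinuousMap.dist_le (by positivity)]
    intro t
    have ht := t.2
    have hbound : ∀ s ∈ Ioc (0 : ℝ) t, ‖G z s - G w s‖ ≤ L * dist z w * Real.exp (c * s) := by
      intro s _
      have h1 := (hlip s).dist_le_mul (Real.exp (c * s) • z (projIcc 0 τ hτ s))
        (Real.exp (c * s) • w (projIcc 0 τ hτ s))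
      rw [dist_smul₀, Real.norm_of_nonneg (Real.exp_pos _).le] at h1
      have h2 := ContinuousMap.dist_apply_le_dist (f := z) (g := w) (projIcc 0 τ hτ s)
      rw [← dist_eq_norm]
      calc _ ≤ L * (Real.exp (c * s) * dist (z (projIcc 0 τ hτ s)) (w (projIcc 0 τ hτ s))) := h1
        _ ≤ L * (Real.exp (c * s) * dist z w) := by gcongr
        _ = _ := by ring
    have hint : ∫ s in (0 : ℝ)..t, L * dist z w * Real.exp (c * s)
        = L * dist z w * ((Real.exp (c * t) - 1) / c) := by
      rw [intervalIntegral.integral_const_mul, intervalIntegral.integral_comp_mul_left _ hc0.ne',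
        integral_exp]
      simp [div_eq_inv_mul]
    have hle : ‖∫ s in (0 : ℝ)..t, (G z s - G w s)‖ ≤ L * dist z w * ((Real.exp (c * t) - 1) / c) := by
      rw [← hint]
      exact intervalIntegral.norm_integral_le_of_norm_le ht.1
        (Filter.Eventually.of_forall hbound) (Continuous.intervalIntegrable (by fun_prop) _ _)
    have heq : Φ z t - Φ w t = Real.exp (-(c * t)) • ∫ s in (0 : ℝ)..t, (G z s - G w s) := by
      rw [intervalIntegral.integral_sub ((hG z).intervalIntegrable _ _)
        ((hG w).intervalIntegrable _ _)]
      simp only [Φ, ContinuousMap.coe_mk, ← smul_sub, add_sub_add_left_eq_sub]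
    rw [dist_eq_norm, heq, norm_smul, Real.norm_of_nonneg (Real.exp_pos _).le]
    calc Real.exp (-(c * t)) * ‖∫ s in (0 : ℝ)..t, (G z s - G w s)‖
        ≤ Real.exp (-(c * t)) * (L * dist z w * (Real.exp (c * t) / c)) := by
          gcongr
          refine hle.trans ?_
          gcongr
          linarith
      _ = L / c * dist z w := by
          rw [Real.exp_neg]
          field_simp
      _ ≤ ((1 / 2 : NNReal) : ℝ) * dist z w := by
          gcongr
          rw [div_le_iff₀ hc0]
          push_cast
          rw [hc]; linarith
  let z := ContractingWith.fixedPoint Φ hΦ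
  have hz : Φ z = z := hΦ.fixedPoint_isFixedPt
  let y : ℝ → X := fun t => x₀ + ∫ s in (0 : ℝ)..t, G z s
  have hy : ∀ t ∈ Icc 0 τ, G z t = f t (y t) := by
    intro t ht
    have h1 : z ⟨t, ht⟩ = Real.exp (-(c * t)) • y t := by
      conv_lhs => rw [← hz]
      rfl
    simp only [G, projIcc_of_mem hτ ht, h1, smul_smul, ← Real.exp_add]
    simp
  refine ⟨y, by simp [y], fun t ht => ?_⟩
  rw [← hy t ht]
  exact (((hG z).integral_hasStrictDerivAt 0 t).hasDerivAt.const_add x₀).hasDerivWithinAt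

/-- Existence for the linear equation
`dT_t(θ)/dt = a_t(θ) T_t(θ) + ∫_B κ_t(θ, θ') T_t(θ') μ(dθ') + b_t(θ)` for a field `T_t(θ)`, `θ ∈ B`,
with values in a Banach space: it is an ordinary linear equation in `C(B, E)`. -/
theorem exists_linear_field {V E : Type*} [MetricSpace V] [MeasurableSpace V] [BorelSpace V]
    [SecondCountableTopology V]
    [NormedAddCommGroup E] [NormedSpace ℝ E] [CompleteSpace E] {B : Set V} (hB : IsCompact B)
    (μ : Measure V) [IsFiniteMeasure μ] {τ : ℝ} (hτ : 0 ≤ τ)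
    {a : ℝ → V → E →L[ℝ] E} (ha : ContinuousOn (fun p : ℝ × V => a p.1 p.2) (Icc 0 τ ×ˢ B))
    {κ : ℝ → V → V → E →L[ℝ] E}
    (hκ : ContinuousOn (fun p : ℝ × V × V => κ p.1 p.2.1 p.2.2) (Icc 0 τ ×ˢ B ×ˢ B))
    {b : ℝ → V → E} (hb : ContinuousOn (fun p : ℝ × V => b p.1 p.2) (Icc 0 τ ×ˢ B))
    {T₀ : V → E} (hT₀ : ContinuousOn T₀ B) :
    ∃ T : ℝ → V → E, ContinuousOn (fun p : ℝ × V => T p.1 p.2) (Icc 0 τ ×ˢ B) ∧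
      (∀ θ ∈ B, T 0 θ = T₀ θ) ∧
      ∀ t ∈ Icc 0 τ, ∀ θ ∈ B, HasDerivWithinAt (fun s => T s θ)
        (a t θ (T t θ) + ∫ θ' in B, κ t θ θ' (T t θ') ∂μ + b t θ) (Icc 0 τ) t := by
  classical
  have : CompactSpace B := isCompact_iff_compactSpace.1 hB
  have hBm : MeasurableSet B := hB.measurableSet
  let π : ℝ → ℝ := fun t => projIcc 0 τ hτ t
  have hπ : Continuous π := continuous_subtype_val.comp continuous_projIcc
  have hπm : ∀ t, π t ∈ Icc 0 τ := fun t => (projIcc 0 τ hτ t).2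
  have ha' : Continuous fun p : ℝ × B => a (π p.1) p.2 :=
    ha.comp_continuous (by fun_prop : Continuous fun p : ℝ × B => (π p.1, (p.2 : V)))
      fun p => ⟨hπm _, p.2.2⟩
  have hb' : Continuous fun p : ℝ × B => b (π p.1) p.2 :=
    hb.comp_continuous (by fun_prop : Continuous fun p : ℝ × B => (π p.1, (p.2 : V)))
      fun p => ⟨hπm _, p.2.2⟩
  have hκ' : Continuous fun p : ℝ × B × B => κ (π p.1) p.2.1 p.2.2 :=
    hκ.comp_continuous
      (by fun_prop : Continuous fun p : ℝ × B × B => (π p.1, (p.2.1 : V), (p.2.2 : V)))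
      fun p => ⟨hπm _, p.2.1.2, p.2.2.2⟩
  let ν : Measure B := μ.comap (↑)
  have hνfin : IsFiniteMeasure ν := by
    refine ⟨?_⟩
    rw [(MeasurableEmbedding.subtype_coe hBm).comap_apply]
    exact measure_lt_top _ _
  have hint : ∀ F : C(B, E), Continuous fun p : ℝ × B => ∫ θ', κ (π p.1) p.2 θ' (F θ') ∂ν := by
    intro F
    have h1 : Continuous (fun (p : ℝ × B) (θ' : B) => κ (π p.1) p.2 θ' (F θ')).uncurry := by
      have h2 : Continuous fun q : (ℝ × B) × B => κ (π q.1.1) q.1.2 q.2 :=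
        hκ'.comp (by fun_prop : Continuous fun q : (ℝ × B) × B => (q.1.1, q.1.2, q.2))
      exact h2.clm_apply (by fun_prop)
    have h3 : LocallyCompactSpace (ℝ × B) := inferInstance
    simpa using continuous_parametric_integral_of_continuous (μ := ν) h1 isCompact_univ
  let Γ : C(B, E) → C(ℝ × B, E) := fun F =>
    ⟨fun p => a (π p.1) p.2 (F p.2) + ∫ θ', κ (π p.1) p.2 θ' (F θ') ∂ν + b (π p.1) p.2,
      ((ha'.clm_apply (by fun_prop)).add (hint F)).add hb'⟩
  let f : ℝ → C(B, E) → C(B, E) := fun t F => (Γ F).curry t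
  have hfc : ∀ F, Continuous fun t => f t F := fun F => (Γ F).curry.continuous
  -- uniform bounds for the coefficients
  obtain ⟨Ca, hCa⟩ : ∃ C, ∀ p ∈ Icc 0 τ ×ˢ B, ‖a p.1 p.2‖ ≤ C :=
    (isCompact_Icc.prod hB).exists_bound_of_continuousOn ha
  obtain ⟨Cκ, hCκ⟩ : ∃ C, ∀ p ∈ Icc 0 τ ×ˢ B ×ˢ B, ‖κ p.1 p.2.1 p.2.2‖ ≤ C :=
    (isCompact_Icc.prod (hB.prod hB)).exists_bound_of_continuousOn hκ
  have hlip : ∀ t, LipschitzWith (|Ca| + |Cκ| * ν.real univ).toNNReal (f t) := by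
    intro t
    refine LipschitzWith.of_dist_le_mul fun F H => ?_
    rw [Real.coe_toNNReal _ (by positivity), ContinuousMap.dist_le (by positivity)]
    intro θ
    have hi : ∀ F : C(B, E), Integrable (fun θ' : B => κ (π t) θ θ' (F θ')) ν := by
      intro F
      have h1 : Continuous fun θ' : B => κ (π t) θ θ' :=
        hκ'.comp (by fun_prop : Continuous fun θ' : B => (t, θ, θ'))
      exact (h1.clm_apply (by fun_prop)).integrable_of_hasCompactSupport
        (HasCompactSupport.of_compactSpace _)
    have heq : f t F θ - f t H θ = a (π t) θ (F θ - H θ)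
        + ∫ θ', κ (π t) θ θ' (F θ' - H θ') ∂ν := by
      simp only [map_sub]
      rw [integral_sub (hi F) (hi H)]
      simp only [f, Γ, ContinuousMap.curry_apply, ContinuousMap.coe_mk]
      abel
    have hd : ∀ θ', ‖F θ' - H θ'‖ ≤ dist F H := fun θ' => by
      rw [← dist_eq_norm]; exact ContinuousMap.dist_apply_le_dist θ'
    rw [dist_eq_norm, heq]
    refine (norm_add_le _ _).trans ?_
    rw [add_mul]
    gcongr
    · refine ((a (π t) θ).le_opNorm _).trans ?_
      gcongr
      · exact (hCa (π t, θ) ⟨hπm t, θ.2⟩).trans (le_abs_self _)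
      · exact hd θ
    · refine (norm_integral_le_of_norm_le_const (C := |Cκ| * dist F H)
        (Filter.Eventually.of_forall fun θ' => ?_)).trans_eq (by ring)
      refine ((κ (π t) θ θ').le_opNorm _).trans ?_
      gcongr
      · exact (hCκ (π t, θ, θ') ⟨hπm t, θ.2, θ'.2⟩).trans (le_abs_self _)
      · exact hd θ'
  obtain ⟨y, hy0, hy⟩ := exists_hasDerivWithinAt_of_lipschitzWith hτ hlip hfc
    ⟨B.domRestrict T₀, hT₀.domRestrict⟩
  refine ⟨fun t θ => if h : θ ∈ B then y t ⟨θ, h⟩ else 0, ?_, ?_, ?_⟩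
  · have hyc : ContinuousOn y (Icc 0 τ) := fun t ht => (hy t ht).continuousWithinAt
    rw [continuousOn_iff_continuous_domRestrict] at hyc ⊢
    have h1 : Continuous fun p : (Icc 0 τ ×ˢ B : Set (ℝ × V)) =>
        ((Icc 0 τ).domRestrict y ⟨p.1.1, p.2.1⟩) ⟨p.1.2, p.2.2⟩ := by
      have h2 : Continuous fun p : (Icc 0 τ ×ˢ B : Set (ℝ × V)) =>
          (Icc 0 τ).domRestrict y ⟨p.1.1, p.2.1⟩ := hyc.comp (by fun_prop)
      fun_prop
    refine h1.congr fun p => ?_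
    have h3 : p.1.2 ∈ B := p.2.2
    simp [h3]
  · intro θ hθ
    simp [hθ, hy0]
  · intro t ht θ hθ
    have h1 := (ContinuousMap.evalCLM ℝ (⟨θ, hθ⟩ : B) : C(B, E) →L[ℝ] E).hasFDerivAt
      |>.comp_hasDerivWithinAt t (hy t ht)
    have hπt : π t = t := by simp [π, projIcc_of_mem hτ ht]
    have h2 : ∫ θ' in B, κ t θ θ' (if h : θ' ∈ B then y t ⟨θ', h⟩ else 0) ∂μ
        = ∫ θ' : B, κ t θ θ' (y t θ') ∂ν := by
      rw [← integral_subtype_comap hBm]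
      simp only [Subtype.coe_prop, dite_true, Subtype.coe_eta, ν]
    simp only [hθ, dite_true, h2]
    convert h1 using 1
    · rfl
    · simp [f, Γ, hπt]

/-- First-order Taylor expansion, uniformly near the points of a compact subset `Γ` of an open set
on which the derivative is continuous. -/
theorem exists_taylor_uniform {V E : Type*} [NormedAddCommGroup V] [NormedSpace ℝ V]
    [ProperSpace V]
    [NormedAddCommGroup E] [NormedSpace ℝ E] {U Γ : Set V} (hU : IsOpen U) (hΓ : IsCompact Γ)
    (hΓU : Γ ⊆ U) {f : V → E} {f' : V → V →L[ℝ] E} (hf : ∀ x ∈ U, HasFDerivAt f (f' x) x)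
    (hf' : ContinuousOn f' U) {ε : ℝ} (hε : 0 < ε) :
    ∃ ρ > 0, ∀ x ∈ Γ, ∀ y, ‖y - x‖ ≤ ρ → ‖f y - f x - f' x (y - x)‖ ≤ ε * ‖y - x‖ := by
  obtain ⟨r, hr, hrU⟩ := hΓ.exists_cthickening_subset_open hU hΓU
  have hK : IsCompact (Metric.cthickening r Γ) := hΓ.cthickening
  obtain ⟨δ, hδ, hδ'⟩ := Metric.uniformContinuousOn_iff.1
    (hK.uniformContinuousOn_of_continuous (hf'.mono hrU)) ε hε
  refine ⟨min r (δ / 2), by positivity, fun x hx y hy => ?_⟩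
  have hball : Metric.closedBall x (min r (δ / 2)) ⊆ Metric.cthickening r Γ :=
    (Metric.closedBall_subset_closedBall (min_le_left _ _)).trans
      (Metric.closedBall_subset_cthickening hx r)
  have hxm : x ∈ Metric.closedBall x (min r (δ / 2)) :=
    Metric.mem_closedBall_self (by positivity)
  refine (convex_closedBall x (min r (δ / 2))).norm_image_sub_le_of_norm_hasFDerivWithin_le'
    (f' := f') (fun z hz => (hf z (hrU (hball hz))).hasFDerivWithinAt) (fun z hz => ?_) hxm
    (by simpa [dist_eq_norm] using hy)
  rw [← dist_eq_norm]
  refine (hδ' z (hball hz) x (hball hxm) ?_).le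
  calc dist z x ≤ δ / 2 := (Metric.mem_closedBall.1 hz).trans (min_le_right _ _)
    _ < δ := by linarith

/-! ### The derivatives of `F`, `K` and `V` -/

namespace Model

variable {k d n : ℕ}

/-- The gradient `∇φ(θ, x)` in `θ`. -/
noncomputable def gradφ (M : Model k d n) (x : Euc d) (θ : Euc k) : Euc k := ∇ (fun η => M.φ η x) θ

/-- The Hessian `∇∇φ(θ, x)` in `θ`. -/
noncomputable def hessφ (M : Model k d n) (x : Euc d) (θ : Euc k) : Euc k →L[ℝ] Euc k :=
  hess (fun η => M.φ η x) θ

variable {M : Model k d n}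

namespace Regular

theorem data_ne_zero (hM : M.Regular) : (n : ℝ) ≠ 0 := by
  exact_mod_cast hM.data_pos.ne'

theorem hasGradientAt (hM : M.Regular) {x : Euc d} (hx : x ∈ M.Ω) {θ : Euc k} (hθ : θ ∈ M.D) :
    HasGradientAt (fun η => M.φ η x) (M.gradφ x θ) θ :=
  ((hM.φ_diff x hx θ hθ).differentiableAt (hM.isOpen_D.mem_nhds hθ)).hasGradientAt

theorem hasFDerivAt (hM : M.Regular) {x : Euc d} (hx : x ∈ M.Ω) {θ : Euc k} (hθ : θ ∈ M.D) :
    HasFDerivAt (fun η => M.φ η x) (innerSL ℝ (M.gradφ x θ)) θ :=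
  (hM.hasGradientAt hx hθ).hasFDerivAt

theorem hasFDerivAt_gradient (hM : M.Regular) {x : Euc d} (hx : x ∈ M.Ω) {θ : Euc k}
    (hθ : θ ∈ M.D) :
    HasFDerivAt (M.gradφ x) (M.hessφ x θ) θ :=
  ((hM.grad_φ_diff x hx θ hθ).differentiableAt (hM.isOpen_D.mem_nhds hθ)).hasFDerivAt

theorem continuousOn (hM : M.Regular) {x : Euc d} (hx : x ∈ M.Ω) :
    ContinuousOn (fun η => M.φ η x) M.D := (hM.φ_diff x hx).continuousOn

theorem continuousOn_gradient (hM : M.Regular) {x : Euc d} (hx : x ∈ M.Ω) :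
    ContinuousOn (M.gradφ x) M.D := (hM.grad_φ_diff x hx).continuousOn

theorem continuousOn_hess (hM : M.Regular) {x : Euc d} (hx : x ∈ M.Ω) :
    ContinuousOn (M.hessφ x) M.D := by
  obtain ⟨L, hL⟩ := hM.hess_φ_lipschitz
  exact (hL x hx).continuousOn

/-- The gradient of a linear combination of the functions `φ(·, x_l)`. -/
theorem hasGradientAt_comb (hM : M.Regular) (c : Fin n → ℝ) {θ : Euc k} (hθ : θ ∈ M.D) :
    HasGradientAt (fun η => (n : ℝ)⁻¹ * ∑ l, c l * M.φ η (M.x l))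
      ((n : ℝ)⁻¹ • ∑ l, c l • M.gradφ (M.x l) θ) θ := by
  rw [hasGradientAt_iff_hasFDerivAt]
  have h := (HasFDerivAt.fun_sum (u := Finset.univ) fun l _ =>
    (hM.hasFDerivAt (hM.data_mem l) hθ).const_mul (c l)).const_mul (n : ℝ)⁻¹
  refine h.congr_fderiv ?_
  ext v
  simp

theorem gradient_comb (hM : M.Regular) (c : Fin n → ℝ) {θ : Euc k} (hθ : θ ∈ M.D) :
    ∇ (fun η => (n : ℝ)⁻¹ * ∑ l, c l * M.φ η (M.x l)) θ
      = (n : ℝ)⁻¹ • ∑ l, c l • M.gradφ (M.x l) θ :=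
  (hM.hasGradientAt_comb c hθ).gradient

/-- The Hessian of a linear combination of the functions `φ(·, x_l)`. -/
theorem hasFDerivAt_gradient_comb (hM : M.Regular) (c : Fin n → ℝ) {θ : Euc k} (hθ : θ ∈ M.D) :
    HasFDerivAt (∇ (fun η => (n : ℝ)⁻¹ * ∑ l, c l * M.φ η (M.x l)))
      ((n : ℝ)⁻¹ • ∑ l, c l • M.hessφ (M.x l) θ) θ := by
  have h := (HasFDerivAt.fun_sum (u := Finset.univ) fun l _ =>
    (hM.hasFDerivAt_gradient (hM.data_mem l) hθ).const_smul (c l)).const_smul (n : ℝ)⁻¹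
  refine h.congr_of_eventuallyEq ?_
  filter_upwards [hM.isOpen_D.mem_nhds hθ] with η hη
  rw [hM.gradient_comb c hη]
  rfl

theorem contDiffOn_gradient_r (hM : M.Regular) : ContDiffOn ℝ 1 (∇ M.r) M.D := by
  have h := hM.r_contDiff.fderiv_of_isOpen hM.isOpen_D (m := 1) (by norm_num)
  exact ((InnerProductSpace.toDual ℝ (Euc k)).symm.contDiff.comp_contDiffOn h)

/-- The Hessian of `F` in terms of those of `φ` and `r`. -/
theorem hasFDerivAt_gradient_F_formula (hM : M.Regular) {θ : Euc k} (hθ : θ ∈ M.D) :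
    HasFDerivAt (∇ M.F) ((n : ℝ)⁻¹ • ∑ l, M.fstar (M.x l) • M.hessφ (M.x l) θ
      - M.lam • hess M.r θ) θ := by
  have hr : ∀ η ∈ M.D, HasGradientAt M.r (∇ M.r η) η := fun η hη =>
    ((hM.r_contDiff.differentiableOn (by norm_num) η hη).differentiableAt
      (hM.isOpen_D.mem_nhds hη)).hasGradientAt
  have hr2 : HasFDerivAt (∇ M.r) (hess M.r θ) θ :=
    ((hM.contDiffOn_gradient_r.differentiableOn (by norm_num) θ hθ).differentiableAt
      (hM.isOpen_D.mem_nhds hθ)).hasFDerivAt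
  refine ((hM.hasFDerivAt_gradient_comb (fun l => M.fstar (M.x l)) hθ).sub
    (hr2.const_smul M.lam)).congr_of_eventuallyEq ?_
  filter_upwards [hM.isOpen_D.mem_nhds hθ] with η hη
  refine HasGradientAt.gradient ?_
  have h1 := hM.hasGradientAt_comb (fun l => M.fstar (M.x l)) hη
  have h2 := hr η hη
  rw [hasGradientAt_iff_hasFDerivAt] at h1 h2 ⊢
  refine (h1.sub (h2.const_mul M.lam)).congr_fderiv ?_
  rw [Pi.sub_apply, map_sub, hM.gradient_comb _ hη]
  simp

theorem hasFDerivAt_gradient_F (hM : M.Regular) {θ : Euc k} (hθ : θ ∈ M.D) :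
    HasFDerivAt (∇ M.F) (hess M.F θ) θ :=
  (hM.hasFDerivAt_gradient_F_formula hθ).differentiableAt.hasFDerivAt

theorem continuousOn_hess_F (hM : M.Regular) : ContinuousOn (hess M.F) M.D := by
  have hr : ContinuousOn (hess M.r) M.D :=
    hM.contDiffOn_gradient_r.continuousOn_fderiv_of_isOpen hM.isOpen_D (by norm_num)
  have h : ContinuousOn (fun θ => (n : ℝ)⁻¹ • ∑ l, M.fstar (M.x l) •
      M.hessφ (M.x l) θ - M.lam • hess M.r θ) M.D := by
    have h1 : ∀ l, ContinuousOn (M.hessφ (M.x l)) M.D := fun l =>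
      hM.continuousOn_hess (hM.data_mem l)
    fun_prop
  exact h.congr fun θ hθ => (hM.hasFDerivAt_gradient_F_formula hθ).fderiv

theorem K_eq (θ' : Euc k) : (fun η => M.K η θ')
    = fun η => (n : ℝ)⁻¹ * ∑ l, M.φ θ' (M.x l) * M.φ η (M.x l) := by
  ext η
  simp [K, mul_comm]

/-- `∇K(θ, ·)` takes its values in the span of the gradients `∇φ(θ, x_l)`. -/
theorem gradK_eq (hM : M.Regular) {θ : Euc k} (hθ : θ ∈ M.D) (θ' : Euc k) :
    M.gradK θ θ' = (n : ℝ)⁻¹ • ∑ l, M.φ θ' (M.x l) • M.gradφ (M.x l) θ := by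
  rw [gradK, K_eq, hM.gradient_comb _ hθ]

theorem hessK_eq (hM : M.Regular) {θ : Euc k} (hθ : θ ∈ M.D) (θ' : Euc k) :
    M.hessK θ θ' = (n : ℝ)⁻¹ • ∑ l, M.φ θ' (M.x l) • M.hessφ (M.x l) θ := by
  rw [hessK, K_eq, hess, (hM.hasFDerivAt_gradient_comb _ hθ).fderiv]

/-- `∇∇'K` is a sum of rank-one operators, one for each data point. -/
theorem crossHessK_eq (hM : M.Regular) {θ θ' : Euc k} (hθ : θ ∈ M.D) (hθ' : θ' ∈ M.D) :
    M.crossHessK θ θ' = (n : ℝ)⁻¹ • ∑ l, (innerSL ℝ (M.gradφ (M.x l) θ')).smulRight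
      (M.gradφ (M.x l) θ) := by
  rw [crossHessK]
  have h : (fun η' => M.gradK θ η') = fun η' => (n : ℝ)⁻¹ • ∑ l, M.φ η' (M.x l) •
      M.gradφ (M.x l) θ := funext fun η' => hM.gradK_eq hθ η'
  rw [h]
  exact ((HasFDerivAt.fun_sum (u := Finset.univ) fun l _ =>
    (hM.hasFDerivAt (hM.data_mem l) hθ').smul_const _).const_smul (n : ℝ)⁻¹).fderiv

theorem gradV_eq (hM : M.Regular) {θ : Euc k} (hθ : θ ∈ M.D) {μ : Measure (Euc k)}
    (hμ : ∀ l, Integrable (fun η => M.φ η (M.x l)) μ) :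
    M.gradV θ μ = -∇ M.F θ + (n : ℝ)⁻¹ • ∑ l, M.f μ (M.x l) • M.gradφ (M.x l) θ := by
  simp_rw [gradV, hM.gradK_eq hθ]
  rw [integral_smul, integral_finsetSum _ fun l _ => (hμ l).smul_const _]
  simp_rw [integral_smul_const]
  rfl

theorem hessV_eq (hM : M.Regular) {θ : Euc k} (hθ : θ ∈ M.D) {μ : Measure (Euc k)}
    (hμ : ∀ l, Integrable (fun η => M.φ η (M.x l)) μ) :
    M.hessV θ μ
      = -hess M.F θ + (n : ℝ)⁻¹ • ∑ l, M.f μ (M.x l) • M.hessφ (M.x l) θ := by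
  simp_rw [hessV, hM.hessK_eq hθ]
  rw [integral_smul, integral_finsetSum _ fun l _ => (hμ l).smul_const _]
  simp_rw [integral_smul_const]
  rfl

end Regular

end Model

/-! ### Averages over finite samples -/

theorem integral_empiricalMeasure {k m : ℕ} (v : Fin m → Euc k) (χ : Euc k → ℝ) :
    ∫ θ, χ θ ∂(empiricalMeasure v) = (m : ℝ)⁻¹ * ∑ i, χ (v i) := by
  rw [empiricalMeasure, integral_smul_measure,
    integral_finsetSum_measure fun i _ => integrable_dirac (by simp)]
  simp

theorem integrable_empiricalMeasure {k m : ℕ} (v : Fin m → Euc k) (χ : Euc k → ℝ) :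
    Integrable χ (empiricalMeasure v) := by
  rcases Nat.eq_zero_or_pos m with rfl | hm
  · simp [empiricalMeasure]
  · refine Integrable.smul_measure ?_ (by simp [hm.ne'])
    rw [integrable_finsetSum_measure]
    exact fun i _ => integrable_dirac (by simp)

/-! ### Integrals of functions that are continuous on a compact set of full measure -/

theorem continuousOn_slice_right {V E : Type*} [TopologicalSpace V] [TopologicalSpace E] {B : Set V}
    {τ : ℝ} {f : ℝ → V → E}
    (hf : ContinuousOn (fun p : ℝ × V => f p.1 p.2) (Icc 0 τ ×ˢ B)) {t : ℝ} (ht : t ∈ Icc 0 τ) :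
    ContinuousOn (f t) B :=
  hf.comp (f := fun θ => (t, θ)) (by fun_prop) fun _ hθ => ⟨ht, hθ⟩

theorem continuousOn_slice_left {V E : Type*} [TopologicalSpace V] [TopologicalSpace E] {B : Set V}
    {τ : ℝ} {f : ℝ → V → E}
    (hf : ContinuousOn (fun p : ℝ × V => f p.1 p.2) (Icc 0 τ ×ˢ B)) {θ : V} (hθ : θ ∈ B) :
    ContinuousOn (fun t => f t θ) (Icc 0 τ) :=
  hf.comp (f := fun t => (t, θ)) (by fun_prop) fun _ ht => ⟨ht, hθ⟩

section CompactSupport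

variable {V E : Type*} [MetricSpace V] [MeasurableSpace V] [BorelSpace V]
  [SecondCountableTopology V] [NormedAddCommGroup E] {B : Set V} {μ : Measure V}

theorem aestronglyMeasurable_of_continuousOn (hB : IsCompact B) (hμB : ∀ᵐ θ ∂μ, θ ∈ B)
    {f : V → E} (hf : ContinuousOn f B) : AEStronglyMeasurable f μ := by
  have h := hf.aestronglyMeasurable (μ := μ) hB.measurableSet
  rwa [Measure.restrict_eq_self_of_ae_mem hμB] at h

theorem memLp_of_continuousOn [IsFiniteMeasure μ] (hB : IsCompact B) (hμB : ∀ᵐ θ ∂μ, θ ∈ B)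
    {f : V → E} (hf : ContinuousOn f B) (p : ℝ≥0∞) : MemLp f p μ := by
  obtain ⟨C, hC⟩ := hB.exists_bound_of_continuousOn hf
  exact MemLp.of_bound (aestronglyMeasurable_of_continuousOn hB hμB hf) C
    (hμB.mono fun θ hθ => hC θ hθ)

theorem integrable_of_continuousOn [IsFiniteMeasure μ] (hB : IsCompact B) (hμB : ∀ᵐ θ ∂μ, θ ∈ B)
    {f : V → E} (hf : ContinuousOn f B) : Integrable f μ :=
  memLp_one_iff_integrable.1 (memLp_of_continuousOn hB hμB hf 1)

variable [NormedSpace ℝ E]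

theorem continuousOn_integral [IsFiniteMeasure μ] (hB : IsCompact B) (hμB : ∀ᵐ θ ∂μ, θ ∈ B)
    {τ : ℝ} {f : ℝ → V → E} (hf : ContinuousOn (fun p : ℝ × V => f p.1 p.2) (Icc 0 τ ×ˢ B)) :
    ContinuousOn (fun t => ∫ θ, f t θ ∂μ) (Icc 0 τ) := by
  obtain ⟨C, hC⟩ := (isCompact_Icc.prod hB).exists_bound_of_continuousOn hf
  refine continuousOn_of_dominated (bound := fun _ => C)
    (fun t ht => aestronglyMeasurable_of_continuousOn hB hμB (continuousOn_slice_right hf ht))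
    (fun t ht => hμB.mono fun θ hθ => hC (t, θ) ⟨ht, hθ⟩) (integrable_const C)
    (hμB.mono fun θ hθ => continuousOn_slice_left hf hθ)

theorem intervalIntegral_integral_swap_of_continuousOn [IsFiniteMeasure μ] (hB : IsCompact B)
    (hμB : ∀ᵐ θ ∂μ, θ ∈ B) {τ : ℝ} (hτ : 0 ≤ τ) {f : ℝ → V → E}
    (hf : ContinuousOn (fun p : ℝ × V => f p.1 p.2) (Icc 0 τ ×ˢ B)) :
    ∫ s in (0 : ℝ)..τ, ∫ θ, f s θ ∂μ = ∫ θ, (∫ s in (0 : ℝ)..τ, f s θ) ∂μ := by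
  refine intervalIntegral_integral_swap ?_
  rw [uIoc_of_le hτ]
  have hae : ∀ᵐ p ∂((volume.restrict (Ioc 0 τ)).prod μ), p ∈ Icc 0 τ ×ˢ B := by
    have h1 : ∀ᵐ s ∂(volume.restrict (Ioc 0 τ)), s ∈ Icc 0 τ :=
      (ae_restrict_mem measurableSet_Ioc).mono fun s hs => Ioc_subset_Icc_self hs
    exact Measure.ae_prod_mem_iff_ae_ae_mem (measurableSet_Icc.prod hB.measurableSet) |>.2
      (h1.mono fun s hs => hμB.mono fun θ hθ => ⟨hs, hθ⟩)
  exact integrable_of_continuousOn (isCompact_Icc.prod hB) hae hf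

end CompactSupport

/-! ### The mean-field flow -/

/-- The mean-field setting on a time interval `[0, τ]`: a regular model, a compactly supported
initial measure on `D`, and its mean-field flow. -/
structure IsSetting {k d n : ℕ} (M : Model k d n) (μ₀ : Measure (Euc k)) (τ : ℝ)
    (Θ : ℝ → Euc k → Euc k) : Prop where
  regular : M.Regular
  isCompact : IsCompact μ₀.support
  subset : μ₀.support ⊆ M.D
  nonneg : 0 ≤ τ
  flow : M.IsMeanFieldFlow μ₀ τ Θ

theorem ae_mem_support {k : ℕ} (μ₀ : Measure (Euc k)) : ∀ᵐ θ ∂μ₀, θ ∈ μ₀.support :=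
  Measure.support_mem_ae

namespace IsSetting

variable {k d n : ℕ} {M : Model k d n} {μ₀ : Measure (Euc k)} [IsProbabilityMeasure μ₀] {τ : ℝ}
  {Θ : ℝ → Euc k → Euc k}

omit [IsProbabilityMeasure μ₀] in
theorem continuousOn_comp (h : IsSetting M μ₀ τ Θ) {E : Type*} [TopologicalSpace E]
    {f : Euc k → E} (hf : ContinuousOn f M.D) :
    ContinuousOn (fun p : ℝ × Euc k => f (Θ p.1 p.2)) (Icc 0 τ ×ˢ μ₀.support) :=
  hf.comp h.flow.continuousOn fun p hp => h.flow.mem p.1 hp.1 p.2 hp.2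

omit [IsProbabilityMeasure μ₀] in
theorem continuousOn_flow (h : IsSetting M μ₀ τ Θ) {t : ℝ} (ht : t ∈ Icc 0 τ) :
    ContinuousOn (Θ t) μ₀.support := continuousOn_slice_right h.flow.continuousOn ht

omit [IsProbabilityMeasure μ₀] in
theorem aemeasurable_flow (h : IsSetting M μ₀ τ Θ) {t : ℝ} (ht : t ∈ Icc 0 τ) :
    AEMeasurable (Θ t) μ₀ :=
  (aestronglyMeasurable_of_continuousOn h.isCompact (ae_mem_support μ₀)
    (h.continuousOn_flow ht)).aemeasurable

omit [IsProbabilityMeasure μ₀] in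
theorem aestronglyMeasurable_map (h : IsSetting M μ₀ τ Θ) {t : ℝ} (ht : t ∈ Icc 0 τ)
    {χ : Euc k → ℝ} (hχ : ContinuousOn χ M.D) : AEStronglyMeasurable χ (μ₀.map (Θ t)) := by
  have hD := h.regular.isOpen_D.measurableSet
  have hmem : ∀ᵐ θ ∂(μ₀.map (Θ t)), θ ∈ M.D :=
    (ae_map_iff (h.aemeasurable_flow ht) hD).2
      ((ae_mem_support μ₀).mono fun θ hθ => h.flow.mem t ht θ hθ)
  have h1 := hχ.aestronglyMeasurable (μ := μ₀.map (Θ t)) hD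
  rwa [Measure.restrict_eq_self_of_ae_mem hmem] at h1

theorem integrable_map (h : IsSetting M μ₀ τ Θ) {t : ℝ} (ht : t ∈ Icc 0 τ)
    {χ : Euc k → ℝ} (hχ : ContinuousOn χ M.D) : Integrable χ (μ₀.map (Θ t)) := by
  rw [integrable_map_measure (h.aestronglyMeasurable_map ht hχ) (h.aemeasurable_flow ht)]
  exact integrable_of_continuousOn h.isCompact (ae_mem_support μ₀)
    (continuousOn_slice_right (f := fun s θ => χ (Θ s θ)) (h.continuousOn_comp hχ) ht)

omit [IsProbabilityMeasure μ₀] in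
theorem f_map_eq (h : IsSetting M μ₀ τ Θ) {t : ℝ} (ht : t ∈ Icc 0 τ) {x : Euc d} (hx : x ∈ M.Ω) :
    M.f (μ₀.map (Θ t)) x = ∫ θ, M.φ (Θ t θ) x ∂μ₀ :=
  integral_map (h.aemeasurable_flow ht) (h.aestronglyMeasurable_map ht (h.regular.continuousOn hx))

theorem continuousOn_f_map (h : IsSetting M μ₀ τ Θ) {x : Euc d} (hx : x ∈ M.Ω) :
    ContinuousOn (fun t => M.f (μ₀.map (Θ t)) x) (Icc 0 τ) :=
  (continuousOn_integral h.isCompact (ae_mem_support μ₀)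
    (h.continuousOn_comp (h.regular.continuousOn hx))).congr fun _ ht => h.f_map_eq ht hx

theorem gradV_eq (h : IsSetting M μ₀ τ Θ) {t : ℝ} (ht : t ∈ Icc 0 τ) {θ : Euc k} (hθ : θ ∈ M.D) :
    M.gradV θ (μ₀.map (Θ t)) = -∇ M.F θ
      + (n : ℝ)⁻¹ • ∑ l, M.f (μ₀.map (Θ t)) (M.x l) • M.gradφ (M.x l) θ :=
  h.regular.gradV_eq hθ fun l =>
    h.integrable_map ht (h.regular.continuousOn (h.regular.data_mem l))

theorem hessV_eq (h : IsSetting M μ₀ τ Θ) {t : ℝ} (ht : t ∈ Icc 0 τ) {θ : Euc k} (hθ : θ ∈ M.D) :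
    M.hessV θ (μ₀.map (Θ t)) = -hess M.F θ
      + (n : ℝ)⁻¹ • ∑ l, M.f (μ₀.map (Θ t)) (M.x l) • M.hessφ (M.x l) θ :=
  h.regular.hessV_eq hθ fun l =>
    h.integrable_map ht (h.regular.continuousOn (h.regular.data_mem l))

theorem continuousOn_hessV (h : IsSetting M μ₀ τ Θ) :
    ContinuousOn (fun p : ℝ × Euc k => M.hessV (Θ p.1 p.2) (μ₀.map (Θ p.1)))
      (Icc 0 τ ×ˢ μ₀.support) := by
  have h1 := h.continuousOn_comp h.regular.continuousOn_hess_F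
  have h2 : ∀ l, ContinuousOn (fun p : ℝ × Euc k => M.hessφ (M.x l) (Θ p.1 p.2))
      (Icc 0 τ ×ˢ μ₀.support) := fun l =>
    h.continuousOn_comp (h.regular.continuousOn_hess (h.regular.data_mem l))
  have h3 : ∀ l, ContinuousOn (fun p : ℝ × Euc k => M.f (μ₀.map (Θ p.1)) (M.x l))
      (Icc 0 τ ×ˢ μ₀.support) := fun l =>
    (h.continuousOn_f_map (h.regular.data_mem l)).comp continuousOn_fst fun p hp => hp.1
  refine ContinuousOn.congr (f := fun p : ℝ × Euc k => -hess M.F (Θ p.1 p.2)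
    + (n : ℝ)⁻¹ • ∑ l, M.f (μ₀.map (Θ p.1)) (M.x l) • M.hessφ (M.x l) (Θ p.1 p.2)) (by fun_prop) ?_
  exact fun p hp => h.hessV_eq hp.1 (h.flow.mem p.1 hp.1 p.2 hp.2)

omit [IsProbabilityMeasure μ₀] in
theorem continuousOn_crossHessK (h : IsSetting M μ₀ τ Θ) :
    ContinuousOn (fun p : ℝ × Euc k × Euc k => M.crossHessK (Θ p.1 p.2.1) (Θ p.1 p.2.2))
      (Icc 0 τ ×ˢ μ₀.support ×ˢ μ₀.support) := by
  have h1 : ∀ l, ContinuousOn (fun p : ℝ × Euc k × Euc k => M.gradφ (M.x l) (Θ p.1 p.2.1))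
      (Icc 0 τ ×ˢ μ₀.support ×ˢ μ₀.support) := fun l =>
    (h.continuousOn_comp (h.regular.continuousOn_gradient (h.regular.data_mem l))).comp
      (f := fun p : ℝ × Euc k × Euc k => (p.1, p.2.1)) (by fun_prop) fun p hp => ⟨hp.1, hp.2.1⟩
  have h2 : ∀ l, ContinuousOn (fun p : ℝ × Euc k × Euc k => M.gradφ (M.x l) (Θ p.1 p.2.2))
      (Icc 0 τ ×ˢ μ₀.support ×ˢ μ₀.support) := fun l =>
    (h.continuousOn_comp (h.regular.continuousOn_gradient (h.regular.data_mem l))).comp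
      (f := fun p : ℝ × Euc k × Euc k => (p.1, p.2.2)) (by fun_prop) fun p hp => ⟨hp.1, hp.2.2⟩
  refine ContinuousOn.congr (f := fun p : ℝ × Euc k × Euc k => (n : ℝ)⁻¹ • ∑ l,
    ContinuousLinearMap.smulRightL ℝ (Euc k) (Euc k) (innerSL ℝ (M.gradφ (M.x l) (Θ p.1 p.2.2)))
      (M.gradφ (M.x l) (Θ p.1 p.2.1))) ?_ ?_
  · fun_prop
  · exact fun p hp => h.regular.crossHessK_eq (h.flow.mem p.1 hp.1 _ hp.2.1)
      (h.flow.mem p.1 hp.1 _ hp.2.2)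

omit [IsProbabilityMeasure μ₀] in
/-- The setting on a shorter time interval. -/
theorem mono (h : IsSetting M μ₀ τ Θ) {t : ℝ} (ht : t ∈ Icc 0 τ) : IsSetting M μ₀ t Θ where
  regular := h.regular
  isCompact := h.isCompact
  subset := h.subset
  nonneg := ht.1
  flow :=
    { continuousOn := h.flow.continuousOn.mono (prod_mono (Icc_subset_Icc_right ht.2) le_rfl)
      init := h.flow.init
      mem := fun s hs => h.flow.mem s (Icc_subset_Icc_right ht.2 hs)
      ode := fun s hs θ hθ => (h.flow.ode s (Icc_subset_Icc_right ht.2 hs) θ hθ).mono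
        (Icc_subset_Icc_right ht.2) }

end IsSetting

/-! ### The adjoint of the linearized flow -/

namespace Model

variable {k d n : ℕ}

/-- The coefficient `c_l(s) = ∫ ∇φ(Θ_s(θ), x_l) · p_s(θ) μ₀(dθ)` of a field `p`. -/
noncomputable def adjointCoef (M : Model k d n) (μ₀ : Measure (Euc k)) (Θ p : ℝ → Euc k → Euc k)
    (l : Fin n) (s : ℝ) : ℝ :=
  ∫ θ, inner ℝ (M.gradφ (M.x l) (Θ s θ)) (p s θ) ∂μ₀

/-- `p_s(θ)` solves on `[0, τ]` the adjoint of the linearized flow, with terminal value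
`∇φ(Θ_τ(θ), x)`. As `K` is a sum over the data points, the transpose of the integral operator with
kernel `∇∇'K(Θ_s(θ), Θ_s(θ'))` takes `p_s` to `n⁻¹ ∑_l c_l(s) ∇φ(Θ_s(θ), x_l)`. -/
structure IsAdjointFlow (M : Model k d n) (μ₀ : Measure (Euc k)) (τ : ℝ) (Θ : ℝ → Euc k → Euc k)
    (x : Euc d) (p : ℝ → Euc k → Euc k) : Prop where
  continuousOn : ContinuousOn (fun q : ℝ × Euc k => p q.1 q.2) (Icc 0 τ ×ˢ μ₀.support)
  terminal : ∀ θ ∈ μ₀.support, p τ θ = M.gradφ x (Θ τ θ)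
  ode : ∀ s ∈ Icc 0 τ, ∀ θ ∈ μ₀.support,
    HasDerivWithinAt (fun s => p s θ)
      ((M.hessV (Θ s θ) (μ₀.map (Θ s))).adjoint (p s θ)
        + (n : ℝ)⁻¹ • ∑ l, M.adjointCoef μ₀ Θ p l s • M.gradφ (M.x l) (Θ s θ))
      (Icc 0 τ) s

/-- The influence function `φ(Θ_τ(θ), x) - ∫_0^τ n⁻¹ ∑_l c_l(s) φ(Θ_s(θ), x_l) ds`, the derivative
of `∫ φ(·, x) dμ_τ` with respect to the initial measure. -/
noncomputable def influence (M : Model k d n) (μ₀ : Measure (Euc k)) (τ : ℝ)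
    (Θ p : ℝ → Euc k → Euc k) (x : Euc d) (θ : Euc k) : ℝ :=
  M.φ (Θ τ θ) x
    - ∫ s in (0 : ℝ)..τ, (n : ℝ)⁻¹ * ∑ l, M.adjointCoef μ₀ Θ p l s * M.φ (Θ s θ) (M.x l)

end Model

namespace IsSetting

variable {k d n : ℕ} {M : Model k d n} {μ₀ : Measure (Euc k)} [IsProbabilityMeasure μ₀] {τ : ℝ}
  {Θ p : ℝ → Euc k → Euc k} {x : Euc d}

omit [IsProbabilityMeasure μ₀] in
theorem continuousOn_inner_gradφ (h : IsSetting M μ₀ τ Θ) (hp : M.IsAdjointFlow μ₀ τ Θ x p)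
    (l : Fin n) : ContinuousOn
      (fun q : ℝ × Euc k => inner ℝ (M.gradφ (M.x l) (Θ q.1 q.2)) (p q.1 q.2))
      (Icc 0 τ ×ˢ μ₀.support) :=
  (h.continuousOn_comp (h.regular.continuousOn_gradient (h.regular.data_mem l))).inner
    hp.continuousOn

theorem continuousOn_adjointCoef (h : IsSetting M μ₀ τ Θ) (hp : M.IsAdjointFlow μ₀ τ Θ x p)
    (l : Fin n) : ContinuousOn (M.adjointCoef μ₀ Θ p l) (Icc 0 τ) :=
  continuousOn_integral h.isCompact (ae_mem_support μ₀) (h.continuousOn_inner_gradφ hp l)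

theorem continuousOn_influence_integrand (h : IsSetting M μ₀ τ Θ)
    (hp : M.IsAdjointFlow μ₀ τ Θ x p) : ContinuousOn (fun q : ℝ × Euc k =>
      (n : ℝ)⁻¹ * ∑ l, M.adjointCoef μ₀ Θ p l q.1 * M.φ (Θ q.1 q.2) (M.x l))
      (Icc 0 τ ×ˢ μ₀.support) :=
  continuousOn_const.mul (continuousOn_finsetSum _ fun l _ =>
    ((h.continuousOn_adjointCoef hp l).comp continuousOn_fst fun _ hq => hq.1).mul
      (h.continuousOn_comp (h.regular.continuousOn (h.regular.data_mem l))))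

/-- The adjoint flow exists: reversed in time, it is a linear equation with an initial value. -/
theorem exists_adjointFlow (h : IsSetting M μ₀ τ Θ) (hx : x ∈ M.Ω) :
    ∃ p, M.IsAdjointFlow μ₀ τ Θ x p := by
  have hrev : ∀ {s : ℝ}, s ∈ Icc 0 τ → τ - s ∈ Icc 0 τ := fun {s} hs =>
    ⟨by linarith [hs.2], by linarith [hs.1]⟩
  have hmaps : MapsTo (fun s => τ - s) (Icc 0 τ) (Icc 0 τ) := fun s hs => hrev hs
  have ha : ContinuousOn (fun q : ℝ × Euc k =>
      -(M.hessV (Θ (τ - q.1) q.2) (μ₀.map (Θ (τ - q.1)))).adjoint) (Icc 0 τ ×ˢ μ₀.support) := by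
    have h1 := h.continuousOn_hessV.comp (f := fun q : ℝ × Euc k => (τ - q.1, q.2))
      (t := Icc 0 τ ×ˢ μ₀.support) (s := Icc 0 τ ×ˢ μ₀.support) (by fun_prop)
      fun q hq => ⟨hrev hq.1, hq.2⟩
    exact (ContinuousLinearMap.adjoint.continuous.comp_continuousOn h1).neg
  have hκ : ContinuousOn (fun q : ℝ × Euc k × Euc k =>
      -M.crossHessK (Θ (τ - q.1) q.2.1) (Θ (τ - q.1) q.2.2))
      (Icc 0 τ ×ˢ μ₀.support ×ˢ μ₀.support) :=
    (h.continuousOn_crossHessK.comp (f := fun q : ℝ × Euc k × Euc k => (τ - q.1, q.2))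
      (s := Icc 0 τ ×ˢ μ₀.support ×ˢ μ₀.support) (by fun_prop)
      fun q hq => ⟨hrev hq.1, hq.2⟩).neg
  have hT₀ : ContinuousOn (fun θ => M.gradφ x (Θ τ θ)) μ₀.support :=
    continuousOn_slice_right (f := fun s θ => M.gradφ x (Θ s θ))
      (h.continuousOn_comp (h.regular.continuousOn_gradient hx))
      ⟨h.nonneg, le_rfl⟩
  obtain ⟨T, hT, hT0, hTode⟩ := exists_linear_field h.isCompact μ₀ h.nonneg
    (a := fun s θ => -(M.hessV (Θ (τ - s) θ) (μ₀.map (Θ (τ - s)))).adjoint) ha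
    (κ := fun s θ θ' => -M.crossHessK (Θ (τ - s) θ) (Θ (τ - s) θ')) hκ
    (b := fun _ _ => 0) continuousOn_const hT₀
  have hpc : ContinuousOn (fun q : ℝ × Euc k => T (τ - q.1) q.2) (Icc 0 τ ×ˢ μ₀.support) :=
    hT.comp (f := fun q : ℝ × Euc k => (τ - q.1, q.2)) (by fun_prop) fun q hq => ⟨hrev hq.1, hq.2⟩
  refine ⟨fun s θ => T (τ - s) θ, hpc, fun θ hθ => by simp [hT0 θ hθ], fun s hs θ hθ => ?_⟩
  have h1 := HasDerivWithinAt.scomp s (hTode (τ - s) (hrev hs) θ hθ)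
    (((hasDerivAt_id s).const_sub τ).hasDerivWithinAt (s := Icc 0 τ)) hmaps
  refine h1.congr_deriv ?_
  rw [Measure.restrict_eq_self_of_ae_mem (ae_mem_support μ₀)]
  have h2 : ∫ θ', (-M.crossHessK (Θ s θ) (Θ s θ')) (T (τ - s) θ') ∂μ₀
      = -((n : ℝ)⁻¹ • ∑ l, M.adjointCoef μ₀ Θ (fun s θ => T (τ - s) θ) l s
        • M.gradφ (M.x l) (Θ s θ)) := by
    have h3 : ∀ᵐ θ' ∂μ₀, (-M.crossHessK (Θ s θ) (Θ s θ')) (T (τ - s) θ')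
        = -((n : ℝ)⁻¹ • ∑ l, (inner ℝ (M.gradφ (M.x l) (Θ s θ')) (T (τ - s) θ') : ℝ)
          • M.gradφ (M.x l) (Θ s θ)) := by
      filter_upwards [ae_mem_support μ₀] with θ' hθ'
      rw [h.regular.crossHessK_eq (h.flow.mem s hs θ hθ) (h.flow.mem s hs θ' hθ')]
      simp
    rw [integral_congr_ae h3, integral_neg, integral_smul, integral_finsetSum]
    · simp_rw [integral_smul_const]
      rfl
    · intro l _
      refine Integrable.smul_const ?_ _
      refine integrable_of_continuousOn h.isCompact (ae_mem_support μ₀) ?_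
      exact (continuousOn_slice_right (f := fun s θ => M.gradφ (M.x l) (Θ s θ)) (h.continuousOn_comp
        (h.regular.continuousOn_gradient (h.regular.data_mem l))) hs).inner
        (continuousOn_slice_right (f := fun s θ => T (τ - s) θ) hpc hs)
  simp only [sub_sub_cancel, h2, add_zero]
  simp [add_comm]

end IsSetting

/-! ### Gronwall estimates -/

/-- A Gronwall estimate in which the differential inequality is only required while `‖e t‖ ≤ ρ`,
provided that the resulting bound does not exceed `ρ`. -/
theorem norm_le_of_norm_deriv_le_of_norm_le {E : Type*} [NormedAddCommGroup E] [NormedSpace ℝ E]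
    {τ L κ ρ : ℝ} (hτ : 0 ≤ τ) (hL : 0 ≤ L) (hκ : 0 < κ) {e e' : ℝ → E} {S : ℝ → ℝ}
    (hS : ContinuousOn S (Icc 0 τ)) (hS0 : ∀ t ∈ Icc 0 τ, 0 ≤ S t)
    (he : ∀ t ∈ Icc 0 τ, HasDerivWithinAt e (e' t) (Icc 0 τ) t) (he0 : e 0 = 0)
    (hρ : Real.exp ((L + 1) * τ) * (κ + L * ∫ s in (0 : ℝ)..τ, S s) ≤ ρ)
    (hbound : ∀ t ∈ Icc 0 τ, ‖e t‖ ≤ ρ → ‖e' t‖ ≤ L * (‖e t‖ + S t)) {t : ℝ} (ht : t ∈ Icc 0 τ) :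
    ‖e t‖ ≤ Real.exp ((L + 1) * τ) * (κ + L * ∫ s in (0 : ℝ)..τ, S s) := by
  -- a continuous extension of `S` to the line
  let S₁ : ℝ → ℝ := fun s => S (projIcc 0 τ hτ s)
  have hS₁ : Continuous S₁ := hS.comp_continuous
    (continuous_subtype_val.comp continuous_projIcc) fun s => (projIcc 0 τ hτ s).2
  have hS₁0 : ∀ s, 0 ≤ S₁ s := fun s => hS0 _ (projIcc 0 τ hτ s).2
  have hSS₁ : ∀ s ∈ Icc 0 τ, S₁ s = S s := fun s hs => by simp [S₁, projIcc_of_mem hτ hs]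
  let I : ℝ → ℝ := fun t => ∫ s in (0 : ℝ)..t, S₁ s
  have hI : ∀ t, HasDerivAt I (S₁ t) t := fun t => (hS₁.integral_hasStrictDerivAt 0 t).hasDerivAt
  have hI0 : ∀ t, 0 ≤ t → 0 ≤ I t := fun t ht =>
    intervalIntegral.integral_nonneg ht fun s _ => hS₁0 s
  have hIτ : I τ = ∫ s in (0 : ℝ)..τ, S s := by
    refine intervalIntegral.integral_congr fun s hs => ?_
    rw [uIcc_of_le hτ] at hs
    exact hSS₁ s hs
  have hImono : ∀ t ∈ Icc 0 τ, I t ≤ I τ := fun t ht =>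
    intervalIntegral.integral_mono_interval le_rfl ht.1 ht.2
      (Eventually.of_forall hS₁0) (hS₁.intervalIntegrable _ _)
  let B : ℝ → ℝ := fun t => Real.exp ((L + 1) * t) * (κ + L * I t)
  have hB : ∀ t, HasDerivAt B (Real.exp ((L + 1) * t) * (L + 1) * (κ + L * I t)
      + Real.exp ((L + 1) * t) * (L * S₁ t)) t := by
    intro t
    have h1 : HasDerivAt (fun t => Real.exp ((L + 1) * t)) (Real.exp ((L + 1) * t) * (L + 1)) t := by
      simpa using ((hasDerivAt_id t).const_mul (L + 1)).exp
    exact h1.mul (((hI t).const_mul L).const_add κ)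
  have hBle : ∀ t ∈ Icc 0 τ, B t ≤ Real.exp ((L + 1) * τ) * (κ + L * I τ) := by
    intro t ht
    have h1 := hImono t ht
    have h2 := hI0 t ht.1
    have h3 := ht.2
    dsimp only [B]
    gcongr
  rw [← hIτ] at hρ ⊢
  refine (image_norm_le_of_norm_deriv_right_lt_deriv_boundary
    (fun s hs => (he s hs).continuousWithinAt)
    (fun s hs => (he s (Ico_subset_Icc_self hs)).mono_of_mem_nhdsWithin
      (Icc_mem_nhdsGE_of_mem hs)) ?_ hB ?_ ht).trans (hBle t ht)
  · have : (0 : ℝ) ≤ κ + L * I 0 := by have := hI0 0 le_rfl; positivity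
    simp only [he0, norm_zero, B]
    positivity
  · intro s hs hes
    have hs' := Ico_subset_Icc_self hs
    refine (hbound s hs' ?_).trans_lt ?_
    · rw [hes]; exact (hBle s hs').trans hρ
    · have h1 : 1 ≤ Real.exp ((L + 1) * s) := Real.one_le_exp (mul_nonneg (by linarith) hs.1)
      have h2 : 0 < κ + L * I s := by have := hI0 s hs.1; positivity
      have h3 : 0 ≤ L * S₁ s := mul_nonneg hL (hS₁0 s)
      have h4 : 0 < B s := by dsimp only [B]; positivity
      rw [hes, ← hSS₁ s hs']
      calc L * (B s + S₁ s) < (L + 1) * B s + 1 * (L * S₁ s) := by linarith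
        _ ≤ (L + 1) * B s + Real.exp ((L + 1) * s) * (L * S₁ s) := by gcongr
        _ = _ := by simp only [B]; ring

/-- A function whose derivative is bounded by `a + b w(t)` moves by at most `a τ + b ∫ w`. -/
theorem norm_sub_le_of_norm_deriv_le {E : Type*} [NormedAddCommGroup E] [NormedSpace ℝ E]
    {τ a b : ℝ} (hτ : 0 ≤ τ) {e e' : ℝ → E} {w : ℝ → ℝ} (hw : ContinuousOn w (Icc 0 τ))
    (he : ∀ t ∈ Icc 0 τ, HasDerivWithinAt e (e' t) (Icc 0 τ) t)
    (hbound : ∀ t ∈ Icc 0 τ, ‖e' t‖ ≤ a + b * w t) :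
    ‖e τ - e 0‖ ≤ a * τ + b * ∫ s in (0 : ℝ)..τ, w s := by
  let w₁ : ℝ → ℝ := fun s => w (projIcc 0 τ hτ s)
  have hw₁ : Continuous w₁ := hw.comp_continuous
    (continuous_subtype_val.comp continuous_projIcc) fun s => (projIcc 0 τ hτ s).2
  have hww₁ : ∀ s ∈ Icc 0 τ, w₁ s = w s := fun s hs => by simp [w₁, projIcc_of_mem hτ hs]
  let I : ℝ → ℝ := fun t => ∫ s in (0 : ℝ)..t, w₁ s
  have hI : ∀ t, HasDerivAt I (w₁ t) t := fun t => (hw₁.integral_hasStrictDerivAt 0 t).hasDerivAt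
  have hIτ : I τ = ∫ s in (0 : ℝ)..τ, w s := by
    refine intervalIntegral.integral_congr fun s hs => ?_
    rw [uIcc_of_le hτ] at hs
    exact hww₁ s hs
  have hB : ∀ t, HasDerivAt (fun t => a * t + b * I t) (a + b * w₁ t) t := fun t => by
    exact (((hasDerivAt_id t).const_mul a).add ((hI t).const_mul b)).congr_deriv (by simp)
  have h := image_norm_le_of_norm_deriv_right_le_deriv_boundary (f := fun t => e t - e 0)
    (f' := e') (fun s hs => ((he s hs).sub_const (e 0)).continuousWithinAt)
    (fun s hs => ((he s (Ico_subset_Icc_self hs)).sub_const (e 0)).mono_of_mem_nhdsWithin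
      (Icc_mem_nhdsGE_of_mem hs)) (by simp [I]) hB
    (fun s hs => by rw [hww₁ s (Ico_subset_Icc_self hs)]; exact hbound s (Ico_subset_Icc_self hs))
    (right_mem_Icc.2 hτ)
  rwa [hIτ] at h

/-! ### Sample averages and the remainder of the drift -/

theorem norm_mean_le {E : Type*} [SeminormedAddCommGroup E] [NormedSpace ℝ E] {n : ℕ} (a : Fin n → E) :
    ‖(n : ℝ)⁻¹ • ∑ l, a l‖ ≤ (n : ℝ)⁻¹ * ∑ l, ‖a l‖ := by
  rw [norm_smul, Real.norm_of_nonneg (by positivity)]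
  gcongr
  exact norm_sum_le _ _

theorem mean_le {n : ℕ} {a : Fin n → ℝ} {b : ℝ} (hb : 0 ≤ b) (h : ∀ l, a l ≤ b) :
    (n : ℝ)⁻¹ * ∑ l, a l ≤ b := by
  rcases Nat.eq_zero_or_pos n with rfl | hn
  · simpa using hb
  · have h1 : ∑ l, a l ≤ n * b := by simpa using Finset.sum_le_sum fun l (_ : l ∈ Finset.univ) => h l
    rw [inv_mul_le_iff₀ (by exact_mod_cast hn)]
    exact h1

theorem norm_mean_le_of_le {E : Type*} [SeminormedAddCommGroup E] [NormedSpace ℝ E] {n : ℕ}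
    {a : Fin n → E} {b : ℝ} (hb : 0 ≤ b) (h : ∀ l, ‖a l‖ ≤ b) : ‖(n : ℝ)⁻¹ • ∑ l, a l‖ ≤ b :=
  (norm_mean_le a).trans (mean_le hb h)

theorem abs_mean_le_of_le {n : ℕ} {a : Fin n → ℝ} {b : ℝ} (hb : 0 ≤ b) (h : ∀ l, |a l| ≤ b) :
    |(n : ℝ)⁻¹ * ∑ l, a l| ≤ b := norm_mean_le_of_le (E := ℝ) hb h

theorem mean_sq_le {n : ℕ} (a : Fin n → ℝ) : ((n : ℝ)⁻¹ * ∑ l, |a l|) ^ 2 ≤ ∑ l, a l ^ 2 := by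
  have h0 : 0 ≤ ∑ l, a l ^ 2 := Finset.sum_nonneg fun l _ => sq_nonneg _
  have h1 : (n : ℝ)⁻¹ * ∑ l, |a l| ≤ Real.sqrt (∑ l, a l ^ 2) :=
    mean_le (Real.sqrt_nonneg _) fun l => Real.abs_le_sqrt
      (Finset.single_le_sum (f := fun l => a l ^ 2) (fun l _ => sq_nonneg _) (Finset.mem_univ l))
  have h2 : 0 ≤ (n : ℝ)⁻¹ * ∑ l, |a l| := by positivity
  calc _ ≤ Real.sqrt (∑ l, a l ^ 2) ^ 2 := by gcongr
    _ = _ := Real.sq_sqrt h0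

/-- The deviation `(1/m) ∑ᵢ χ(vᵢ) - ∫ χ dμ` of a sample average from its mean. -/
noncomputable def sampleDev {k m : ℕ} (μ : Measure (Euc k)) (v : Fin m → Euc k) (χ : Euc k → ℝ) : ℝ :=
  (m : ℝ)⁻¹ * ∑ i, χ (v i) - ∫ θ, χ θ ∂μ

/-- First-order expansion of the drift `∇F - n⁻¹ ∑_l u_l ∇φ_l` of a particle, when its position is
displaced by `e` and the outputs `u` change by `v`. Here `a`, `g` are the values of `∇F`, `∇φ_l` at the
original position and `b`, `h` those at the displaced one, with derivatives `A`, `H`. -/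
theorem norm_drift_remainder_le {V : Type*} [NormedAddCommGroup V] [NormedSpace ℝ V] {n : ℕ}
    {a b e : V} {A : V →L[ℝ] V} {g h : Fin n → V} {H : Fin n → V →L[ℝ] V} {u v : Fin n → ℝ}
    {C η E : ℝ} (hη : 0 ≤ η) (hE : 0 ≤ E) (hab : ‖b - a - A e‖ ≤ η * E)
    (hgh : ∀ l, ‖h l - g l - H l e‖ ≤ η * E) (hL : ∀ l, ‖h l - g l‖ ≤ C * E)
    (hu : ∀ l, |u l| + 1 ≤ C) (hC : 1 ≤ C) :
    ‖(b - (n : ℝ)⁻¹ • ∑ l, (u l + v l) • h l) - (a - (n : ℝ)⁻¹ • ∑ l, u l • g l)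
        - (A e - (n : ℝ)⁻¹ • ∑ l, u l • H l e) + (n : ℝ)⁻¹ • ∑ l, v l • g l‖
      ≤ C * η * E + C * E * ((n : ℝ)⁻¹ * ∑ l, |v l|) := by
  have heq : (b - (n : ℝ)⁻¹ • ∑ l, (u l + v l) • h l) - (a - (n : ℝ)⁻¹ • ∑ l, u l • g l)
        - (A e - (n : ℝ)⁻¹ • ∑ l, u l • H l e) + (n : ℝ)⁻¹ • ∑ l, v l • g l
      = (b - a - A e) - (n : ℝ)⁻¹ • ∑ l, u l • (h l - g l - H l e)
        - (n : ℝ)⁻¹ • ∑ l, v l • (h l - g l) := by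
    simp only [add_smul, smul_sub, Finset.sum_add_distrib, Finset.sum_sub_distrib, smul_add]
    abel
  have h1 : ‖(n : ℝ)⁻¹ • ∑ l, u l • (h l - g l - H l e)‖ ≤ (C - 1) * (η * E) := by
    refine norm_mean_le_of_le (mul_nonneg (by linarith) (by positivity)) fun l => ?_
    rw [norm_smul, Real.norm_eq_abs]
    have := hu l
    gcongr
    · linarith
    · exact hgh l
  have h2 : ‖(n : ℝ)⁻¹ • ∑ l, v l • (h l - g l)‖ ≤ C * E * ((n : ℝ)⁻¹ * ∑ l, |v l|) := by
    refine (norm_mean_le _).trans ?_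
    have h3 : ∑ l, ‖v l • (h l - g l)‖ ≤ C * E * ∑ l, |v l| := by
      rw [Finset.mul_sum]
      refine Finset.sum_le_sum fun l _ => ?_
      rw [norm_smul, Real.norm_eq_abs, mul_comm]
      gcongr
      exact hL l
    rw [mul_left_comm]
    gcongr
  rw [heq]
  calc _ ≤ ‖b - a - A e‖ + ‖(n : ℝ)⁻¹ • ∑ l, u l • (h l - g l - H l e)‖
        + ‖(n : ℝ)⁻¹ • ∑ l, v l • (h l - g l)‖ :=
        (norm_sub_le _ _).trans (by gcongr; exact norm_sub_le _ _)
    _ ≤ η * E + (C - 1) * (η * E) + C * E * ((n : ℝ)⁻¹ * ∑ l, |v l|) := by gcongr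
    _ = _ := by ring

/-! ### Expansion of the particle system around the mean-field flow -/

section Expansion

variable {k d n : ℕ} {M : Model k d n} {μ₀ : Measure (Euc k)} [IsProbabilityMeasure μ₀] {τ : ℝ}
  {Θ p : ℝ → Euc k → Euc k} {x : Euc d}

/-- The displacement `ρ` is small enough for the first-order Taylor expansions around the points of
the mean-field flow to hold with relative error `η`. -/
structure IsTaylorRadius (M : Model k d n) (μ₀ : Measure (Euc k)) (τ : ℝ) (Θ : ℝ → Euc k → Euc k)
    (x : Euc d) (η ρ : ℝ) : Prop where
  target : ∀ s ∈ Icc 0 τ, ∀ θ ∈ μ₀.support, ∀ y, ‖y - Θ s θ‖ ≤ ρ →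
    ‖M.φ y x - M.φ (Θ s θ) x - inner ℝ (M.gradφ x (Θ s θ)) (y - Θ s θ)‖ ≤ η * ‖y - Θ s θ‖
  data : ∀ l, ∀ s ∈ Icc 0 τ, ∀ θ ∈ μ₀.support, ∀ y, ‖y - Θ s θ‖ ≤ ρ →
    ‖M.φ y (M.x l) - M.φ (Θ s θ) (M.x l) - inner ℝ (M.gradφ (M.x l) (Θ s θ)) (y - Θ s θ)‖
      ≤ η * ‖y - Θ s θ‖
  grad : ∀ l, ∀ s ∈ Icc 0 τ, ∀ θ ∈ μ₀.support, ∀ y, ‖y - Θ s θ‖ ≤ ρ →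
    ‖M.gradφ (M.x l) y - M.gradφ (M.x l) (Θ s θ) - M.hessφ (M.x l) (Θ s θ) (y - Θ s θ)‖
      ≤ η * ‖y - Θ s θ‖
  gradF : ∀ s ∈ Icc 0 τ, ∀ θ ∈ μ₀.support, ∀ y, ‖y - Θ s θ‖ ≤ ρ →
    ‖∇ M.F y - ∇ M.F (Θ s θ) - hess M.F (Θ s θ) (y - Θ s θ)‖ ≤ η * ‖y - Θ s θ‖

/-- `C` bounds, with some room, the quantities attached to the mean-field flow and to the adjoint
field `p`. -/
structure IsFlowBound (M : Model k d n) (μ₀ : Measure (Euc k)) (τ : ℝ) (Θ p : ℝ → Euc k → Euc k)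
    (C : ℝ) : Prop where
  one_le : 1 ≤ C
  grad : ∀ l, ∀ s ∈ Icc 0 τ, ∀ θ ∈ μ₀.support, ‖M.gradφ (M.x l) (Θ s θ)‖ + 1 ≤ C
  hess : ∀ l, ∀ s ∈ Icc 0 τ, ∀ θ ∈ μ₀.support, ‖M.hessφ (M.x l) (Θ s θ)‖ + 1 ≤ C
  hessV : ∀ s ∈ Icc 0 τ, ∀ θ ∈ μ₀.support, ‖M.hessV (Θ s θ) (μ₀.map (Θ s))‖ + 1 ≤ C
  adjoint : ∀ s ∈ Icc 0 τ, ∀ θ ∈ μ₀.support, ‖p s θ‖ + 1 ≤ C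
  output : ∀ l, ∀ s ∈ Icc 0 τ, |M.f (μ₀.map (Θ s)) (M.x l)| + 1 ≤ C
  coef : ∀ l, ∀ s ∈ Icc 0 τ, |M.adjointCoef μ₀ Θ p l s| + 1 ≤ C

omit [IsProbabilityMeasure μ₀] in
theorem IsSetting.eventually_taylor (h : IsSetting M μ₀ τ Θ) {E : Type*} [NormedAddCommGroup E]
    [NormedSpace ℝ E] {f : Euc k → E} {f' : Euc k → Euc k →L[ℝ] E}
    (hf : ∀ y ∈ M.D, HasFDerivAt f (f' y) y) (hf' : ContinuousOn f' M.D) {η : ℝ} (hη : 0 < η) :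
    ∀ᶠ ρ in 𝓝[>] (0 : ℝ), ∀ s ∈ Icc 0 τ, ∀ θ ∈ μ₀.support, ∀ y, ‖y - Θ s θ‖ ≤ ρ →
      ‖f y - f (Θ s θ) - f' (Θ s θ) (y - Θ s θ)‖ ≤ η * ‖y - Θ s θ‖ := by
  have hΓ : IsCompact ((fun p : ℝ × Euc k => Θ p.1 p.2) '' (Icc 0 τ ×ˢ μ₀.support)) :=
    (isCompact_Icc.prod h.isCompact).image_of_continuousOn h.flow.continuousOn
  obtain ⟨ρ, hρ, hT⟩ := exists_taylor_uniform h.regular.isOpen_D hΓ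
    (by rintro _ ⟨p, hp, rfl⟩; exact h.flow.mem p.1 hp.1 p.2 hp.2) hf hf' hη
  filter_upwards [Ioc_mem_nhdsGT hρ] with ρ' hρ' s hs θ hθ y hy
  exact hT _ ⟨(s, θ), ⟨hs, hθ⟩, rfl⟩ y (hy.trans hρ'.2)

omit [IsProbabilityMeasure μ₀] in
theorem IsSetting.exists_isTaylorRadius (h : IsSetting M μ₀ τ Θ) (hx : x ∈ M.Ω) {η : ℝ}
    (hη : 0 < η) : ∃ ρ, 0 < ρ ∧ ρ ≤ 1 ∧ IsTaylorRadius M μ₀ τ Θ x η ρ := by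
  have hφ : ∀ {y : Euc d}, y ∈ M.Ω → ContinuousOn (fun θ => innerSL ℝ (M.gradφ y θ)) M.D :=
    fun {y} hy => (innerSL ℝ).continuous.comp_continuousOn (h.regular.continuousOn_gradient hy)
  have h1 := h.eventually_taylor (fun y hy => h.regular.hasFDerivAt hx hy) (hφ hx) hη
  have h2 := eventually_all.2 fun l => h.eventually_taylor
    (fun y hy => h.regular.hasFDerivAt (h.regular.data_mem l) hy) (hφ (h.regular.data_mem l)) hη
  have h3 := eventually_all.2 fun l => h.eventually_taylor
    (fun y hy => h.regular.hasFDerivAt_gradient (h.regular.data_mem l) hy)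
    (h.regular.continuousOn_hess (h.regular.data_mem l)) hη
  have h4 := h.eventually_taylor (fun y hy => h.regular.hasFDerivAt_gradient_F hy)
    h.regular.continuousOn_hess_F hη
  obtain ⟨ρ, hρ⟩ := (h1.and (h2.and (h3.and (h4.and (Ioc_mem_nhdsGT (zero_lt_one' ℝ)))))).exists
  exact ⟨ρ, hρ.2.2.2.2.1, hρ.2.2.2.2.2, ⟨hρ.1, hρ.2.1, hρ.2.2.1, hρ.2.2.2.1⟩⟩

theorem _root_.IsCompact.eventually_norm_add_one_le {X E : Type*} [TopologicalSpace X]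
    [SeminormedAddCommGroup E] {s : Set X} (hs : IsCompact s) {f : X → E} (hf : ContinuousOn f s) :
    ∀ᶠ C in atTop, ∀ y ∈ s, ‖f y‖ + 1 ≤ C := by
  obtain ⟨C, hC⟩ := hs.exists_bound_of_continuousOn hf
  filter_upwards [eventually_ge_atTop (C + 1)] with C' hC' y hy
  linarith [hC y hy]

theorem IsSetting.exists_isFlowBound (h : IsSetting M μ₀ τ Θ) (hp : M.IsAdjointFlow μ₀ τ Θ x p) :
    ∃ C, IsFlowBound M μ₀ τ Θ p C := by
  have hK : IsCompact (Icc 0 τ ×ˢ μ₀.support) := isCompact_Icc.prod h.isCompact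
  have h1 := eventually_all.2 fun l => hK.eventually_norm_add_one_le
    (h.continuousOn_comp (h.regular.continuousOn_gradient (h.regular.data_mem l)))
  have h2 := eventually_all.2 fun l => hK.eventually_norm_add_one_le
    (h.continuousOn_comp (h.regular.continuousOn_hess (h.regular.data_mem l)))
  have h3 := hK.eventually_norm_add_one_le h.continuousOn_hessV
  have h4 := hK.eventually_norm_add_one_le hp.continuousOn
  have h5 := eventually_all.2 fun l => isCompact_Icc.eventually_norm_add_one_le
    (h.continuousOn_f_map (h.regular.data_mem l))
  have h6 := eventually_all.2 fun l => isCompact_Icc.eventually_norm_add_one_le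
    (h.continuousOn_adjointCoef hp l)
  obtain ⟨C, ⟨⟨⟨⟨⟨h1, h2⟩, h3⟩, h4⟩, h5⟩, h6⟩, h7⟩ := ((((((h1.and h2).and h3).and h4).and h5).and
    h6).and (eventually_ge_atTop 1)).exists
  exact ⟨C, h7, fun l s hs θ hθ => h1 l (s, θ) ⟨hs, hθ⟩, fun l s hs θ hθ => h2 l (s, θ) ⟨hs, hθ⟩,
    fun s hs θ hθ => h3 (s, θ) ⟨hs, hθ⟩, fun s hs θ hθ => h4 (s, θ) ⟨hs, hθ⟩, h5, h6⟩

variable {C η ρ E s : ℝ} {m : ℕ} {z Y : Fin m → Euc k}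

omit [IsProbabilityMeasure μ₀] in
/-- Expansion of the output at `y` of a displaced sample: the sampling error, plus the first-order
effect of the displacements. -/
theorem IsSetting.abs_output_remainder_le (h : IsSetting M μ₀ τ Θ) (hs : s ∈ Icc 0 τ) {y : Euc d}
    (hy : y ∈ M.Ω) (hz : ∀ i, z i ∈ μ₀.support) (hη : 0 ≤ η) (hE0 : 0 ≤ E)
    (hE : ∀ i, ‖Y i - Θ s (z i)‖ ≤ E) (hEρ : E ≤ ρ)
    (hT : ∀ s ∈ Icc 0 τ, ∀ θ ∈ μ₀.support, ∀ y', ‖y' - Θ s θ‖ ≤ ρ →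
      ‖M.φ y' y - M.φ (Θ s θ) y - inner ℝ (M.gradφ y (Θ s θ)) (y' - Θ s θ)‖ ≤ η * ‖y' - Θ s θ‖) :
    |M.f (empiricalMeasure Y) y - M.f (μ₀.map (Θ s)) y
      - sampleDev μ₀ z (fun θ => M.φ (Θ s θ) y)
      - (m : ℝ)⁻¹ * ∑ i, inner ℝ (M.gradφ y (Θ s (z i))) (Y i - Θ s (z i))| ≤ η * E := by
  have heq : M.f (empiricalMeasure Y) y - M.f (μ₀.map (Θ s)) y
      - sampleDev μ₀ z (fun θ => M.φ (Θ s θ) y)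
      - (m : ℝ)⁻¹ * ∑ i, inner ℝ (M.gradφ y (Θ s (z i))) (Y i - Θ s (z i))
      = (m : ℝ)⁻¹ * ∑ i, (M.φ (Y i) y - M.φ (Θ s (z i)) y
        - inner ℝ (M.gradφ y (Θ s (z i))) (Y i - Θ s (z i))) := by
    rw [h.f_map_eq hs hy, Model.f, integral_empiricalMeasure, sampleDev]
    simp only [Finset.sum_sub_distrib]
    ring
  rw [heq]
  refine abs_mean_le_of_le (by positivity) fun i => ?_
  refine (hT s hs (z i) (hz i) (Y i) ((hE i).trans hEρ)).trans ?_
  gcongr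
  exact hE i

omit [IsProbabilityMeasure μ₀] in
theorem IsSetting.abs_output_sub_le (h : IsSetting M μ₀ τ Θ) (hC : IsFlowBound M μ₀ τ Θ p C)
    (hT : IsTaylorRadius M μ₀ τ Θ x η ρ) (hs : s ∈ Icc 0 τ) (hz : ∀ i, z i ∈ μ₀.support)
    (hη : 0 ≤ η) (hη1 : η ≤ 1) (hE0 : 0 ≤ E) (hE : ∀ i, ‖Y i - Θ s (z i)‖ ≤ E) (hEρ : E ≤ ρ)
    (l : Fin n) :
    |M.f (empiricalMeasure Y) (M.x l) - M.f (μ₀.map (Θ s)) (M.x l)|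
      ≤ |sampleDev μ₀ z (fun θ => M.φ (Θ s θ) (M.x l))| + C * E := by
  have h1 := h.abs_output_remainder_le hs (h.regular.data_mem l) hz hη hE0 hE hEρ (hT.data l)
  have h2 : |(m : ℝ)⁻¹ * ∑ i, inner ℝ (M.gradφ (M.x l) (Θ s (z i))) (Y i - Θ s (z i))|
      ≤ (C - 1) * E := by
    have hC1 := hC.one_le
    refine abs_mean_le_of_le (mul_nonneg (by linarith) hE0) fun i => ?_
    refine (abs_real_inner_le_norm _ _).trans ?_
    have := hC.grad l s hs (z i) (hz i)
    gcongr
    · linarith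
    · exact hE i
  have h3 : η * E ≤ E := mul_le_of_le_one_left hE0 hη1
  rw [abs_le] at h1 h2
  have h4 := abs_le.1 (le_refl |sampleDev μ₀ z (fun θ => M.φ (Θ s θ) (M.x l))|)
  rw [abs_le]
  constructor <;> linarith [h1.1, h1.2, h2.1, h2.2, h4.1, h4.2]

/-- Expansion of the velocity of a displaced particle. -/
theorem IsSetting.norm_velocity_remainder_le (h : IsSetting M μ₀ τ Θ)
    (hC : IsFlowBound M μ₀ τ Θ p C) (hT : IsTaylorRadius M μ₀ τ Θ x η ρ) (hs : s ∈ Icc 0 τ)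
    (hz : ∀ i, z i ∈ μ₀.support) (hYD : ∀ i, Y i ∈ M.D) (hη : 0 ≤ η) (hη1 : η ≤ 1)
    (hE0 : 0 ≤ E) (hE : ∀ i, ‖Y i - Θ s (z i)‖ ≤ E) (hEρ : E ≤ ρ) (i : Fin m) :
    ‖(-M.gradV (Y i) (empiricalMeasure Y)) - (-M.gradV (Θ s (z i)) (μ₀.map (Θ s)))
        + M.hessV (Θ s (z i)) (μ₀.map (Θ s)) (Y i - Θ s (z i))
        + (n : ℝ)⁻¹ • ∑ l, (M.f (empiricalMeasure Y) (M.x l) - M.f (μ₀.map (Θ s)) (M.x l))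
          • M.gradφ (M.x l) (Θ s (z i))‖
      ≤ C * η * E + C * E * ((n : ℝ)⁻¹ *
        ∑ l, |M.f (empiricalMeasure Y) (M.x l) - M.f (μ₀.map (Θ s)) (M.x l)|) := by
  have hX := h.flow.mem s hs (z i) (hz i)
  have hi := (hE i).trans hEρ
  have hstep : η * ‖Y i - Θ s (z i)‖ ≤ η * E := by gcongr; exact hE i
  have h1 := norm_drift_remainder_le (a := ∇ M.F (Θ s (z i))) (b := ∇ M.F (Y i))
    (e := Y i - Θ s (z i)) (A := hess M.F (Θ s (z i)))
    (g := fun l => M.gradφ (M.x l) (Θ s (z i))) (h := fun l => M.gradφ (M.x l) (Y i))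
    (H := fun l => M.hessφ (M.x l) (Θ s (z i)))
    (u := fun l => M.f (μ₀.map (Θ s)) (M.x l))
    (v := fun l => M.f (empiricalMeasure Y) (M.x l) - M.f (μ₀.map (Θ s)) (M.x l))
    (C := C) hη hE0 ((hT.gradF s hs (z i) (hz i) (Y i) hi).trans hstep)
    (fun l => (hT.grad l s hs (z i) (hz i) (Y i) hi).trans hstep) (fun l => ?_)
    (fun l => hC.output l s hs) hC.one_le
  · refine (congrArg norm ?_).trans_le h1
    rw [h.gradV_eq hs hX, h.hessV_eq hs hX,
      h.regular.gradV_eq (hYD i) fun l => integrable_empiricalMeasure _ _]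
    simp only [add_sub_cancel, add_apply, neg_apply, smul_apply, sum_apply]
    abel
  · have h2 := hT.grad l s hs (z i) (hz i) (Y i) hi
    have h3 := (M.hessφ (M.x l) (Θ s (z i))).le_opNorm (Y i - Θ s (z i))
    have h4 := hC.hess l s hs (z i) (hz i)
    calc ‖M.gradφ (M.x l) (Y i) - M.gradφ (M.x l) (Θ s (z i))‖
        ≤ ‖M.gradφ (M.x l) (Y i) - M.gradφ (M.x l) (Θ s (z i))
            - M.hessφ (M.x l) (Θ s (z i)) (Y i - Θ s (z i))‖
          + ‖M.hessφ (M.x l) (Θ s (z i)) (Y i - Θ s (z i))‖ := by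
          rw [add_comm]; exact norm_le_insert' _ _
      _ ≤ 1 * ‖Y i - Θ s (z i)‖ + ‖M.hessφ (M.x l) (Θ s (z i))‖ * ‖Y i - Θ s (z i)‖ := by
          gcongr
          exact h2.trans (by gcongr)
      _ = (‖M.hessφ (M.x l) (Θ s (z i))‖ + 1) * ‖Y i - Θ s (z i)‖ := by ring
      _ ≤ C * E := by
          have := hC.one_le
          gcongr
          exact hE i

/-- A priori bound for the velocity of the displacement of a particle. -/
theorem IsSetting.norm_velocity_sub_le (h : IsSetting M μ₀ τ Θ)
    (hC : IsFlowBound M μ₀ τ Θ p C) (hT : IsTaylorRadius M μ₀ τ Θ x η ρ) (hs : s ∈ Icc 0 τ)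
    (hz : ∀ i, z i ∈ μ₀.support) (hYD : ∀ i, Y i ∈ M.D) (hη : 0 ≤ η) (hη1 : η ≤ 1)
    (hE0 : 0 ≤ E) (hE1 : E ≤ 1) (hE : ∀ i, ‖Y i - Θ s (z i)‖ ≤ E) (hEρ : E ≤ ρ) (i : Fin m) :
    ‖(-M.gradV (Y i) (empiricalMeasure Y)) - (-M.gradV (Θ s (z i)) (μ₀.map (Θ s)))‖
      ≤ 4 * C ^ 2 * (E + (n : ℝ)⁻¹ * ∑ l, |sampleDev μ₀ z (fun θ => M.φ (Θ s θ) (M.x l))|) := by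
  have hC1 := hC.one_le
  set S := (n : ℝ)⁻¹ * ∑ l, |sampleDev μ₀ z (fun θ => M.φ (Θ s θ) (M.x l))| with hS
  have hS0 : 0 ≤ S := by positivity
  set W := (n : ℝ)⁻¹ * ∑ l, |M.f (empiricalMeasure Y) (M.x l) - M.f (μ₀.map (Θ s)) (M.x l)| with hW
  have hWS : W ≤ S + C * E := by
    have h1 : W ≤ (n : ℝ)⁻¹ * ∑ l, (|sampleDev μ₀ z (fun θ => M.φ (Θ s θ) (M.x l))| + C * E) := by
      rw [hW]
      gcongr with l
      exact h.abs_output_sub_le hC hT hs hz hη hη1 hE0 hE hEρ l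
    refine h1.trans_eq ?_
    have := h.regular.data_ne_zero
    rw [Finset.sum_add_distrib, mul_add, ← hS]
    simp
    field_simp
  have h1 := h.norm_velocity_remainder_le hC hT hs hz hYD hη hη1 hE0 hE hEρ i
  rw [← hW] at h1
  have h2 : ‖M.hessV (Θ s (z i)) (μ₀.map (Θ s)) (Y i - Θ s (z i))‖ ≤ C * E := by
    refine ((M.hessV (Θ s (z i)) (μ₀.map (Θ s))).le_opNorm _).trans ?_
    have := hC.hessV s hs (z i) (hz i)
    gcongr
    · linarith
    · exact hE i
  have h3 : ‖(n : ℝ)⁻¹ • ∑ l, (M.f (empiricalMeasure Y) (M.x l) - M.f (μ₀.map (Θ s)) (M.x l))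
      • M.gradφ (M.x l) (Θ s (z i))‖ ≤ C * W := by
    refine (norm_mean_le _).trans ?_
    rw [hW, mul_left_comm, Finset.mul_sum Finset.univ _ C]
    gcongr with l
    rw [norm_smul, Real.norm_eq_abs, mul_comm]
    have := hC.grad l s hs (z i) (hz i)
    gcongr
    linarith
  have h4 : ∀ a b c : Euc k, ‖a‖ ≤ ‖a + b + c‖ + ‖b‖ + ‖c‖ := fun a b c => by
    have : a = (a + b + c) - b - c := by abel
    calc ‖a‖ = ‖(a + b + c) - b - c‖ := by rw [← this]
      _ ≤ _ := (norm_sub_le _ _).trans (by gcongr; exact norm_sub_le _ _)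
  refine (h4 _ _ _).trans ((add_le_add_three h1 h2 h3).trans ?_)
  have h5 : C * η * E ≤ C * E := by
    have : η * E ≤ 1 * E := by gcongr
    nlinarith
  have h6 : C * E * W ≤ C * W := by
    have : 0 ≤ W := by positivity
    have h7 : E * W ≤ 1 * W := by gcongr
    nlinarith
  have h7 : C * W ≤ C * (S + C * E) := by gcongr
  have h8 : C ≤ C ^ 2 := by nlinarith
  nlinarith [mul_le_mul_of_nonneg_right h8 hE0, mul_le_mul_of_nonneg_right h8 hS0]

end Expansion

/-! ### Displacements of the particles and their pairing with the adjoint field -/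

section Displacement

variable {k d n : ℕ} {M : Model k d n} {μ₀ : Measure (Euc k)} [IsProbabilityMeasure μ₀] {τ : ℝ}
  {Θ p : ℝ → Euc k → Euc k} {x : Euc d} {C η ρ κ : ℝ} {m : ℕ} {z : Fin m → Euc k}
  {Y : Fin m → ℝ → Euc k}

/-- A solution of the particle gradient flow on `[0, τ]` with the deterministic starting points
`z i`. -/
structure IsParticlePath (M : Model k d n) (τ : ℝ) (z : Fin m → Euc k) (Y : Fin m → ℝ → Euc k) :
    Prop where
  init : ∀ i, Y i 0 = z i
  mem : ∀ t ∈ Icc 0 τ, ∀ i, Y i t ∈ M.D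
  ode : ∀ t ∈ Icc 0 τ, ∀ i, HasDerivWithinAt (Y i)
    (-M.gradV (Y i t) (empiricalMeasure fun j => Y j t)) (Icc 0 τ) t

/-- The sum of the squared sampling errors, at time `s`, of the functions `φ(Θ_s(·), x_l)` and
`∇φ(Θ_s(·), x_l) · p_s(·)`. Its time integral controls the fluctuations of the particle system. -/
noncomputable def samplingError (M : Model k d n) (μ₀ : Measure (Euc k)) (Θ p : ℝ → Euc k → Euc k)
    (z : Fin m → Euc k) (s : ℝ) : ℝ :=
  ∑ l, (sampleDev μ₀ z (fun θ => M.φ (Θ s θ) (M.x l)) ^ 2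
    + sampleDev μ₀ z (fun θ => inner ℝ (M.gradφ (M.x l) (Θ s θ)) (p s θ)) ^ 2)

theorem continuousOn_sampleDev (hB : IsCompact μ₀.support) (hz : ∀ i, z i ∈ μ₀.support)
    {ψ : ℝ → Euc k → ℝ}
    (hψ : ContinuousOn (fun q : ℝ × Euc k => ψ q.1 q.2) (Icc 0 τ ×ˢ μ₀.support)) :
    ContinuousOn (fun s => sampleDev μ₀ z (ψ s)) (Icc 0 τ) := by
  have h1 := continuousOn_integral hB (ae_mem_support μ₀) hψ
  have h2 : ∀ i, ContinuousOn (fun s => ψ s (z i)) (Icc 0 τ) := fun i =>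
    continuousOn_slice_left hψ (hz i)
  unfold sampleDev
  fun_prop

theorem IsSetting.continuousOn_sampleDev_φ (h : IsSetting M μ₀ τ Θ) (hz : ∀ i, z i ∈ μ₀.support)
    (l : Fin n) :
    ContinuousOn (fun s => sampleDev μ₀ z (fun θ => M.φ (Θ s θ) (M.x l))) (Icc 0 τ) :=
  continuousOn_sampleDev h.isCompact hz (ψ := fun s θ => M.φ (Θ s θ) (M.x l))
    (h.continuousOn_comp (h.regular.continuousOn (h.regular.data_mem l)))

theorem IsSetting.continuousOn_samplingError (h : IsSetting M μ₀ τ Θ)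
    (hp : M.IsAdjointFlow μ₀ τ Θ x p) (hz : ∀ i, z i ∈ μ₀.support) :
    ContinuousOn (samplingError M μ₀ Θ p z) (Icc 0 τ) := by
  have h1 : ∀ l, ContinuousOn
      (fun s => sampleDev μ₀ z (fun θ => M.φ (Θ s θ) (M.x l)) ^ 2) (Icc 0 τ) := fun l =>
    (h.continuousOn_sampleDev_φ hz l).pow 2
  have h2 : ∀ l, ContinuousOn (fun s =>
      sampleDev μ₀ z (fun θ => inner ℝ (M.gradφ (M.x l) (Θ s θ)) (p s θ)) ^ 2) (Icc 0 τ) := fun l =>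
    (continuousOn_sampleDev h.isCompact hz
      (ψ := fun s θ => inner ℝ (M.gradφ (M.x l) (Θ s θ)) (p s θ))
      (h.continuousOn_inner_gradφ hp l)).pow 2
  exact continuousOn_finsetSum _ fun l _ => (h1 l).add (h2 l)

/-- The rate in the Gronwall estimate for the displacements. -/
noncomputable def displacementConst (C τ : ℝ) : ℝ :=
  Real.exp ((4 * C ^ 2 + 1) * τ) * (1 + 4 * C ^ 2 * (τ + 1))

theorem displacementConst_pos (hτ : 0 ≤ τ) : 0 < displacementConst C τ := by
  unfold displacementConst
  positivity

omit [IsProbabilityMeasure μ₀] in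
theorem IsSetting.hasDerivWithinAt_displacement (h : IsSetting M μ₀ τ Θ)
    (hY : IsParticlePath M τ z Y) (hz : ∀ i, z i ∈ μ₀.support) {s : ℝ} (hs : s ∈ Icc 0 τ)
    (i : Fin m) : HasDerivWithinAt (fun s => Y i s - Θ s (z i))
      ((-M.gradV (Y i s) (empiricalMeasure fun j => Y j s))
        - (-M.gradV (Θ s (z i)) (μ₀.map (Θ s)))) (Icc 0 τ) s :=
  (hY.ode s hs i).sub (h.flow.ode s hs (z i) (hz i))

/-- The particles stay close to the mean-field trajectories with the same starting points. -/
theorem IsSetting.norm_displacement_le (h : IsSetting M μ₀ τ Θ) (hp : M.IsAdjointFlow μ₀ τ Θ x p)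
    (hC : IsFlowBound M μ₀ τ Θ p C) (hT : IsTaylorRadius M μ₀ τ Θ x η ρ)
    (hz : ∀ i, z i ∈ μ₀.support) (hη : 0 ≤ η) (hη1 : η ≤ 1) (hρ1 : ρ ≤ 1) (hκ : 0 < κ)
    (hκρ : displacementConst C τ * κ ≤ ρ) (hY : IsParticlePath M τ z Y)
    (hW : ∫ s in (0 : ℝ)..τ, samplingError M μ₀ Θ p z s ≤ κ ^ 2) {s : ℝ} (hs : s ∈ Icc 0 τ)
    (i : Fin m) : ‖Y i s - Θ s (z i)‖ ≤ displacementConst C τ * κ := by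
  have hτ := h.nonneg
  let S : ℝ → ℝ := fun s => (n : ℝ)⁻¹ * ∑ l, |sampleDev μ₀ z (fun θ => M.φ (Θ s θ) (M.x l))|
  have hS0 : ∀ s, 0 ≤ S s := fun s => by positivity
  have hSc : ContinuousOn S (Icc 0 τ) := by
    have h1 := fun l => (h.continuousOn_sampleDev_φ hz l).abs
    fun_prop
  have hWc := h.continuousOn_samplingError hp hz
  have hSW : ∀ s, S s ^ 2 ≤ samplingError M μ₀ Θ p z s := fun s =>
    (mean_sq_le _).trans (Finset.sum_le_sum fun l _ => le_add_of_nonneg_right (sq_nonneg _))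
  have hSint : ∫ s in (0 : ℝ)..τ, S s ≤ κ * (τ + 1) := by
    have h1 : ∫ s in (0 : ℝ)..τ, S s
        ≤ ∫ s in (0 : ℝ)..τ, (κ + κ⁻¹ * samplingError M μ₀ Θ p z s) := by
      refine intervalIntegral.integral_mono_on hτ (hSc.intervalIntegrable_of_Icc hτ)
        (ContinuousOn.intervalIntegrable_of_Icc hτ (by fun_prop)) fun s hs => ?_
      -- the integral of `S` is bounded through that of `S²`, by Young's inequality
      have h2 : κ * S s ≤ κ ^ 2 + S s ^ 2 := by nlinarith [sq_nonneg (κ - S s), hS0 s, hκ.le]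
      have h3 : S s ≤ κ⁻¹ * (κ ^ 2 + samplingError M μ₀ Θ p z s) := by
        rw [le_inv_mul_iff₀ hκ]
        linarith [hSW s]
      refine h3.trans_eq ?_
      field_simp
    refine h1.trans ?_
    rw [intervalIntegral.integral_add (by simp)
      (ContinuousOn.intervalIntegrable_of_Icc hτ (by fun_prop)),
      intervalIntegral.integral_const_mul]
    have h4 : κ⁻¹ * ∫ s in (0 : ℝ)..τ, samplingError M μ₀ Θ p z s ≤ κ⁻¹ * κ ^ 2 := by gcongr
    have h5 : κ⁻¹ * κ ^ 2 = κ := by field_simp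
    simp only [intervalIntegral.integral_const, sub_zero, smul_eq_mul]
    linarith
  have hle : Real.exp ((4 * C ^ 2 + 1) * τ) * (κ + 4 * C ^ 2 * ∫ s in (0 : ℝ)..τ, S s)
      ≤ displacementConst C τ * κ := by
    rw [displacementConst, mul_assoc (Real.exp _), mul_assoc (4 : ℝ)]
    refine mul_le_mul_of_nonneg_left ?_ (Real.exp_pos _).le
    have : C ^ 2 * ∫ s in (0 : ℝ)..τ, S s ≤ C ^ 2 * (κ * (τ + 1)) := by gcongr
    linarith
  have hbound := norm_le_of_norm_deriv_le_of_norm_le (e := fun s i => Y i s - Θ s (z i))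
    (e' := fun s i => (-M.gradV (Y i s) (empiricalMeasure fun j => Y j s))
        - (-M.gradV (Θ s (z i)) (μ₀.map (Θ s)))) (L := 4 * C ^ 2) (ρ := ρ)
    hτ (by positivity) hκ hSc (fun s _ => hS0 s)
    (fun s hs => hasDerivWithinAt_pi.2 fun i => h.hasDerivWithinAt_displacement hY hz hs i)
    (by ext1 i; simp [hY.init, h.flow.init (z i) (hz i)]) (hle.trans hκρ) ?_ hs
  · exact (norm_le_pi_norm (fun i => Y i s - Θ s (z i)) i).trans (hbound.trans hle)
  · intro s hs hes
    refine (pi_norm_le_iff_of_nonneg (by have := hS0 s; positivity)).2 fun i => ?_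
    exact h.norm_velocity_sub_le hC hT hs hz (hY.mem s hs) hη hη1 (norm_nonneg _)
      (hes.trans hρ1) (fun i => norm_le_pi_norm (fun i => Y i s - Θ s (z i)) i) hes i

omit [IsProbabilityMeasure μ₀] in
theorem sampleDev_sub {f g : Euc k → ℝ} (hf : Integrable f μ₀) (hg : Integrable g μ₀) :
    sampleDev μ₀ z (fun θ => f θ - g θ) = sampleDev μ₀ z f - sampleDev μ₀ z g := by
  rw [sampleDev, integral_sub hf hg, Finset.sum_sub_distrib, sampleDev, sampleDev]
  ring

/-- Sampling deviations commute with integration in time. -/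
theorem sampleDev_integral (hB : IsCompact μ₀.support) (hτ : 0 ≤ τ) (hz : ∀ i, z i ∈ μ₀.support)
    {ψ : ℝ → Euc k → ℝ}
    (hψ : ContinuousOn (fun q : ℝ × Euc k => ψ q.1 q.2) (Icc 0 τ ×ˢ μ₀.support)) :
    sampleDev μ₀ z (fun θ => ∫ s in (0 : ℝ)..τ, ψ s θ)
      = ∫ s in (0 : ℝ)..τ, sampleDev μ₀ z (ψ s) := by
  have h1 : ∀ i, ContinuousOn (fun s => ψ s (z i)) (Icc 0 τ) := fun i =>
    continuousOn_slice_left hψ (hz i)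
  have h2 := continuousOn_integral hB (ae_mem_support μ₀) hψ
  unfold sampleDev
  rw [intervalIntegral.integral_sub
    (ContinuousOn.intervalIntegrable_of_Icc hτ (by fun_prop))
    (h2.intervalIntegrable_of_Icc hτ), intervalIntegral.integral_const_mul,
    intervalIntegral.integral_finsetSum fun i _ => (h1 i).intervalIntegrable_of_Icc hτ,
    intervalIntegral_integral_swap_of_continuousOn hB (ae_mem_support μ₀) hτ hψ]

theorem IsSetting.continuousOn_integral_influence (h : IsSetting M μ₀ τ Θ)
    (hp : M.IsAdjointFlow μ₀ τ Θ x p) : ContinuousOn (fun θ => ∫ s in (0 : ℝ)..τ,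
      (n : ℝ)⁻¹ * ∑ l, M.adjointCoef μ₀ Θ p l s * M.φ (Θ s θ) (M.x l)) μ₀.support := by
  let ψ : ℝ → Euc k → ℝ := fun s θ =>
    (n : ℝ)⁻¹ * ∑ l, M.adjointCoef μ₀ Θ p l s * M.φ (Θ s θ) (M.x l)
  have hψ : ContinuousOn (fun q : ℝ × Euc k => ψ q.1 q.2) (Icc 0 τ ×ˢ μ₀.support) :=
    h.continuousOn_influence_integrand hp
  obtain ⟨C, hC⟩ := (isCompact_Icc.prod h.isCompact).exists_bound_of_continuousOn hψ
  simp_rw [intervalIntegral.integral_of_le h.nonneg]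
  refine continuousOn_of_dominated (bound := fun _ => C) (fun θ hθ => ?_) (fun θ hθ => ?_)
    (integrable_const C) ?_
  · exact ((continuousOn_slice_left (f := ψ) hψ hθ).mono Ioc_subset_Icc_self).aestronglyMeasurable
      measurableSet_Ioc
  · exact (ae_restrict_mem measurableSet_Ioc).mono fun s hs => hC (s, θ) ⟨Ioc_subset_Icc_self hs, hθ⟩
  · exact (ae_restrict_mem measurableSet_Ioc).mono fun s hs =>
      continuousOn_slice_right (f := ψ) hψ (Ioc_subset_Icc_self hs)

theorem IsSetting.continuousOn_influence (h : IsSetting M μ₀ τ Θ) (hx : x ∈ M.Ω)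
    (hp : M.IsAdjointFlow μ₀ τ Θ x p) :
    ContinuousOn (M.influence μ₀ τ Θ p x) μ₀.support :=
  (continuousOn_slice_right (f := fun s θ => M.φ (Θ s θ) x)
    (h.continuousOn_comp (h.regular.continuousOn hx)) ⟨h.nonneg, le_rfl⟩).sub
    (h.continuousOn_integral_influence hp)

theorem IsSetting.sampleDev_influence (h : IsSetting M μ₀ τ Θ) (hx : x ∈ M.Ω)
    (hp : M.IsAdjointFlow μ₀ τ Θ x p) (hz : ∀ i, z i ∈ μ₀.support) :
    sampleDev μ₀ z (M.influence μ₀ τ Θ p x)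
      = sampleDev μ₀ z (fun θ => M.φ (Θ τ θ) x)
        - ∫ s in (0 : ℝ)..τ, (n : ℝ)⁻¹ * ∑ l,
          M.adjointCoef μ₀ Θ p l s * sampleDev μ₀ z (fun θ => M.φ (Θ s θ) (M.x l)) := by
  have hi : ∀ {y : Euc d}, y ∈ M.Ω → ∀ {s}, s ∈ Icc 0 τ →
      Integrable (fun θ => M.φ (Θ s θ) y) μ₀ := fun {y} hy {s} hs =>
    integrable_of_continuousOn h.isCompact (ae_mem_support μ₀)
      (continuousOn_slice_right (f := fun s θ => M.φ (Θ s θ) y)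
        (h.continuousOn_comp (h.regular.continuousOn hy)) hs)
  unfold Model.influence
  rw [sampleDev_sub (hi hx ⟨h.nonneg, le_rfl⟩)
    (integrable_of_continuousOn h.isCompact (ae_mem_support μ₀)
      (h.continuousOn_integral_influence hp)),
    sampleDev_integral h.isCompact h.nonneg hz (h.continuousOn_influence_integrand hp)]
  congr 1
  refine intervalIntegral.integral_congr fun s hs => ?_
  rw [uIcc_of_le h.nonneg] at hs
  simp only [sampleDev]
  rw [integral_const_mul, integral_finsetSum _ fun l _ =>
    (hi (h.regular.data_mem l) hs).const_mul _]
  simp_rw [integral_const_mul, mul_sub, Finset.sum_sub_distrib, mul_sub, Finset.mul_sum]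
  congr 1
  rw [Finset.sum_comm]
  refine Finset.sum_congr rfl fun l _ => Finset.sum_congr rfl fun i _ => ?_
  ring

/-- Collects the three error terms of the derivative of the pairing. -/
theorem pairing_error_le {C η E W : ℝ} (hC : 1 ≤ C) (hηE : 0 ≤ η * E) (hW : 0 ≤ W) :
    C * (C * η * E + C * (2 * C * E ^ 2 + W)) + (C ^ 2 * E ^ 2 + W) + C * (η * E)
      ≤ 4 * C ^ 3 * (η * E + E ^ 2) + 4 * C ^ 3 * W := by
  have h1 : C ≤ C ^ 3 := le_self_pow₀ hC (by norm_num)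
  have h2 : C ^ 2 ≤ C ^ 3 := pow_le_pow_right₀ hC (by norm_num)
  have hE := sq_nonneg E
  have hC0 : 0 ≤ C ^ 3 := by positivity
  linarith [mul_le_mul_of_nonneg_right h1 hηE, mul_le_mul_of_nonneg_right h2 hηE,
    mul_le_mul_of_nonneg_right h2 hE, mul_le_mul_of_nonneg_right h2 hW,
    mul_le_mul_of_nonneg_right (hC.trans h1) hW, mul_nonneg hC0 hηE, mul_nonneg hC0 hE,
    mul_nonneg hC0 hW]

/-- The pairing of the adjoint field with the displacements evolves, up to a small error, only
through the sampling errors of the outputs at the data points. -/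
theorem IsSetting.norm_pairing_deriv_le (h : IsSetting M μ₀ τ Θ) (hp : M.IsAdjointFlow μ₀ τ Θ x p)
    (hC : IsFlowBound M μ₀ τ Θ p C) (hT : IsTaylorRadius M μ₀ τ Θ x η ρ)
    (hz : ∀ i, z i ∈ μ₀.support) (hη : 0 ≤ η) (hη1 : η ≤ 1) {E : ℝ} (hE0 : 0 ≤ E) (hEρ : E ≤ ρ)
    (hY : IsParticlePath M τ z Y) {s : ℝ} (hs : s ∈ Icc 0 τ)
    (hE : ∀ i, ‖Y i s - Θ s (z i)‖ ≤ E) :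
    ∃ Φ', HasDerivWithinAt
        (fun s => (m : ℝ)⁻¹ * ∑ i, inner ℝ (p s (z i)) (Y i s - Θ s (z i))) Φ' (Icc 0 τ) s ∧
      ‖Φ' + (n : ℝ)⁻¹ * ∑ l,
          M.adjointCoef μ₀ Θ p l s * sampleDev μ₀ z (fun θ => M.φ (Θ s θ) (M.x l))‖
        ≤ 4 * C ^ 3 * (η * E + E ^ 2) + 4 * C ^ 3 * samplingError M μ₀ Θ p z s := by
  have hC1 := hC.one_le
  set e : Fin m → Euc k := fun i => Y i s - Θ s (z i) with he
  set g : Fin n → Fin m → Euc k := fun l i => M.gradφ (M.x l) (Θ s (z i)) with hg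
  set v : Fin n → ℝ := fun l => M.f (empiricalMeasure fun i => Y i s) (M.x l)
    - M.f (μ₀.map (Θ s)) (M.x l) with hv
  set c : Fin n → ℝ := fun l => M.adjointCoef μ₀ Θ p l s with hc
  set q : Fin n → ℝ := fun l => sampleDev μ₀ z (fun θ => M.φ (Θ s θ) (M.x l)) with hq
  set b : Fin n → ℝ := fun l =>
    sampleDev μ₀ z (fun θ => inner ℝ (M.gradφ (M.x l) (Θ s θ)) (p s θ)) with hb
  set e' : Fin m → Euc k := fun i => (-M.gradV (Y i s) (empiricalMeasure fun j => Y j s))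
    - (-M.gradV (Θ s (z i)) (μ₀.map (Θ s))) with he'
  set A : Fin m → Euc k →L[ℝ] Euc k := fun i => M.hessV (Θ s (z i)) (μ₀.map (Θ s)) with hA
  set R : Fin m → Euc k := fun i => e' i + A i (e i) + (n : ℝ)⁻¹ • ∑ l, v l • g l i with hR
  set W := samplingError M μ₀ Θ p z s with hW
  have hWeq : W = ∑ l, (q l ^ 2 + b l ^ 2) := rfl
  -- the estimates for the outputs and the velocities
  have hvq : ∀ l, |v l| ≤ |q l| + C * E := fun l =>
    h.abs_output_sub_le hC hT hs hz hη hη1 hE0 hE hEρ l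
  have hr : ∀ l, |v l - q l - (m : ℝ)⁻¹ * ∑ i, inner ℝ (g l i) (e i)| ≤ η * E := fun l =>
    h.abs_output_remainder_le hs (h.regular.data_mem l) hz hη hE0 hE hEρ (hT.data l)
  have hRle : ∀ i, ‖R i‖ ≤ C * η * E + C * E * ((n : ℝ)⁻¹ * ∑ l, |v l|) := fun i =>
    h.norm_velocity_remainder_le hC hT hs hz (hY.mem s hs) hη hη1 hE0 hE hEρ i
  have hcb : ∀ l, (m : ℝ)⁻¹ * ∑ i, inner ℝ (g l i) (p s (z i)) = b l + c l := fun l => by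
    simp only [hb, hc, hg, sampleDev, Model.adjointCoef]
    ring
  refine ⟨(m : ℝ)⁻¹ * ∑ i, (inner ℝ (p s (z i)) (e' i)
    + inner ℝ ((A i).adjoint (p s (z i)) + (n : ℝ)⁻¹ • ∑ l, c l • g l i) (e i)), ?_, ?_⟩
  · exact (HasDerivWithinAt.fun_sum fun i _ => (hp.ode s hs (z i) (hz i)).inner ℝ
      (h.hasDerivWithinAt_displacement hY hz hs i)).const_mul _
  · have hterm : ∀ i, inner ℝ (p s (z i)) (e' i)
        + inner ℝ ((A i).adjoint (p s (z i)) + (n : ℝ)⁻¹ • ∑ l, c l • g l i) (e i)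
        = inner ℝ (p s (z i)) (R i) - (n : ℝ)⁻¹ * ∑ l, v l * inner ℝ (g l i) (p s (z i))
          + (n : ℝ)⁻¹ * ∑ l, c l * inner ℝ (g l i) (e i) := fun i => by
      simp only [hR, inner_add_left, inner_add_right, ContinuousLinearMap.adjoint_inner_left,
        real_inner_smul_left, real_inner_smul_right, sum_inner, inner_sum,
        real_inner_comm (p s (z i))]
      ring
    have hswap : ∀ (a : Fin n → ℝ) (w : Fin n → Fin m → ℝ),
        (m : ℝ)⁻¹ * ∑ i, (n : ℝ)⁻¹ * ∑ l, a l * w l i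
          = (n : ℝ)⁻¹ * ∑ l, a l * ((m : ℝ)⁻¹ * ∑ i, w l i) := fun a w => by
      simp only [Finset.mul_sum]
      rw [Finset.sum_comm]
      refine Finset.sum_congr rfl fun l _ => Finset.sum_congr rfl fun i _ => ?_
      ring
    -- by the adjoint equation the terms linear in the displacements cancel; what remains is the
    -- sampling error of the outputs and products of small quantities
    have heq : (m : ℝ)⁻¹ * ∑ i, (inner ℝ (p s (z i)) (e' i)
        + inner ℝ ((A i).adjoint (p s (z i)) + (n : ℝ)⁻¹ • ∑ l, c l • g l i) (e i))
        + (n : ℝ)⁻¹ * ∑ l, c l * q l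
        = (m : ℝ)⁻¹ * ∑ i, inner ℝ (p s (z i)) (R i) - (n : ℝ)⁻¹ * ∑ l, v l * b l
          - (n : ℝ)⁻¹ * ∑ l, c l * (v l - q l - (m : ℝ)⁻¹ * ∑ i, inner ℝ (g l i) (e i)) := by
      simp only [hterm, Finset.sum_add_distrib, Finset.sum_sub_distrib, mul_add, mul_sub]
      rw [hswap, hswap]
      simp only [hcb, mul_add, Finset.sum_add_distrib, mul_comm (v _) (c _)]
      ring
    rw [heq]
    have hEW : E * ((n : ℝ)⁻¹ * ∑ l, |v l|) ≤ 2 * C * E ^ 2 + W := by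
      have h1 : ∀ l, E * |v l| ≤ 2 * C * E ^ 2 + W := fun l => by
        have h2 : q l ^ 2 ≤ W := by
          rw [hWeq]
          refine le_trans (le_add_of_nonneg_right (sq_nonneg (b l)))
            (Finset.single_le_sum (f := fun l => q l ^ 2 + b l ^ 2) (fun l _ => by positivity)
              (Finset.mem_univ l))
        have h3 : E * |v l| ≤ E * (|q l| + C * E) := by gcongr; exact hvq l
        nlinarith [sq_abs (q l), sq_nonneg (E - |q l|), sq_nonneg E]
      rw [mul_left_comm, Finset.mul_sum]
      have hW0 : 0 ≤ W := by rw [hWeq]; positivity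
      exact mean_le (by positivity) h1
    have hb1 : |(m : ℝ)⁻¹ * ∑ i, inner ℝ (p s (z i)) (R i)|
        ≤ C * (C * η * E + C * (2 * C * E ^ 2 + W)) := by
      have hW0 : 0 ≤ W := by rw [hWeq]; positivity
      refine abs_mean_le_of_le (by positivity) fun i => ?_
      refine (abs_real_inner_le_norm _ _).trans ?_
      have := hC.adjoint s hs (z i) (hz i)
      gcongr
      · linarith
      · refine (hRle i).trans ?_
        rw [mul_assoc C E]
        gcongr
    have hb2 : |(n : ℝ)⁻¹ * ∑ l, v l * b l| ≤ C ^ 2 * E ^ 2 + W := by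
      have hW0 : 0 ≤ W := by rw [hWeq]; positivity
      refine abs_mean_le_of_le (by positivity) fun l => ?_
      have h2 : q l ^ 2 + b l ^ 2 ≤ W := by
        rw [hWeq]
        exact Finset.single_le_sum (f := fun l => q l ^ 2 + b l ^ 2) (fun l _ => by positivity)
              (Finset.mem_univ l)
      rw [abs_mul]
      have h3 : |v l| * |b l| ≤ (|q l| + C * E) * |b l| := by gcongr; exact hvq l
      nlinarith [sq_abs (q l), sq_abs (b l), sq_nonneg (|b l| - |q l|), sq_nonneg (C * E - |b l|)]
    have hb3 : |(n : ℝ)⁻¹ * ∑ l, c l * (v l - q l - (m : ℝ)⁻¹ * ∑ i, inner ℝ (g l i) (e i))|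
        ≤ C * (η * E) := by
      refine abs_mean_le_of_le (by positivity) fun l => ?_
      rw [abs_mul]
      have := hC.coef l s hs
      gcongr
      · linarith
      · exact hr l
    rw [Real.norm_eq_abs]
    refine (abs_sub _ _).trans ((add_le_add ((abs_sub _ _).trans (add_le_add hb1 hb2)) hb3).trans ?_)
    exact pairing_error_le hC1 (by positivity) (by rw [hWeq]; positivity)

end Displacement

/-! ### The pathwise expansion -/

section PathwiseExpansion

variable {k d n : ℕ} {M : Model k d n} {μ₀ : Measure (Euc k)} [IsProbabilityMeasure μ₀] {τ : ℝ}
  {Θ p : ℝ → Euc k → Euc k} {x : Euc d}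

/-- The quantitative form of the pathwise expansion: the pairing of the adjoint field with the
displacements, integrated over `[0, τ]`, turns the first-order effect of the displacements on the output
into the time integral in the influence function. -/
theorem IsSetting.abs_expansion_le (h : IsSetting M μ₀ τ Θ) (hx : x ∈ M.Ω)
    (hp : M.IsAdjointFlow μ₀ τ Θ x p) {C η ρ κ : ℝ} (hC : IsFlowBound M μ₀ τ Θ p C)
    (hT : IsTaylorRadius M μ₀ τ Θ x η ρ) (hη : 0 ≤ η) (hη1 : η ≤ 1) (hρ1 : ρ ≤ 1) (hκ : 0 < κ)
    (hκρ : displacementConst C τ * κ ≤ ρ) {m : ℕ} {z : Fin m → Euc k}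
    {Y : Fin m → ℝ → Euc k} (hz : ∀ i, z i ∈ μ₀.support) (hY : IsParticlePath M τ z Y)
    (hW : ∫ s in (0 : ℝ)..τ, samplingError M μ₀ Θ p z s ≤ κ ^ 2) :
    |M.f (empiricalMeasure fun i => Y i τ) x - M.f (μ₀.map (Θ τ)) x
        - sampleDev μ₀ z (M.influence μ₀ τ Θ p x)|
      ≤ η * (displacementConst C τ * κ)
        + (4 * C ^ 3 * (η * (displacementConst C τ * κ) + (displacementConst C τ * κ) ^ 2) * τ
          + 4 * C ^ 3 * κ ^ 2) := by
  have hτ := h.nonneg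
  have hττ : τ ∈ Icc 0 τ := ⟨hτ, le_rfl⟩
  have hC1 := hC.one_le
  set E := displacementConst C τ * κ with hEdef
  have hE0 : 0 ≤ E := mul_nonneg (displacementConst_pos hτ).le hκ.le
  have hE : ∀ s ∈ Icc 0 τ, ∀ i, ‖Y i s - Θ s (z i)‖ ≤ E := fun s hs i =>
    h.norm_displacement_le hp hC hT hz hη hη1 hρ1 hκ hκρ hY hW hs i
  let G : ℝ → ℝ := fun s => (n : ℝ)⁻¹ * ∑ l,
    M.adjointCoef μ₀ Θ p l s * sampleDev μ₀ z (fun θ => M.φ (Θ s θ) (M.x l))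
  have hG : ContinuousOn G (Icc 0 τ) := continuousOn_const.mul (continuousOn_finsetSum _ fun l _ =>
    (h.continuousOn_adjointCoef hp l).mul (h.continuousOn_sampleDev_φ hz l))
  let Φ : ℝ → ℝ := fun s => (m : ℝ)⁻¹ * ∑ i, inner ℝ (p s (z i)) (Y i s - Θ s (z i))
  -- the integrated form of the evolution of the pairing
  have hpair : |Φ τ + ∫ s in (0 : ℝ)..τ, G s|
      ≤ 4 * C ^ 3 * (η * E + E ^ 2) * τ + 4 * C ^ 3 * κ ^ 2 := by
    choose! Φ' hΦ' hΦ'le using fun s (hs : s ∈ Icc 0 τ) =>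
      h.norm_pairing_deriv_le hp hC hT hz hη hη1 hE0 hκρ hY hs (hE s hs)
    let G₁ : ℝ → ℝ := fun s => G (projIcc 0 τ hτ s)
    have hG₁ : Continuous G₁ := hG.comp_continuous
      (continuous_subtype_val.comp continuous_projIcc) fun s => (projIcc 0 τ hτ s).2
    have hGG₁ : ∀ s ∈ Icc 0 τ, G₁ s = G s := fun s hs => by simp [G₁, projIcc_of_mem hτ hs]
    have hint : ∫ s in (0 : ℝ)..τ, G₁ s = ∫ s in (0 : ℝ)..τ, G s := by
      refine intervalIntegral.integral_congr fun s hs => ?_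
      rw [uIcc_of_le hτ] at hs
      exact hGG₁ s hs
    have h1 := norm_sub_le_of_norm_deriv_le (e := fun s => Φ s + ∫ s in (0 : ℝ)..s, G₁ s)
      (e' := fun s => Φ' s + G s) hτ (h.continuousOn_samplingError hp hz)
      (fun s hs => by
        rw [← hGG₁ s hs]
        exact (hΦ' s hs).add (hG₁.integral_hasStrictDerivAt 0 s).hasDerivAt.hasDerivWithinAt)
      hΦ'le
    have hΦ0 : Φ 0 = 0 := by
      simp [Φ, hY.init, fun i => h.flow.init (z i) (hz i)]
    rw [hΦ0, hint] at h1
    simp only [intervalIntegral.integral_same, add_zero, sub_zero, Real.norm_eq_abs] at h1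
    refine h1.trans ?_
    gcongr
  have hout := h.abs_output_remainder_le (Y := fun i => Y i τ) hττ hx hz hη hE0 (hE τ hττ) hκρ
    hT.target
  have hterm : (m : ℝ)⁻¹ * ∑ i, inner ℝ (M.gradφ x (Θ τ (z i))) (Y i τ - Θ τ (z i)) = Φ τ := by
    simp only [Φ, fun i => hp.terminal (z i) (hz i)]
  rw [hterm] at hout
  rw [h.sampleDev_influence hx hp hz]
  refine le_trans (le_of_eq ?_) ((abs_add_le _ _).trans (add_le_add hout hpair))
  congr 1
  simp only [G]
  ring

/-- **Pathwise expansion.** If the sampling errors are of order `κ`, the output of the particle system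
at time `τ` differs from the mean-field output by the sampling error of the influence function, up
to `o(κ)`, uniformly in the number of particles. -/
theorem IsSetting.exists_abs_expansion_le (h : IsSetting M μ₀ τ Θ) (hx : x ∈ M.Ω)
    (hp : M.IsAdjointFlow μ₀ τ Θ x p) {ε : ℝ} (hε : 0 < ε) :
    ∃ δ > 0, ∀ κ, 0 < κ → κ ≤ δ → ∀ (m : ℕ) (z : Fin m → Euc k) (Y : Fin m → ℝ → Euc k),
      (∀ i, z i ∈ μ₀.support) → IsParticlePath M τ z Y →
      ∫ s in (0 : ℝ)..τ, samplingError M μ₀ Θ p z s ≤ κ ^ 2 →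
      |M.f (empiricalMeasure fun i => Y i τ) x - M.f (μ₀.map (Θ τ)) x
        - sampleDev μ₀ z (M.influence μ₀ τ Θ p x)| ≤ ε * κ := by
  have hτ := h.nonneg
  obtain ⟨C, hC⟩ := h.exists_isFlowBound hp
  have hC1 := hC.one_le
  have hK := displacementConst_pos (C := C) hτ
  set K := displacementConst C τ with hKdef
  -- the error bound of `abs_expansion_le` is `κ (η A₁ + κ A₂)`
  have hA₁ : 0 < K + 4 * C ^ 3 * (τ * K) := by positivity
  have hA₂ : 0 < 4 * C ^ 3 * (τ * K ^ 2 + 1) := by positivity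
  set A₁ := K + 4 * C ^ 3 * (τ * K) with hA₁def
  set A₂ := 4 * C ^ 3 * (τ * K ^ 2 + 1) with hA₂def
  have hη : 0 < min 1 (ε / (2 * A₁)) := by positivity
  have hη1 : min 1 (ε / (2 * A₁)) ≤ 1 := min_le_left _ _
  have hηA : min 1 (ε / (2 * A₁)) * A₁ ≤ ε / 2 :=
    (mul_le_mul_of_nonneg_right (min_le_right _ _) hA₁.le).trans_eq (by field_simp)
  set η := min 1 (ε / (2 * A₁)) with hηdef
  obtain ⟨ρ, hρ, hρ1, hT⟩ := h.exists_isTaylorRadius hx hη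
  refine ⟨min (ρ / K) (ε / (2 * A₂)), by positivity, fun κ hκ hκδ m z Y hz hY hW => ?_⟩
  have hκρ : K * κ ≤ ρ := by
    rw [mul_comm, ← le_div_iff₀ hK]
    exact hκδ.trans (min_le_left _ _)
  have hκA : κ * A₂ ≤ ε / 2 :=
    (mul_le_mul_of_nonneg_right (hκδ.trans (min_le_right _ _)) hA₂.le).trans_eq (by field_simp)
  refine (h.abs_expansion_le hx hp hC hT hη.le hη1 hρ1 hκ hκρ hz hY hW).trans ?_
  calc _ = κ * (η * A₁ + κ * A₂) := by rw [← hKdef, hA₁def, hA₂def]; ring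
    _ ≤ κ * (ε / 2 + ε / 2) := by gcongr
    _ = ε * κ := by ring

end PathwiseExpansion

/-! ### The size of the sampling errors -/

section Sampling

variable {k : ℕ} {μ₀ : Measure (Euc k)} [IsProbabilityMeasure μ₀] {S : Type*} [MeasurableSpace S]
  {P : Measure S} [IsProbabilityMeasure P] {θ₀ : ℕ → S → Euc k}

omit [IsProbabilityMeasure μ₀] in
/-- The mean square deviation of a sample average of a bounded function is at most `C² / m`. -/
theorem lintegral_sampleDev_sq_le (hlaw : ∀ i, HasLaw (θ₀ i) μ₀ P) (hindep : iIndepFun θ₀ P)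
    {χ : Euc k → ℝ} (hχ : Measurable χ) {C : ℝ} (hC : ∀ θ, |χ θ| ≤ C) {m : ℕ} (hm : 0 < m) :
    ∫⁻ ω, ENNReal.ofReal (sampleDev μ₀ (fun i : Fin m => θ₀ i ω) χ ^ 2) ∂P
      ≤ ENNReal.ofReal (C ^ 2 / m) := by
  have hm' : (m : ℝ) ≠ 0 := by exact_mod_cast hm.ne'
  let X : Fin m → S → ℝ := fun i ω => χ (θ₀ i ω)
  have hXm : ∀ i, AEMeasurable (X i) P := fun i => hχ.comp_aemeasurable (hlaw i).aemeasurable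
  have hX : ∀ i, MemLp (X i) 2 P := fun i =>
    MemLp.of_bound (hXm i).aestronglyMeasurable C (Eventually.of_forall fun ω => hC _)
  have hmean : ∀ i, ∫ ω, X i ω ∂P = ∫ θ, χ θ ∂μ₀ := fun i =>
    (hlaw i).integral_comp hχ.aestronglyMeasurable
  have hvar : ∀ i, Var[X i; P] ≤ C ^ 2 := fun i => by
    refine (variance_le_expectation_sq (hXm i).aestronglyMeasurable).trans ?_
    have h1 : ∀ ω, (X i ^ 2) ω ≤ C ^ 2 := fun ω => by
      rw [Pi.pow_apply, ← sq_abs]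
      gcongr
      exact hC _
    calc ∫ ω, (X i ^ 2) ω ∂P ≤ ∫ _, C ^ 2 ∂P :=
          integral_mono (hX i).integrable_sq (integrable_const _) h1
      _ = C ^ 2 := by simp
  let Z : S → ℝ := fun ω => (m : ℝ)⁻¹ * (∑ i, X i) ω
  have hsum : MemLp (∑ i, X i) 2 P := memLp_finsetSum' _ fun i _ => hX i
  have hZ : MemLp Z 2 P := hsum.const_mul _
  have hZmean : ∫ ω, Z ω ∂P = ∫ θ, χ θ ∂μ₀ := by
    simp only [Z, Finset.sum_apply]
    rw [integral_const_mul, integral_finsetSum _ fun i _ => (hX i).integrable (by norm_num)]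
    simp only [hmean, Finset.sum_const, Finset.card_univ, Fintype.card_fin, nsmul_eq_mul]
    field_simp
  have hZvar : Var[Z; P] ≤ C ^ 2 / m := by
    rw [variance_const_mul, IndepFun.variance_sum (fun i _ => hX i)]
    · have h1 : ∑ i, Var[X i; P] ≤ m * C ^ 2 := by
        simpa using Finset.sum_le_sum fun i (_ : i ∈ Finset.univ) => hvar i
      calc ((m : ℝ)⁻¹) ^ 2 * ∑ i, Var[X i; P] ≤ ((m : ℝ)⁻¹) ^ 2 * (m * C ^ 2) := by gcongr
        _ = C ^ 2 / m := by field_simp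
    · intro i _ j _ hij
      exact (hindep.indepFun (fun hij' => hij (Fin.ext hij'))).comp hχ hχ
  have h1 : ∫⁻ ω, ENNReal.ofReal (sampleDev μ₀ (fun i : Fin m => θ₀ i ω) χ ^ 2) ∂P
      = evariance Z P := by
    rw [evariance_eq_lintegral_ofReal, hZmean]
    simp [sampleDev, Z, X]
  rw [h1, ← ofReal_variance hZ]
  exact ENNReal.ofReal_le_ofReal hZvar

omit [IsProbabilityMeasure μ₀] in
/-- By Tietze's theorem, a function that is continuous on the compact set `[0, τ] × supp μ₀` may be
replaced by a continuous bounded one, which is measurable on the whole space. -/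
theorem exists_continuous_bounded_extension {τ : ℝ} (hB : IsCompact μ₀.support)
    {ψ : ℝ → Euc k → ℝ}
    (hψ : ContinuousOn (fun q : ℝ × Euc k => ψ q.1 q.2) (Icc 0 τ ×ˢ μ₀.support)) :
    ∃ χ : ℝ → Euc k → ℝ, Continuous (fun q : ℝ × Euc k => χ q.1 q.2) ∧
      (∃ C, ∀ s θ, |χ s θ| ≤ C) ∧ ∀ s ∈ Icc 0 τ, ∀ θ ∈ μ₀.support, χ s θ = ψ s θ := by
  have hK : IsCompact (Icc 0 τ ×ˢ μ₀.support) := isCompact_Icc.prod hB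
  have : CompactSpace (Icc 0 τ ×ˢ μ₀.support : Set (ℝ × Euc k)) := isCompact_iff_compactSpace.1 hK
  let f : BoundedContinuousFunction (Icc 0 τ ×ˢ μ₀.support : Set (ℝ × Euc k)) ℝ :=
    BoundedContinuousFunction.mkOfCompact ⟨_, hψ.domRestrict⟩
  obtain ⟨g, -, hg⟩ := BoundedContinuousFunction.exists_norm_eq_domRestrict_eq_of_closed f hK.isClosed
  refine ⟨fun s θ => g (s, θ), g.continuous, ⟨‖g‖, fun s θ => g.norm_coe_le_norm (s, θ)⟩,
    fun s hs θ hθ => ?_⟩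
  exact DFunLike.congr_fun hg ⟨(s, θ), ⟨hs, hθ⟩⟩

omit [IsProbabilityMeasure μ₀] in
theorem sampleDev_congr {m : ℕ} {z : Fin m → Euc k} (hz : ∀ i, z i ∈ μ₀.support)
    {χ ψ : Euc k → ℝ} (h : ∀ θ ∈ μ₀.support, χ θ = ψ θ) : sampleDev μ₀ z χ = sampleDev μ₀ z ψ := by
  rw [sampleDev, sampleDev, integral_congr_ae ((ae_mem_support μ₀).mono h)]
  simp only [fun i => h (z i) (hz i)]

omit [IsProbabilityMeasure μ₀] [IsProbabilityMeasure P] in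
theorem ae_mem_support_of_hasLaw (hlaw : ∀ i, HasLaw (θ₀ i) μ₀ P) :
    ∀ᵐ ω ∂P, ∀ i, θ₀ i ω ∈ μ₀.support := by
  refine ae_all_iff.2 fun i => ?_
  have h1 := ae_mem_support μ₀
  rw [← (hlaw i).map_eq] at h1
  have h2 := ae_of_ae_map (hlaw i).aemeasurable h1
  rwa [(hlaw i).map_eq] at h2

/-- The time integral of squared sampling errors is of order `1/m` in probability. -/
theorem exists_measure_sampleDev_gt_le {ι : Type*} [Fintype ι] {τ : ℝ} (hτ : 0 ≤ τ)
    (hlaw : ∀ i, HasLaw (θ₀ i) μ₀ P) (hindep : iIndepFun θ₀ P) (hB : IsCompact μ₀.support)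
    {ψ : ι → ℝ → Euc k → ℝ}
    (hψ : ∀ j, ContinuousOn (fun q : ℝ × Euc k => ψ j q.1 q.2) (Icc 0 τ ×ˢ μ₀.support)) :
    ∃ C, 0 ≤ C ∧ ∀ m : ℕ, 0 < m → ∀ κ : ℝ, 0 < κ →
      P {ω | κ ^ 2 < ∫ s in (0 : ℝ)..τ, ∑ j, sampleDev μ₀ (fun i : Fin m => θ₀ i ω) (ψ j s) ^ 2}
        ≤ ENNReal.ofReal (C / (m * κ ^ 2)) := by
  choose χ hχ hχC hχψ using fun j => exists_continuous_bounded_extension hB (hψ j)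
  choose C hC using hχC
  have hC0 : ∀ j, 0 ≤ C j := fun j => (abs_nonneg _).trans (hC j 0 0)
  refine ⟨τ * ∑ j, C j ^ 2, by positivity, fun m hm κ hκ => ?_⟩
  have hm' : (0 : ℝ) < m := by exact_mod_cast hm
  let f : S → ℝ → ℝ≥0∞ := fun ω s =>
    ∑ j, ENNReal.ofReal (sampleDev μ₀ (fun i : Fin m => θ₀ i ω) (χ j s) ^ 2)
  have hdev : ∀ j, AEMeasurable
      (fun q : S × ℝ => sampleDev μ₀ (fun i : Fin m => θ₀ i q.1) (χ j q.2))
      (P.prod (volume.restrict (Icc 0 τ))) := by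
    intro j
    have h1 : Measurable fun q : S × ℝ => ∫ θ, χ j q.2 θ ∂μ₀ := by
      have : StronglyMeasurable fun s : ℝ => ∫ θ, χ j s θ ∂μ₀ :=
        StronglyMeasurable.integral_prod_right (f := χ j) (hχ j).stronglyMeasurable
      exact this.measurable.comp measurable_snd
    have h2 : ∀ i : Fin m, AEMeasurable (fun q : S × ℝ => χ j q.2 (θ₀ i q.1))
        (P.prod (volume.restrict (Icc 0 τ))) := fun i =>
      (hχ j).measurable.comp_aemeasurable
        (measurable_snd.aemeasurable.prodMk (hlaw i).aemeasurable.comp_fst)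
    unfold sampleDev
    exact ((Finset.aemeasurable_fun_sum _ fun i _ => h2 i).const_mul _).sub h1.aemeasurable
  have hf : AEMeasurable (Function.uncurry f) (P.prod (volume.restrict (Icc 0 τ))) :=
    Finset.aemeasurable_fun_sum _ fun j _ => ((hdev j).pow_const 2).ennreal_ofReal
  have hE : ∫⁻ ω, (∫⁻ s in Icc 0 τ, f ω s) ∂P ≤ ENNReal.ofReal (τ * (∑ j, C j ^ 2) / m) := by
    rw [lintegral_lintegral_swap hf]
    have h1 : ∀ s, ∫⁻ ω, f ω s ∂P ≤ ENNReal.ofReal ((∑ j, C j ^ 2) / m) := by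
      intro s
      have h2 : ∀ j, AEMeasurable (fun ω =>
          ENNReal.ofReal (sampleDev μ₀ (fun i : Fin m => θ₀ i ω) (χ j s) ^ 2)) P := by
        intro j
        have h3 : ∀ i : Fin m, AEMeasurable (fun ω => χ j s (θ₀ i ω)) P := fun i =>
          ((hχ j).comp (by fun_prop : Continuous fun θ : Euc k => (s, θ))).measurable.comp_aemeasurable
            (hlaw i).aemeasurable
        unfold sampleDev
        exact ((((Finset.aemeasurable_fun_sum _ fun i _ => h3 i).const_mul _).sub
          aemeasurable_const).pow_const 2).ennreal_ofReal
      simp only [f]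
      rw [lintegral_finsetSum' _ fun j _ => h2 j, Finset.sum_div,
        ENNReal.ofReal_sum_of_nonneg fun j _ => by positivity]
      refine Finset.sum_le_sum fun j _ => lintegral_sampleDev_sq_le hlaw hindep
        ((hχ j).comp (by fun_prop : Continuous fun θ : Euc k => (s, θ))).measurable (hC j s) hm
    refine (lintegral_mono h1).trans ?_
    rw [lintegral_const, Measure.restrict_apply_univ, Real.volume_Icc, sub_zero, mul_comm,
      ← ENNReal.ofReal_mul hτ, mul_div_assoc]
  have hae : ∀ᵐ ω ∂P, κ ^ 2 < ∫ s in (0 : ℝ)..τ,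
        ∑ j, sampleDev μ₀ (fun i : Fin m => θ₀ i ω) (ψ j s) ^ 2 →
      ENNReal.ofReal (κ ^ 2) ≤ ∫⁻ s in Icc 0 τ, f ω s := by
    filter_upwards [ae_mem_support_of_hasLaw hlaw] with ω hω hlt
    have hz : ∀ i : Fin m, θ₀ i ω ∈ μ₀.support := fun i => hω i
    refine (ENNReal.ofReal_le_ofReal hlt.le).trans ?_
    have hc : ContinuousOn (fun s => ∑ j, sampleDev μ₀ (fun i : Fin m => θ₀ i ω) (ψ j s) ^ 2)
        (Icc 0 τ) := continuousOn_finsetSum _ fun j _ => (continuousOn_sampleDev hB hz (hψ j)).pow 2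
    rw [intervalIntegral.integral_of_le hτ, ← integral_Icc_eq_integral_Ioc,
      ofReal_integral_eq_lintegral_ofReal (hc.integrableOn_compact isCompact_Icc)
        (Eventually.of_forall fun s => by dsimp only; positivity)]
    refine le_of_eq (setLIntegral_congr_fun measurableSet_Icc fun s hs => ?_)
    simp only [f]
    rw [ENNReal.ofReal_sum_of_nonneg fun j _ => by positivity]
    refine Finset.sum_congr rfl fun j _ => ?_
    rw [sampleDev_congr hz (hχψ j s hs)]
  calc P {ω | κ ^ 2 < ∫ s in (0 : ℝ)..τ,
          ∑ j, sampleDev μ₀ (fun i : Fin m => θ₀ i ω) (ψ j s) ^ 2}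
      ≤ P {ω | ENNReal.ofReal (κ ^ 2) ≤ ∫⁻ s in Icc 0 τ, f ω s} := measure_mono_ae hae
    _ ≤ (∫⁻ ω, (∫⁻ s in Icc 0 τ, f ω s) ∂P) / ENNReal.ofReal (κ ^ 2) :=
        meas_ge_le_lintegral_div hf.lintegral_prod_right'
          (by simpa using by positivity) ENNReal.ofReal_ne_top
    _ ≤ ENNReal.ofReal (τ * (∑ j, C j ^ 2) / m) / ENNReal.ofReal (κ ^ 2) := by gcongr
    _ = _ := by
        rw [← ENNReal.ofReal_div_of_pos (by positivity), div_div]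

end Sampling

/-! ### Convergence in law of the particle outputs -/

section Convergence

variable {k d n : ℕ} {M : Model k d n} {μ₀ : Measure (Euc k)} [IsProbabilityMeasure μ₀] {τ : ℝ}
  {Θ p : ℝ → Euc k → Euc k} {x : Euc d} {S : Type*} [MeasurableSpace S]
  {P : Measure S} [IsProbabilityMeasure P] {θ₀ : ℕ → S → Euc k}
  {ϑ : (m : ℕ) → Fin m → ℝ → S → Euc k}

omit [IsProbabilityMeasure μ₀] [IsProbabilityMeasure P] in
theorem ae_isParticlePath {m : ℕ} {v : Fin m → ℝ → S → Euc k} (hv : M.IsParticleFlow P τ θ₀ m v) :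
    ∀ᵐ ω ∂P, IsParticlePath M τ (fun i : Fin m => θ₀ i ω) (fun i t => v i t ω) := by
  filter_upwards [hv.init, hv.mem, hv.ode] with ω h1 h2 h3
  exact ⟨h1, h2, h3⟩

/-- The fluctuations of the particle outputs are those of the sample averages of the influence
function, up to a vanishing error. -/
theorem IsSetting.tendstoInMeasure_remainder (h : IsSetting M μ₀ τ Θ) (hx : x ∈ M.Ω)
    (hp : M.IsAdjointFlow μ₀ τ Θ x p) (hlaw : ∀ i, HasLaw (θ₀ i) μ₀ P) (hindep : iIndepFun θ₀ P)
    (hϑ : ∀ m, M.IsParticleFlow P τ θ₀ m (ϑ m)) :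
    TendstoInMeasure P (fun (m : ℕ) ω => Real.sqrt m *
        (M.f (empiricalMeasure fun i => ϑ m i τ ω) x - M.f (μ₀.map (Θ τ)) x)
      - Real.sqrt m * sampleDev μ₀ (fun i : Fin m => θ₀ i ω) (M.influence μ₀ τ Θ p x))
      atTop 0 := by
  obtain ⟨C, hC0, hC⟩ := exists_measure_sampleDev_gt_le (ι := Fin n ⊕ Fin n) h.nonneg hlaw hindep
    h.isCompact (ψ := Sum.elim (fun l s θ => M.φ (Θ s θ) (M.x l))
      (fun l s θ => inner ℝ (M.gradφ (M.x l) (Θ s θ)) (p s θ)))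
    (by
      rintro (l | l)
      · exact h.continuousOn_comp (h.regular.continuousOn (h.regular.data_mem l))
      · exact h.continuousOn_inner_gradφ hp l)
  simp only [Fintype.sum_sum_type, Sum.elim_inl, Sum.elim_inr, ← Finset.sum_add_distrib] at hC
  change ∀ m : ℕ, 0 < m → ∀ κ : ℝ, 0 < κ → P {ω | κ ^ 2 <
    ∫ s in (0 : ℝ)..τ, samplingError M μ₀ Θ p (fun i : Fin m => θ₀ i ω) s} ≤ _ at hC
  rw [tendstoInMeasure_iff_norm]
  intro η hη
  rw [ENNReal.tendsto_nhds_zero]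
  intro a ha
  -- `κ = b / √m`, where `b` is large enough for the exceptional event to have probability at most `a`
  obtain ⟨b, hb0, hb⟩ : ∃ b : ℝ, 0 < b ∧ ENNReal.ofReal (C / b ^ 2) ≤ a := by
    rcases eq_or_ne a ∞ with rfl | ha'
    · exact ⟨1, one_pos, le_top⟩
    · have ha0 := ENNReal.toReal_pos ha.ne' ha'
      refine ⟨Real.sqrt ((C + 1) / a.toReal), by positivity, ENNReal.ofReal_le_of_le_toReal ?_⟩
      rw [Real.sq_sqrt (by positivity), div_div_eq_mul_div, div_le_iff₀ (by positivity)]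
      nlinarith
  obtain ⟨δ, hδ, hexp⟩ := h.exists_abs_expansion_le hx hp (ε := η / (2 * b)) (by positivity)
  have hlim : Tendsto (fun m : ℕ => b / Real.sqrt m) atTop (𝓝 0) :=
    tendsto_const_nhds.div_atTop (Real.tendsto_sqrt_atTop.comp tendsto_natCast_atTop_atTop)
  filter_upwards [hlim.eventually (ge_mem_nhds hδ), eventually_gt_atTop 0] with m hmδ hm
  have hm' : (0 : ℝ) < m := by exact_mod_cast hm
  have hsq : 0 < Real.sqrt m := Real.sqrt_pos.2 hm'
  have hκ : 0 < b / Real.sqrt m := by positivity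
  refine le_trans (measure_mono_ae ?_) ((hC m hm (b / Real.sqrt m) hκ).trans ?_)
  · filter_upwards [ae_mem_support_of_hasLaw hlaw, ae_isParticlePath (hϑ m)] with ω hω hpath hle
    by_contra hnot
    have h1 := hexp _ hκ hmδ m _ _ (fun i => hω i) hpath (not_lt.1 hnot)
    have h2 : η ≤ Real.sqrt m * |M.f (empiricalMeasure fun i => ϑ m i τ ω) x - M.f (μ₀.map (Θ τ)) x
        - sampleDev μ₀ (fun i : Fin m => θ₀ i ω) (M.influence μ₀ τ Θ p x)| := by
      have h3 : η ≤ ‖_‖ := hle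
      rwa [Pi.zero_apply, sub_zero, ← mul_sub, norm_mul, Real.norm_of_nonneg hsq.le,
        Real.norm_eq_abs] at h3
    have h4 : Real.sqrt m * (η / (2 * b) * (b / Real.sqrt m)) = η / 2 := by field_simp
    have h5 := h2.trans (mul_le_mul_of_nonneg_left h1 hsq.le)
    rw [h4] at h5
    linarith
  · refine le_trans (le_of_eq ?_) hb
    rw [div_pow, Real.sq_sqrt hm'.le]
    congr 2
    field_simp

omit [IsProbabilityMeasure μ₀] in
/-- The central limit theorem for sample averages of a function that is continuous on the support. -/
theorem tendstoInDistribution_sampleDev {S' : Type*} [MeasurableSpace S'] {P' : Measure S'}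
    [IsProbabilityMeasure P'] (hB : IsCompact μ₀.support) (hlaw : ∀ i, HasLaw (θ₀ i) μ₀ P)
    (hindep : iIndepFun θ₀ P) {χ : Euc k → ℝ} (hχ : ContinuousOn χ μ₀.support) {g : S' → ℝ}
    (hg : HasLaw g (gaussianReal 0 (Var[χ; μ₀]).toNNReal) P') :
    TendstoInDistribution
      (fun (m : ℕ) ω => Real.sqrt m * sampleDev μ₀ (fun i : Fin m => θ₀ i ω) χ)
      atTop g (fun _ => P) P' := by
  obtain ⟨χ', hχ'c, ⟨C, hC⟩, hχ'⟩ := exists_continuous_bounded_extension (τ := 0) hB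
    (ψ := fun _ => χ) (hχ.comp continuousOn_snd fun q hq => hq.2)
  let f : Euc k → ℝ := χ' 0
  have hfc : Continuous f := hχ'c.comp (by fun_prop : Continuous fun θ : Euc k => ((0 : ℝ), θ))
  have hfχ : ∀ θ ∈ μ₀.support, f θ = χ θ := hχ' 0 ⟨le_rfl, le_rfl⟩
  let X : ℕ → S → ℝ := fun i ω => f (θ₀ i ω)
  have hX0 : MemLp (X 0) 2 P := MemLp.of_bound
    (hfc.measurable.comp_aemeasurable (hlaw 0).aemeasurable).aestronglyMeasurable C
    (Eventually.of_forall fun ω => hC 0 _)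
  have hident : ∀ i, IdentDistrib (X i) (X 0) P P := fun i =>
    (IdentDistrib.mk (hlaw i).aemeasurable (hlaw 0).aemeasurable
      ((hlaw i).map_eq.trans (hlaw 0).map_eq.symm)).comp hfc.measurable
  have hmean : P[X 0] = ∫ θ, f θ ∂μ₀ :=
    (hlaw 0).integral_comp hfc.measurable.aestronglyMeasurable
  have hvar : Var[X 0; P] = Var[χ; μ₀] := by
    rw [← variance_congr ((ae_mem_support μ₀).mono hfχ), ← (hlaw 0).map_eq,
      variance_map hfc.measurable.aemeasurable (hlaw 0).aemeasurable]
    rfl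
  rw [← hvar] at hg
  refine (tendstoInDistribution_inv_sqrt_mul_sum_sub hg hX0
    (hindep.comp (fun _ => f) fun _ => hfc.measurable) hident).congr (fun m => ?_) ae_eq_rfl
  filter_upwards [ae_mem_support_of_hasLaw hlaw] with ω hω
  rw [← sampleDev_congr (fun i => hω i) hfχ, sampleDev, hmean, Finset.sum_range]
  rcases Nat.eq_zero_or_pos m with rfl | hm
  · simp
  · have hm' : (0 : ℝ) < m := by exact_mod_cast hm
    have h1 : Real.sqrt m * (m : ℝ)⁻¹ = (Real.sqrt m)⁻¹ := by
      rw [← div_eq_mul_inv, Real.sqrt_div_self']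
      simp
    have h2 : (Real.sqrt m)⁻¹ * m = Real.sqrt m := by
      rw [inv_mul_eq_div, Real.div_sqrt]
    rw [mul_sub, mul_sub, ← mul_assoc, ← mul_assoc, h1, h2]

/-- The fluctuations of the particle outputs are asymptotically normal; the limiting variance is the
variance of the influence function. -/
theorem IsSetting.tendstoInDistribution_output (h : IsSetting M μ₀ τ Θ) (hx : x ∈ M.Ω)
    (hp : M.IsAdjointFlow μ₀ τ Θ x p) (hlaw : ∀ i, HasLaw (θ₀ i) μ₀ P) (hindep : iIndepFun θ₀ P)
    (hϑ : ∀ m, M.IsParticleFlow P τ θ₀ m (ϑ m)) {S' : Type*} [MeasurableSpace S']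
    {P' : Measure S'} [IsProbabilityMeasure P'] {g : S' → ℝ}
    (hg : HasLaw g (gaussianReal 0 (Var[M.influence μ₀ τ Θ p x; μ₀]).toNNReal) P') :
    TendstoInDistribution
      (fun (m : ℕ) (s : S) => Real.sqrt m *
        (M.f (empiricalMeasure fun i => ϑ m i τ s) x - M.f (μ₀.map (Θ τ)) x))
      atTop g (fun _ => P) P' := by
  refine tendstoInDistribution_of_tendstoInMeasure_sub _ g
    (tendstoInDistribution_sampleDev h.isCompact hlaw hindep (h.continuousOn_influence hx hp) hg)
    (h.tendstoInMeasure_remainder hx hp hlaw hindep hϑ) fun m => ?_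
  have hττ : τ ∈ Icc 0 τ := ⟨h.nonneg, le_rfl⟩
  have h1 : ∀ i, AEMeasurable (fun s => M.φ (ϑ m i τ s) x) P := fun i => by
    have hmeas := (hϑ m).aemeasurable i τ hττ
    have hD := h.regular.isOpen_D.measurableSet
    have hmem : ∀ᵐ θ ∂(P.map (ϑ m i τ)), θ ∈ M.D := (ae_map_iff hmeas hD).2
      ((hϑ m).mem.mono fun ω hω => hω τ hττ i)
    have h2 := (h.regular.continuousOn hx).aemeasurable (μ := P.map (ϑ m i τ)) hD
    rw [Measure.restrict_eq_self_of_ae_mem hmem] at h2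
    exact h2.comp_aemeasurable hmeas
  simp only [Model.f, integral_empiricalMeasure]
  fun_prop

end Convergence

/-! ### Integrals against the Gaussian random measure -/

section Noise

variable {k : ℕ} {S' : Type*} [MeasurableSpace S'] {μ₀ : Measure (Euc k)} {P' : Measure S'}
  {ω₀ : Lp ℝ 2 μ₀ → Lp ℝ 2 P'}

namespace IsGaussianFluctuation

/-- The covariance, as an identity of inner products in `L²`. -/
theorem inner_eq (hω₀ : IsGaussianFluctuation μ₀ P' ω₀) (χ χ' : Lp ℝ 2 μ₀) :
    inner ℝ (ω₀ χ) (ω₀ χ') = inner ℝ χ χ' - (∫ θ, χ θ ∂μ₀) * ∫ θ, χ' θ ∂μ₀ := by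
  simp only [L2.inner_def, RCLike.inner_apply, conj_trivial]
  rw [hω₀.covariance χ' χ, mul_comm (∫ θ, χ' θ ∂μ₀)]

variable [IsFiniteMeasure μ₀]

theorem inner_add_smul_left (hω₀ : IsGaussianFluctuation μ₀ P' ω₀) (a : ℝ) (χ₁ χ₂ χ : Lp ℝ 2 μ₀) :
    inner ℝ (ω₀ (χ₁ + a • χ₂)) (ω₀ χ) = inner ℝ (ω₀ χ₁ + a • ω₀ χ₂) (ω₀ χ) := by
  have hint : ∀ χ : Lp ℝ 2 μ₀, Integrable χ μ₀ := fun χ => (Lp.memLp χ).integrable one_le_two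
  have h1 : ∫ θ, (χ₁ + a • χ₂) θ ∂μ₀ = ∫ θ, χ₁ θ ∂μ₀ + a * ∫ θ, χ₂ θ ∂μ₀ := by
    rw [← integral_const_mul, ← integral_add (hint _) ((hint _).const_mul _)]
    refine integral_congr_ae ?_
    filter_upwards [Lp.coeFn_add χ₁ (a • χ₂), Lp.coeFn_smul a χ₂] with θ h2 h3
    rw [h2, Pi.add_apply, h3, Pi.smul_apply, smul_eq_mul]
  rw [inner_add_left, inner_smul_left, hω₀.inner_eq, hω₀.inner_eq, hω₀.inner_eq, h1,
    inner_add_left, inner_smul_left]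
  simp only [conj_trivial]
  ring

/-- A centered family whose covariances are bilinear in the index is linear in the index: the
variance of `ω₀ (χ₁ + a χ₂) - ω₀ χ₁ - a ω₀ χ₂` vanishes. -/
theorem map_add_smul (hω₀ : IsGaussianFluctuation μ₀ P' ω₀) (a : ℝ) (χ₁ χ₂ : Lp ℝ 2 μ₀) :
    ω₀ (χ₁ + a • χ₂) = ω₀ χ₁ + a • ω₀ χ₂ := by
  have h0 : ∀ χ, inner ℝ (ω₀ (χ₁ + a • χ₂) - (ω₀ χ₁ + a • ω₀ χ₂)) (ω₀ χ) = 0 := fun χ => by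
    rw [inner_sub_left, hω₀.inner_add_smul_left, sub_self]
  rw [← sub_eq_zero, ← inner_self_eq_zero (𝕜 := ℝ)]
  rw [inner_sub_right (𝕜 := ℝ) _ (ω₀ (χ₁ + a • χ₂)), inner_add_right, inner_smul_right, h0, h0, h0]
  simp

omit [IsFiniteMeasure μ₀] in
theorem norm_apply_le (hω₀ : IsGaussianFluctuation μ₀ P' ω₀) (χ : Lp ℝ 2 μ₀) : ‖ω₀ χ‖ ≤ ‖χ‖ := by
  have h1 := hω₀.inner_eq χ χ
  rw [real_inner_self_eq_norm_sq, real_inner_self_eq_norm_sq] at h1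
  refine le_of_sq_le_sq ?_ (norm_nonneg _)
  nlinarith [mul_self_nonneg (∫ θ, χ θ ∂μ₀)]

/-- The integral against the Gaussian random measure as a continuous linear map. -/
noncomputable def toCLM (hω₀ : IsGaussianFluctuation μ₀ P' ω₀) : Lp ℝ 2 μ₀ →L[ℝ] Lp ℝ 2 P' :=
  LinearMap.mkContinuous
    { toFun := ω₀
      map_add' := fun χ₁ χ₂ => by simpa using hω₀.map_add_smul 1 χ₁ χ₂
      map_smul' := fun a χ => by
        have h0 : ω₀ 0 = 0 := by simpa using hω₀.norm_apply_le 0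
        simpa [h0] using hω₀.map_add_smul a 0 χ } 1 fun χ => by simpa using hω₀.norm_apply_le χ

theorem toCLM_apply (hω₀ : IsGaussianFluctuation μ₀ P' ω₀) (χ : Lp ℝ 2 μ₀) :
    hω₀.toCLM χ = ω₀ χ := rfl

theorem noiseIntegral_eq (hω₀ : IsGaussianFluctuation μ₀ P' ω₀) {χ : Euc k → ℝ}
    (hχ : MemLp χ 2 μ₀) : noiseIntegral ω₀ χ = hω₀.toCLM hχ.toLp := by
  rw [noiseIntegral, dif_pos hχ, toCLM_apply]

theorem noiseIntegral_sub (hω₀ : IsGaussianFluctuation μ₀ P' ω₀) {χ χ' : Euc k → ℝ}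
    (hχ : MemLp χ 2 μ₀) (hχ' : MemLp χ' 2 μ₀) :
    noiseIntegral ω₀ (fun θ => χ θ - χ' θ) = noiseIntegral ω₀ χ - noiseIntegral ω₀ χ' := by
  rw [hω₀.noiseIntegral_eq hχ, hω₀.noiseIntegral_eq hχ', ← map_sub, ← MemLp.toLp_sub]
  exact hω₀.noiseIntegral_eq (hχ.sub hχ')

theorem noiseIntegral_const_mul (hω₀ : IsGaussianFluctuation μ₀ P' ω₀) {χ : Euc k → ℝ}
    (hχ : MemLp χ 2 μ₀) (a : ℝ) :
    noiseIntegral ω₀ (fun θ => a * χ θ) = a • noiseIntegral ω₀ χ := by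
  rw [hω₀.noiseIntegral_eq hχ, ← map_smul, ← MemLp.toLp_const_smul]
  exact hω₀.noiseIntegral_eq (hχ.const_smul a)

theorem noiseIntegral_sum (hω₀ : IsGaussianFluctuation μ₀ P' ω₀) {ι : Type*} (I : Finset ι)
    {χ : ι → Euc k → ℝ} (hχ : ∀ i, MemLp (χ i) 2 μ₀) :
    noiseIntegral ω₀ (fun θ => ∑ i ∈ I, χ i θ) = ∑ i ∈ I, noiseIntegral ω₀ (χ i) := by
  classical
  induction I using Finset.induction_on with
  | empty =>
    have h0 : MemLp (fun _ : Euc k => (0 : ℝ)) 2 μ₀ := MemLp.zero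
    simp only [Finset.sum_empty]
    rw [hω₀.noiseIntegral_eq h0, show h0.toLp = 0 from MemLp.toLp_zero _, map_zero]
  | insert i I hi ih =>
    have hsum : MemLp (fun θ => ∑ i ∈ I, χ i θ) 2 μ₀ := memLp_finsetSum I fun i _ => hχ i
    simp only [Finset.sum_insert hi]
    rw [← ih, hω₀.noiseIntegral_eq (hχ i), hω₀.noiseIntegral_eq hsum, ← map_add, ← MemLp.toLp_add]
    exact hω₀.noiseIntegral_eq ((hχ i).add hsum)

/-- The integral of a vector-valued linear combination. -/
theorem noiseIntegralVec_smul_sum (hω₀ : IsGaussianFluctuation μ₀ P' ω₀) {ι : Type*} [Fintype ι]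
    {χ : ι → Euc k → ℝ} (hχ : ∀ i, MemLp (χ i) 2 μ₀) (c : ℝ) (v : ι → Euc k) :
    noiseIntegralVec ω₀ (fun θ => c • ∑ j, χ j θ • v j)
      = c • ∑ j, (ContinuousLinearMap.toSpanSingleton ℝ (v j)).compLp (noiseIntegral ω₀ (χ j)) := by
  have h1 : ∀ i, noiseIntegral ω₀ (fun θ => (c • ∑ j, χ j θ • v j) i)
      = ∑ j, (c * v j i) • noiseIntegral ω₀ (χ j) := fun i => by
    have h2 : (fun θ => (c • ∑ j, χ j θ • v j) i) = fun θ => ∑ j, (c * v j i) * χ j θ := by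
      funext θ
      simp only [PiLp.smul_apply, WithLp.ofLp_sum, WithLp.ofLp_smul, Finset.sum_apply,
        Pi.smul_apply, smul_eq_mul, Finset.mul_sum]
      exact Finset.sum_congr rfl fun j _ => by ring
    rw [h2, hω₀.noiseIntegral_sum _ fun j => (hχ j).const_mul _]
    exact Finset.sum_congr rfl fun j _ => hω₀.noiseIntegral_const_mul (hχ j) _
  have h3 : ∀ v : Euc k, ContinuousLinearMap.toSpanSingleton ℝ v
      = ∑ i, v i • ContinuousLinearMap.toSpanSingleton ℝ (EuclideanSpace.single i (1 : ℝ)) :=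
    fun v => by
      ext j
      simp [Finset.sum_apply, Pi.single_apply]
  have h4 : ∀ (A : ℝ →L[ℝ] Euc k) (N : Lp ℝ 2 P'), A.compLp N = A.compLpL 2 P' N := fun _ _ => rfl
  have h5 : ∀ v : Euc k, (ContinuousLinearMap.toSpanSingleton ℝ v).compLpL 2 P'
      = ∑ i, v i • (ContinuousLinearMap.toSpanSingleton ℝ
        (EuclideanSpace.single i (1 : ℝ))).compLpL 2 P' := fun v => by
    have := congrArg (fun A => ((ContinuousLinearMap.id ℝ (ℝ →L[ℝ] Euc k)).compLpL₂ 2 P') A) (h3 v)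
    simp only [map_sum, map_smul] at this
    exact this
  simp only [noiseIntegralVec, h1, h4, map_sum, map_smul]
  rw [Finset.sum_comm, Finset.smul_sum]
  refine Finset.sum_congr rfl fun j _ => ?_
  rw [h5, sum_apply, Finset.smul_sum]
  exact Finset.sum_congr rfl fun i _ => by
    rw [smul_apply, smul_smul]

variable {τ : ℝ} {G : ℝ → Euc k → ℝ}

/-- A function of two variables that is continuous on the compact set `[0, τ] × supp μ₀` is continuous
in time as a curve in `L²(μ₀)`. -/
theorem _root_.MeanField.continuousOn_toLp (hB : IsCompact μ₀.support)
    (hG : ContinuousOn (fun q : ℝ × Euc k => G q.1 q.2) (Icc 0 τ ×ˢ μ₀.support))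
    {Γ : ℝ → Lp ℝ 2 μ₀} (hΓ : ∀ s ∈ Icc 0 τ, Γ s =ᵐ[μ₀] G s) : ContinuousOn Γ (Icc 0 τ) := by
  have huc := (isCompact_Icc.prod hB).uniformContinuousOn_of_continuous hG
  rw [Metric.uniformContinuousOn_iff] at huc
  rw [Metric.continuousOn_iff]
  intro s hs ε hε
  set C := (((measureUnivNNReal μ₀) : ℝ) ^ (2 : ℝ≥0∞).toReal⁻¹) with hC
  have hC0 : 0 ≤ C := by positivity
  obtain ⟨δ, hδ, hδ'⟩ := huc (ε / (C + 1)) (by positivity)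
  refine ⟨δ, hδ, fun s' hs' hd => ?_⟩
  have h1 : ∀ᵐ θ ∂μ₀, ‖(Γ s' - Γ s) θ‖ ≤ ε / (C + 1) := by
    filter_upwards [ae_mem_support μ₀, hΓ s hs, hΓ s' hs', Lp.coeFn_sub (Γ s') (Γ s)]
      with θ hθ e1 e2 e3
    rw [e3, Pi.sub_apply, e1, e2, ← dist_eq_norm]
    exact (hδ' (s', θ) ⟨hs', hθ⟩ (s, θ) ⟨hs, hθ⟩ (by simpa [Prod.dist_eq] using hd)).le
  rw [dist_eq_norm]
  calc ‖Γ s' - Γ s‖ ≤ C * (ε / (C + 1)) := Lp.norm_le_of_ae_bound (by positivity) h1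
    _ < ε := by
      rw [mul_div_assoc', div_lt_iff₀ (by positivity)]
      nlinarith

theorem continuousOn_noiseIntegral (hω₀ : IsGaussianFluctuation μ₀ P' ω₀)
    (hB : IsCompact μ₀.support)
    (hG : ContinuousOn (fun q : ℝ × Euc k => G q.1 q.2) (Icc 0 τ ×ˢ μ₀.support)) :
    ContinuousOn (fun s => noiseIntegral ω₀ (G s)) (Icc 0 τ) := by
  classical
  have hm : ∀ s ∈ Icc 0 τ, MemLp (G s) 2 μ₀ := fun s hs =>
    memLp_of_continuousOn hB (ae_mem_support μ₀) (continuousOn_slice_right hG hs) 2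
  have h1 : ContinuousOn (fun s => if h : MemLp (G s) 2 μ₀ then h.toLp else 0) (Icc 0 τ) :=
    continuousOn_toLp hB hG fun s hs => by rw [dif_pos (hm s hs)]; exact (hm s hs).coeFn_toLp
  refine (hω₀.toCLM.continuous.comp_continuousOn h1).congr fun s hs => ?_
  rw [Function.comp_apply, dif_pos (hm s hs), hω₀.noiseIntegral_eq (hm s hs)]

/-- Integration in time commutes with integration against the Gaussian random measure. -/
theorem noiseIntegral_intervalIntegral (hω₀ : IsGaussianFluctuation μ₀ P' ω₀)
    (hB : IsCompact μ₀.support) (hτ : 0 ≤ τ)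
    (hG : ContinuousOn (fun q : ℝ × Euc k => G q.1 q.2) (Icc 0 τ ×ˢ μ₀.support)) :
    noiseIntegral ω₀ (fun θ => ∫ s in (0 : ℝ)..τ, G s θ)
      = ∫ s in (0 : ℝ)..τ, noiseIntegral ω₀ (G s) := by
  classical
  have hsupp := ae_mem_support μ₀
  have hm : ∀ s ∈ Icc 0 τ, MemLp (G s) 2 μ₀ := fun s hs =>
    memLp_of_continuousOn hB hsupp (continuousOn_slice_right hG hs) 2
  have hcomm : MemLp (fun θ => ∫ s in (0 : ℝ)..τ, G s θ) 2 μ₀ := by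
    obtain ⟨C, hC⟩ := (isCompact_Icc.prod hB).exists_bound_of_continuousOn hG
    have hprod : Integrable (fun q : ℝ × Euc k => G q.1 q.2)
        ((volume.restrict (Ioc 0 τ)).prod μ₀) := by
      refine integrable_of_continuousOn (isCompact_Icc.prod hB) ?_ hG
      exact Measure.ae_prod_mem_iff_ae_ae_mem (measurableSet_Icc.prod hB.measurableSet) |>.2
        ((ae_restrict_mem measurableSet_Ioc).mono fun s hs =>
          hsupp.mono fun θ hθ => ⟨Ioc_subset_Icc_self hs, hθ⟩)
    refine MemLp.of_bound ?_ (C * |τ - 0|) ?_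
    · simp only [intervalIntegral.integral_of_le hτ]
      exact hprod.integral_prod_right.aestronglyMeasurable
    · filter_upwards [hsupp] with θ hθ
      refine intervalIntegral.norm_integral_le_of_norm_le_const fun s hs => ?_
      rw [uIoc_of_le hτ] at hs
      exact hC (s, θ) ⟨Ioc_subset_Icc_self hs, hθ⟩
  set Γ : ℝ → Lp ℝ 2 μ₀ := fun s => if h : MemLp (G s) 2 μ₀ then h.toLp else 0 with hΓdef
  have hΓ : ∀ s ∈ Icc 0 τ, Γ s =ᵐ[μ₀] G s := fun s hs => by
    rw [hΓdef]
    simp only [dif_pos (hm s hs)]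
    exact (hm s hs).coeFn_toLp
  have hΓc : ContinuousOn Γ (Icc 0 τ) := continuousOn_toLp hB hG hΓ
  have hΓi : IntervalIntegrable Γ volume 0 τ := hΓc.intervalIntegrable_of_Icc hτ
  -- the two sides agree in `L²(μ₀)`, as they have the same inner products with every `f`
  have hkey : hcomm.toLp = ∫ s in (0 : ℝ)..τ, Γ s := by
    refine ext_inner_left ℝ fun f => ?_
    have hR : inner ℝ f (∫ s in (0 : ℝ)..τ, Γ s) = ∫ s in (0 : ℝ)..τ, inner ℝ f (Γ s) :=
      ((innerSL ℝ f).intervalIntegral_comp_comm hΓi).symm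
    have hf : Integrable f μ₀ := (Lp.memLp f).integrable one_le_two
    have hswap : ∫ s in (0 : ℝ)..τ, ∫ θ, f θ * G s θ ∂μ₀
        = ∫ θ, (∫ s in (0 : ℝ)..τ, f θ * G s θ) ∂μ₀ := by
      refine intervalIntegral_integral_swap ?_
      rw [uIoc_of_le hτ]
      obtain ⟨C, hC⟩ := (isCompact_Icc.prod hB).exists_bound_of_continuousOn hG
      have hae : ∀ᵐ q ∂((volume.restrict (Ioc 0 τ)).prod μ₀), q ∈ Icc 0 τ ×ˢ μ₀.support :=
        Measure.ae_prod_mem_iff_ae_ae_mem (measurableSet_Icc.prod hB.measurableSet) |>.2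
          ((ae_restrict_mem measurableSet_Ioc).mono fun s hs =>
            hsupp.mono fun θ hθ => ⟨Ioc_subset_Icc_self hs, hθ⟩)
      have hf2 : Integrable (fun q : ℝ × Euc k => f q.2)
          ((volume.restrict (Ioc 0 τ)).prod μ₀) := hf.comp_snd _
      exact hf2.mul_bdd (c := C)
        (aestronglyMeasurable_of_continuousOn (isCompact_Icc.prod hB) hae hG)
        (hae.mono fun q hq => hC q hq)
    rw [hR, L2.inner_def]
    calc ∫ θ, inner ℝ (f θ) ((hcomm.toLp : Lp ℝ 2 μ₀) θ) ∂μ₀ = ∫ θ, (∫ s in (0 : ℝ)..τ, f θ * G s θ) ∂μ₀ := by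
          refine integral_congr_ae ?_
          filter_upwards [hcomm.coeFn_toLp] with θ hθ
          rw [hθ, intervalIntegral.integral_const_mul]
          simp [mul_comm]
      _ = ∫ s in (0 : ℝ)..τ, ∫ θ, f θ * G s θ ∂μ₀ := hswap.symm
      _ = ∫ s in (0 : ℝ)..τ, inner ℝ f (Γ s) := by
          refine intervalIntegral.integral_congr fun s hs => ?_
          rw [uIcc_of_le hτ] at hs
          simp only [L2.inner_def]
          refine integral_congr_ae ?_
          filter_upwards [hΓ s hs] with θ hθ
          simp [hθ, mul_comm]
  rw [hω₀.noiseIntegral_eq hcomm, hkey, ← hω₀.toCLM.intervalIntegral_comp_comm hΓi]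
  refine intervalIntegral.integral_congr fun s hs => ?_
  rw [uIcc_of_le hτ] at hs
  simp only [hω₀.noiseIntegral_eq (hm s hs), hΓdef, dif_pos (hm s hs)]

omit [IsFiniteMeasure μ₀] in
/-- Integrals against the Gaussian random measure are Gaussian. -/
theorem hasLaw_noiseIntegral [IsProbabilityMeasure μ₀] [IsProbabilityMeasure P']
    (hω₀ : IsGaussianFluctuation μ₀ P' ω₀)
    {χ : Euc k → ℝ} (hχ : MemLp χ 2 μ₀) :
    HasLaw (fun s => noiseIntegral ω₀ χ s) (gaussianReal 0 (Var[χ; μ₀]).toNNReal) P' := by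
  rw [hω₀.noiseIntegral_eq hχ, toCLM_apply]
  have hG := hω₀.gaussian.hasGaussianLaw_eval hχ.toLp
  refine ⟨hG.aemeasurable, ?_⟩
  rw [hG.map_eq_gaussianReal, hω₀.mean]
  congr 2
  rw [variance_eq_sub (Lp.memLp _), hω₀.mean, variance_eq_sub hχ]
  have h1 := hω₀.covariance hχ.toLp hχ.toLp
  have h2 : ∫ θ, (hχ.toLp : Lp ℝ 2 μ₀) θ * (hχ.toLp : Lp ℝ 2 μ₀) θ ∂μ₀ = ∫ θ, χ θ * χ θ ∂μ₀ := by
    refine integral_congr_ae ?_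
    filter_upwards [hχ.coeFn_toLp] with θ hθ
    rw [hθ]
  rw [h2, integral_congr_ae hχ.coeFn_toLp] at h1
  simp only [Pi.pow_apply, sq]
  rw [h1]
  ring

end IsGaussianFluctuation

end Noise

/-! ### Linear actions on square-integrable random vectors -/

section Actions

variable {k : ℕ} {S' : Type*} [MeasurableSpace S']

/-- Linear operators acting on square-integrable random vectors. -/
noncomputable def operatorAction (P' : Measure S') :
    (Euc k →L[ℝ] Euc k) →L[ℝ] Lp (Euc k) 2 P' →L[ℝ] Lp (Euc k) 2 P' :=
  (ContinuousLinearMap.id ℝ (Euc k →L[ℝ] Euc k)).compLpL₂ 2 P'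

/-- The inner product of a vector with a square-integrable random vector. -/
noncomputable def pairing (P' : Measure S') :
    Euc k →L[ℝ] Lp (Euc k) 2 P' →L[ℝ] Lp ℝ 2 P' :=
  (innerSL ℝ).compLpL₂ 2 P'

/-- The product of a vector with a square-integrable random variable. -/
noncomputable def spread (P' : Measure S') :
    Euc k →L[ℝ] Lp ℝ 2 P' →L[ℝ] Lp (Euc k) 2 P' :=
  ((ContinuousLinearMap.toSpanSingletonCLE (𝕜 := ℝ) (E := Euc k) :
    Euc k →L[ℝ] ℝ →L[ℝ] Euc k)).compLpL₂ 2 P'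

variable {P' : Measure S'}

theorem operatorAction_apply (A : Euc k →L[ℝ] Euc k) (X : Lp (Euc k) 2 P') :
    operatorAction P' A X = A.compLp X := rfl

theorem pairing_apply (v : Euc k) (X : Lp (Euc k) 2 P') :
    pairing P' v X = (innerSL ℝ v).compLp X := rfl

theorem spread_apply (v : Euc k) (N : Lp ℝ 2 P') :
    spread P' v N = (ContinuousLinearMap.toSpanSingleton ℝ v).compLp N := rfl

/-- A rank-one operator acts by a pairing followed by a product. -/
theorem operatorAction_smulRight (v w : Euc k) (X : Lp (Euc k) 2 P') :
    operatorAction P' ((innerSL ℝ v).smulRight w) X = spread P' w (pairing P' v X) := by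
  rw [operatorAction_apply, spread_apply, pairing_apply]
  refine Lp.ext ?_
  filter_upwards [ContinuousLinearMap.coeFn_compLp ((innerSL ℝ v).smulRight w) X,
    ContinuousLinearMap.coeFn_compLp (ContinuousLinearMap.toSpanSingleton ℝ w)
      ((innerSL ℝ v).compLp X), ContinuousLinearMap.coeFn_compLp (innerSL ℝ v) X] with s h1 h2 h3
  rw [h1, h2, h3]
  rfl

theorem pairing_spread (v w : Euc k) (N : Lp ℝ 2 P') :
    pairing P' v (spread P' w N) = (inner ℝ v w : ℝ) • N := by
  rw [spread_apply, pairing_apply]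
  refine Lp.ext ?_
  filter_upwards [ContinuousLinearMap.coeFn_compLp (innerSL ℝ v)
      ((ContinuousLinearMap.toSpanSingleton ℝ w).compLp N),
    ContinuousLinearMap.coeFn_compLp (ContinuousLinearMap.toSpanSingleton ℝ w) N,
    Lp.coeFn_smul (inner ℝ v w : ℝ) N] with s h1 h2 h3
  rw [h1, h2, h3]
  simp [mul_comm]

theorem pairing_adjoint (A : Euc k →L[ℝ] Euc k) (v : Euc k) (X : Lp (Euc k) 2 P') :
    pairing P' (A.adjoint v) X = pairing P' v (operatorAction P' A X) := by
  rw [operatorAction_apply, pairing_apply, pairing_apply]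
  refine Lp.ext ?_
  filter_upwards [ContinuousLinearMap.coeFn_compLp (innerSL ℝ (A.adjoint v)) X,
    ContinuousLinearMap.coeFn_compLp (innerSL ℝ v) (A.compLp X),
    ContinuousLinearMap.coeFn_compLp A X] with s h1 h2 h3
  rw [h1, h2, h3]
  simp [ContinuousLinearMap.adjoint_inner_left]

end Actions

/-! ### The tangent flow and its duality with the adjoint flow -/

namespace IsSetting

variable {k d n : ℕ} {M : Model k d n} {μ₀ : Measure (Euc k)} [IsProbabilityMeasure μ₀] {τ : ℝ}
  {Θ p : ℝ → Euc k → Euc k} {x : Euc d} {S' : Type*} [MeasurableSpace S'] {P' : Measure S'}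
  {ω₀ : Lp ℝ 2 μ₀ → Lp ℝ 2 P'} {T : ℝ → Euc k → Lp (Euc k) 2 P'}

/-- The noise term of the tangent flow is finite-dimensional: `K` is a sum over the data points. -/
theorem noiseIntegralVec_gradK (h : IsSetting M μ₀ τ Θ) (hω₀ : IsGaussianFluctuation μ₀ P' ω₀)
    {s : ℝ} (hs : s ∈ Icc 0 τ) {θ : Euc k} (hθ : θ ∈ μ₀.support) :
    noiseIntegralVec ω₀ (fun θ' => M.gradK (Θ s θ) (Θ s θ'))
      = (n : ℝ)⁻¹ • ∑ l, spread P' (M.gradφ (M.x l) (Θ s θ))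
        (noiseIntegral ω₀ fun θ' => M.φ (Θ s θ') (M.x l)) := by
  have h1 : (fun θ' => M.gradK (Θ s θ) (Θ s θ'))
      = fun θ' => (n : ℝ)⁻¹ • ∑ l, M.φ (Θ s θ') (M.x l) • M.gradφ (M.x l) (Θ s θ) :=
    funext fun θ' => h.regular.gradK_eq (h.flow.mem s hs θ hθ) _
  rw [h1]
  exact hω₀.noiseIntegralVec_smul_sum (fun l => memLp_of_continuousOn h.isCompact
    (ae_mem_support μ₀) (continuousOn_slice_right (f := fun s θ => M.φ (Θ s θ) (M.x l))
      (h.continuousOn_comp (h.regular.continuousOn (h.regular.data_mem l))) hs) 2) _ _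

theorem continuousOn_noiseIntegral_φ (h : IsSetting M μ₀ τ Θ)
    (hω₀ : IsGaussianFluctuation μ₀ P' ω₀) (l : Fin n) :
    ContinuousOn (fun s => noiseIntegral ω₀ fun θ' => M.φ (Θ s θ') (M.x l)) (Icc 0 τ) :=
  hω₀.continuousOn_noiseIntegral h.isCompact
    (h.continuousOn_comp (h.regular.continuousOn (h.regular.data_mem l)))

/-- The tangent flow exists: it solves a linear equation in the Banach space `L²(P'; ℝᵏ)`. -/
theorem exists_tangentFlow (h : IsSetting M μ₀ τ Θ) (hω₀ : IsGaussianFluctuation μ₀ P' ω₀) :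
    ∃ T, M.IsTangentFlow μ₀ τ Θ ω₀ T := by
  have ha : ContinuousOn (fun q : ℝ × Euc k =>
      -operatorAction P' (M.hessV (Θ q.1 q.2) (μ₀.map (Θ q.1)))) (Icc 0 τ ×ˢ μ₀.support) :=
    ((operatorAction P').continuous.comp_continuousOn h.continuousOn_hessV).neg
  have hκ : ContinuousOn (fun q : ℝ × Euc k × Euc k =>
      -operatorAction P' (M.crossHessK (Θ q.1 q.2.1) (Θ q.1 q.2.2)))
      (Icc 0 τ ×ˢ μ₀.support ×ˢ μ₀.support) :=
    ((operatorAction P').continuous.comp_continuousOn h.continuousOn_crossHessK).neg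
  have hb : ContinuousOn (fun q : ℝ × Euc k =>
      -noiseIntegralVec ω₀ (fun θ' => M.gradK (Θ q.1 q.2) (Θ q.1 θ')))
      (Icc 0 τ ×ˢ μ₀.support) := by
    have h1 : ∀ l, ContinuousOn (fun q : ℝ × Euc k => spread P' (M.gradφ (M.x l) (Θ q.1 q.2))
        (noiseIntegral ω₀ fun θ' => M.φ (Θ q.1 θ') (M.x l))) (Icc 0 τ ×ˢ μ₀.support) := fun l =>
      ((spread P').continuous.comp_continuousOn (h.continuousOn_comp
        (h.regular.continuousOn_gradient (h.regular.data_mem l)))).clm_apply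
        ((h.continuousOn_noiseIntegral_φ hω₀ l).comp continuousOn_fst fun _ hq => hq.1)
    refine ContinuousOn.congr (((continuousOn_finsetSum Finset.univ fun l _ => h1 l).const_smul
      (n : ℝ)⁻¹).neg) fun q hq => ?_
    rw [h.noiseIntegralVec_gradK hω₀ hq.1 hq.2]
    rfl
  obtain ⟨T, hT, hT0, hTode⟩ := exists_linear_field h.isCompact μ₀ h.nonneg
    (a := fun s θ => -operatorAction P' (M.hessV (Θ s θ) (μ₀.map (Θ s)))) ha
    (κ := fun s θ θ' => -operatorAction P' (M.crossHessK (Θ s θ) (Θ s θ'))) hκ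
    (b := fun s θ => -noiseIntegralVec ω₀ (fun θ' => M.gradK (Θ s θ) (Θ s θ'))) hb
    (T₀ := fun _ => 0) continuousOn_const
  refine ⟨T, hT, hT0, fun s hs θ hθ => (hTode s hs θ hθ).congr_deriv ?_⟩
  rw [Measure.restrict_eq_self_of_ae_mem (ae_mem_support μ₀)]
  simp only [neg_apply, integral_neg, operatorAction_apply]
  abel

/-- The mean pairing `∫ ∇φ(Θ_s(θ), x_l) · T_s(θ) μ₀(dθ)` of a field of random vectors. -/
noncomputable def _root_.MeanField.Model.tangentCoef (M : Model k d n) (μ₀ : Measure (Euc k))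
    (Θ : ℝ → Euc k → Euc k) (T : ℝ → Euc k → Lp (Euc k) 2 P') (l : Fin n) (s : ℝ) : Lp ℝ 2 P' :=
  ∫ θ, pairing P' (M.gradφ (M.x l) (Θ s θ)) (T s θ) ∂μ₀

omit [IsProbabilityMeasure μ₀] in
theorem continuousOn_pairing {v : ℝ → Euc k → Euc k}
    (hv : ContinuousOn (fun q : ℝ × Euc k => v q.1 q.2) (Icc 0 τ ×ˢ μ₀.support))
    (hT : M.IsTangentFlow μ₀ τ Θ ω₀ T) :
    ContinuousOn (fun q : ℝ × Euc k => pairing P' (v q.1 q.2) (T q.1 q.2))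
      (Icc 0 τ ×ˢ μ₀.support) :=
  ((pairing P').continuous.comp_continuousOn hv).clm_apply hT.continuousOn

omit [IsProbabilityMeasure μ₀] in
theorem continuousOn_pairing_gradφ (h : IsSetting M μ₀ τ Θ)
    (hT : M.IsTangentFlow μ₀ τ Θ ω₀ T) (l : Fin n) :
    ContinuousOn (fun q : ℝ × Euc k => pairing P' (M.gradφ (M.x l) (Θ q.1 q.2)) (T q.1 q.2))
      (Icc 0 τ ×ˢ μ₀.support) :=
  continuousOn_pairing (v := fun s θ => M.gradφ (M.x l) (Θ s θ)) (h.continuousOn_comp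
    (h.regular.continuousOn_gradient (h.regular.data_mem l))) hT

theorem continuousOn_tangentCoef (h : IsSetting M μ₀ τ Θ) (hT : M.IsTangentFlow μ₀ τ Θ ω₀ T)
    (l : Fin n) : ContinuousOn (M.tangentCoef μ₀ Θ T l) (Icc 0 τ) :=
  continuousOn_integral h.isCompact (ae_mem_support μ₀) (h.continuousOn_pairing_gradφ hT l)

/-- The integral term of the tangent flow is finite-dimensional, as is its noise term. -/
theorem integral_crossHessK_compLp (h : IsSetting M μ₀ τ Θ) (hT : M.IsTangentFlow μ₀ τ Θ ω₀ T)
    {s : ℝ} (hs : s ∈ Icc 0 τ) {θ : Euc k} (hθ : θ ∈ μ₀.support) :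
    ∫ θ', (M.crossHessK (Θ s θ) (Θ s θ')).compLp (T s θ') ∂μ₀
      = (n : ℝ)⁻¹ • ∑ l, spread P' (M.gradφ (M.x l) (Θ s θ)) (M.tangentCoef μ₀ Θ T l s) := by
  have hint : ∀ l, Integrable (fun θ' => pairing P' (M.gradφ (M.x l) (Θ s θ')) (T s θ')) μ₀ :=
    fun l => integrable_of_continuousOn h.isCompact (ae_mem_support μ₀)
      (continuousOn_slice_right
        (f := fun s θ' => pairing P' (M.gradφ (M.x l) (Θ s θ')) (T s θ'))
        (h.continuousOn_pairing_gradφ hT l) hs)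
  have h1 : ∀ᵐ θ' ∂μ₀, (M.crossHessK (Θ s θ) (Θ s θ')).compLp (T s θ')
      = (n : ℝ)⁻¹ • ∑ l, spread P' (M.gradφ (M.x l) (Θ s θ))
        (pairing P' (M.gradφ (M.x l) (Θ s θ')) (T s θ')) := by
    filter_upwards [ae_mem_support μ₀] with θ' hθ'
    rw [← operatorAction_apply, h.regular.crossHessK_eq (h.flow.mem s hs θ hθ)
      (h.flow.mem s hs θ' hθ')]
    simp only [map_smul, map_sum, smul_apply, sum_apply, operatorAction_smulRight]
  rw [integral_congr_ae h1, integral_smul, integral_finsetSum _ fun l _ =>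
    (spread P' (M.gradφ (M.x l) (Θ s θ))).integrable_comp (hint l)]
  simp_rw [ContinuousLinearMap.integral_comp_comm _ (hint _)]
  rfl

/-- In the derivative of the pairing of the adjoint flow and the tangent flow, the Hessian terms
cancel. -/
theorem hasDerivWithinAt_pairing (h : IsSetting M μ₀ τ Θ) (hω₀ : IsGaussianFluctuation μ₀ P' ω₀)
    (hp : M.IsAdjointFlow μ₀ τ Θ x p) (hT : M.IsTangentFlow μ₀ τ Θ ω₀ T)
    {s : ℝ} (hs : s ∈ Icc 0 τ) {θ : Euc k} (hθ : θ ∈ μ₀.support) :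
    HasDerivWithinAt (fun s => pairing P' (p s θ) (T s θ))
      ((n : ℝ)⁻¹ • ∑ l, (M.adjointCoef μ₀ Θ p l s • pairing P' (M.gradφ (M.x l) (Θ s θ)) (T s θ)
        - (inner ℝ (M.gradφ (M.x l) (Θ s θ)) (p s θ) : ℝ) • (M.tangentCoef μ₀ Θ T l s
          + noiseIntegral ω₀ fun θ' => M.φ (Θ s θ') (M.x l)))) (Icc 0 τ) s := by
  refine ((pairing P').hasDerivWithinAt_of_bilinear (hp.ode s hs θ hθ)
    (hT.ode s hs θ hθ)).congr_deriv ?_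
  rw [h.integral_crossHessK_compLp hT hs hθ, h.noiseIntegralVec_gradK hω₀ hs hθ,
    ← operatorAction_apply]
  simp only [map_add, map_sub, map_neg, map_smul, map_sum, add_apply, smul_apply, sum_apply,
    pairing_adjoint, pairing_spread, Finset.sum_sub_distrib, smul_add, Finset.sum_add_distrib,
    smul_sub, real_inner_comm]
  abel

/-- Duality: for every tangent flow, the limiting fluctuation of the output is the integral of the
influence function against the Gaussian random measure. -/
theorem limitFluctuation_eq (h : IsSetting M μ₀ τ Θ) (hω₀ : IsGaussianFluctuation μ₀ P' ω₀)
    (hx : x ∈ M.Ω) (hp : M.IsAdjointFlow μ₀ τ Θ x p) (hT : M.IsTangentFlow μ₀ τ Θ ω₀ T) :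
    limitFluctuation Θ ω₀ T τ (fun θ => M.φ θ x)
      = noiseIntegral ω₀ (M.influence μ₀ τ Θ p x) := by
  have hsupp := ae_mem_support μ₀
  -- the derivative of the pairing `⟨p_s(θ), T_s(θ)⟩`
  set D' : ℝ → Euc k → Lp ℝ 2 P' := fun s θ =>
    (n : ℝ)⁻¹ • ∑ l, (M.adjointCoef μ₀ Θ p l s • pairing P' (M.gradφ (M.x l) (Θ s θ)) (T s θ)
        - (inner ℝ (M.gradφ (M.x l) (Θ s θ)) (p s θ) : ℝ) • (M.tangentCoef μ₀ Θ T l s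
          + noiseIntegral ω₀ fun θ' => M.φ (Θ s θ') (M.x l))) with hD'
  have hD'c : ContinuousOn (fun q : ℝ × Euc k => D' q.1 q.2) (Icc 0 τ ×ˢ μ₀.support) := by
    have h1 : ∀ l, ContinuousOn (fun q : ℝ × Euc k => M.adjointCoef μ₀ Θ p l q.1)
        (Icc 0 τ ×ˢ μ₀.support) := fun l =>
      (h.continuousOn_adjointCoef hp l).comp continuousOn_fst fun _ hq => hq.1
    have h2 : ∀ l, ContinuousOn (fun q : ℝ × Euc k => M.tangentCoef μ₀ Θ T l q.1
        + noiseIntegral ω₀ fun θ' => M.φ (Θ q.1 θ') (M.x l)) (Icc 0 τ ×ˢ μ₀.support) := fun l =>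
      ((h.continuousOn_tangentCoef hT l).comp continuousOn_fst fun _ hq => hq.1).add
        ((h.continuousOn_noiseIntegral_φ hω₀ l).comp continuousOn_fst fun _ hq => hq.1)
    have h3 := continuousOn_finsetSum Finset.univ fun l _ =>
      ((h1 l).smul (h.continuousOn_pairing_gradφ hT l)).sub
        ((h.continuousOn_inner_gradφ hp l).smul (h2 l))
    exact h3.const_smul (n : ℝ)⁻¹
  have hpT := continuousOn_pairing (μ₀ := μ₀) hp.continuousOn hT
  -- in time, the pairing goes from `0`, as `T_0 = 0`, to its terminal value
  have hftc : ∀ θ ∈ μ₀.support, ∫ s in (0 : ℝ)..τ, D' s θ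
      = pairing P' (M.gradφ x (Θ τ θ)) (T τ θ) := fun θ hθ => by
    have h1 := intervalIntegral.integral_eq_sub_of_hasDeriv_right_of_le h.nonneg
      (continuousOn_slice_left (f := fun s θ => pairing P' (p s θ) (T s θ)) hpT hθ)
      (fun s hs => ((h.hasDerivWithinAt_pairing hω₀ hp hT (Ioo_subset_Icc_self hs) hθ).hasDerivAt
        (Icc_mem_nhds hs.1 hs.2)).hasDerivWithinAt)
      ((continuousOn_slice_left hD'c hθ).intervalIntegrable_of_Icc h.nonneg)
    rw [hp.terminal θ hθ, hT.init θ hθ, map_zero, sub_zero] at h1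
    exact h1
  -- averaging over `μ₀` turns `⟨∇φ_l, p⟩` into `c_l` and `⟨∇φ_l, T⟩` into the tangent coefficient, and
  -- only the noise terms survive
  have hmean : ∀ s ∈ Icc 0 τ, ∫ θ, D' s θ ∂μ₀ = -((n : ℝ)⁻¹ • ∑ l, M.adjointCoef μ₀ Θ p l s •
      noiseIntegral ω₀ fun θ' => M.φ (Θ s θ') (M.x l)) := fun s hs => by
    have hi1 : ∀ l, Integrable (fun θ => M.adjointCoef μ₀ Θ p l s •
        pairing P' (M.gradφ (M.x l) (Θ s θ)) (T s θ)) μ₀ := fun l =>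
      (integrable_of_continuousOn h.isCompact hsupp
        (continuousOn_slice_right
        (f := fun s θ' => pairing P' (M.gradφ (M.x l) (Θ s θ')) (T s θ'))
        (h.continuousOn_pairing_gradφ hT l) hs)).smul (M.adjointCoef μ₀ Θ p l s)
    have hi2 : ∀ l, Integrable (fun θ => (inner ℝ (M.gradφ (M.x l) (Θ s θ)) (p s θ) : ℝ) •
        (M.tangentCoef μ₀ Θ T l s + noiseIntegral ω₀ fun θ' => M.φ (Θ s θ') (M.x l))) μ₀ :=
      fun l => (integrable_of_continuousOn h.isCompact hsupp (continuousOn_slice_right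
        (f := fun s θ => inner ℝ (M.gradφ (M.x l) (Θ s θ)) (p s θ))
        (h.continuousOn_inner_gradφ hp l) hs)).smul_const _
    simp only [hD']
    rw [integral_smul, ← smul_neg, ← Finset.sum_neg_distrib]
    congr 1
    refine (integral_finsetSum _ fun l _ => (hi1 l).sub (hi2 l)).trans
      (Finset.sum_congr rfl fun l _ => (integral_sub (hi1 l) (hi2 l)).trans ?_)
    rw [integral_smul, integral_smul_const, smul_add]
    change _ • M.tangentCoef μ₀ Θ T l s - (M.adjointCoef μ₀ Θ p l s • _ + _) = _
    abel_nf
    rfl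
  have hpair : ∫ θ, (innerSL ℝ (∇ (fun η => M.φ η x) (Θ τ θ))).compLp (T τ θ) ∂μ₀
      = -∫ s in (0 : ℝ)..τ, (n : ℝ)⁻¹ • ∑ l, M.adjointCoef μ₀ Θ p l s •
        noiseIntegral ω₀ fun θ' => M.φ (Θ s θ') (M.x l) := by
    calc ∫ θ, (innerSL ℝ (∇ (fun η => M.φ η x) (Θ τ θ))).compLp (T τ θ) ∂μ₀
        = ∫ θ, (∫ s in (0 : ℝ)..τ, D' s θ) ∂μ₀ :=
          integral_congr_ae (hsupp.mono fun θ hθ => (hftc θ hθ).symm)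
      _ = ∫ s in (0 : ℝ)..τ, ∫ θ, D' s θ ∂μ₀ :=
          (intervalIntegral_integral_swap_of_continuousOn h.isCompact hsupp h.nonneg hD'c).symm
      _ = _ := by
          rw [← intervalIntegral.integral_neg]
          refine intervalIntegral.integral_congr fun s hs => ?_
          rw [uIcc_of_le h.nonneg] at hs
          exact hmean s hs
  have hmφ : ∀ l, ∀ s ∈ Icc 0 τ, MemLp (fun θ => M.φ (Θ s θ) (M.x l)) 2 μ₀ := fun l s hs =>
    memLp_of_continuousOn h.isCompact hsupp (continuousOn_slice_right
      (f := fun s θ => M.φ (Θ s θ) (M.x l))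
      (h.continuousOn_comp (h.regular.continuousOn (h.regular.data_mem l))) hs) 2
  have hnoise : noiseIntegral ω₀ (fun θ => ∫ s in (0 : ℝ)..τ,
      (n : ℝ)⁻¹ * ∑ l, M.adjointCoef μ₀ Θ p l s * M.φ (Θ s θ) (M.x l))
      = ∫ s in (0 : ℝ)..τ, (n : ℝ)⁻¹ • ∑ l, M.adjointCoef μ₀ Θ p l s •
        noiseIntegral ω₀ fun θ' => M.φ (Θ s θ') (M.x l) := by
    rw [hω₀.noiseIntegral_intervalIntegral h.isCompact h.nonneg
      (h.continuousOn_influence_integrand hp)]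
    refine intervalIntegral.integral_congr fun s hs => ?_
    rw [uIcc_of_le h.nonneg] at hs
    have hsum : MemLp (fun θ => ∑ l, M.adjointCoef μ₀ Θ p l s * M.φ (Θ s θ) (M.x l)) 2 μ₀ :=
      memLp_finsetSum _ fun l _ => (hmφ l s hs).const_mul _
    rw [hω₀.noiseIntegral_const_mul hsum,
      hω₀.noiseIntegral_sum _ fun l => (hmφ l s hs).const_mul _]
    congr 1
    exact Finset.sum_congr rfl fun l _ => hω₀.noiseIntegral_const_mul (hmφ l s hs) _
  have hm1 : MemLp (fun θ => M.φ (Θ τ θ) x) 2 μ₀ :=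
    memLp_of_continuousOn h.isCompact hsupp (continuousOn_slice_right
      (f := fun s θ => M.φ (Θ s θ) x) (h.continuousOn_comp (h.regular.continuousOn hx))
      ⟨h.nonneg, le_rfl⟩) 2
  have hm2 : MemLp (fun θ => ∫ s in (0 : ℝ)..τ,
      (n : ℝ)⁻¹ * ∑ l, M.adjointCoef μ₀ Θ p l s * M.φ (Θ s θ) (M.x l)) 2 μ₀ :=
    memLp_of_continuousOn h.isCompact hsupp (h.continuousOn_integral_influence hp) 2
  rw [limitFluctuation, hpair, ← hnoise, ← sub_eq_add_neg]
  exact (hω₀.noiseIntegral_sub hm1 hm2).symm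

end IsSetting

/-! ### Restriction to a shorter time interval -/

theorem Model.IsTangentFlow.mono {k d n : ℕ} {M : Model k d n} {μ₀ : Measure (Euc k)} {τ t : ℝ}
    {Θ : ℝ → Euc k → Euc k} {S' : Type*} [MeasurableSpace S'] {P' : Measure S'}
    {ω₀ : Lp ℝ 2 μ₀ → Lp ℝ 2 P'} {T : ℝ → Euc k → Lp (Euc k) 2 P'}
    (hT : M.IsTangentFlow μ₀ τ Θ ω₀ T) (ht : t ≤ τ) : M.IsTangentFlow μ₀ t Θ ω₀ T where
  continuousOn := hT.continuousOn.mono (prod_mono (Icc_subset_Icc_right ht) le_rfl)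
  init := hT.init
  ode := fun s hs θ hθ => (hT.ode s (Icc_subset_Icc_right ht hs) θ hθ).mono
    (Icc_subset_Icc_right ht)

theorem Model.IsParticleFlow.mono {k d n : ℕ} {M : Model k d n} {τ t : ℝ} {S : Type*}
    [MeasurableSpace S] {P : Measure S} {θ₀ : ℕ → S → Euc k} {m : ℕ}
    {ϑ : Fin m → ℝ → S → Euc k} (hϑ : M.IsParticleFlow P τ θ₀ m ϑ) (ht : t ≤ τ) :
    M.IsParticleFlow P t θ₀ m ϑ where
  aemeasurable := fun i s hs => hϑ.aemeasurable i s (Icc_subset_Icc_right ht hs)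
  init := hϑ.init
  mem := hϑ.mem.mono fun _ h s hs => h s (Icc_subset_Icc_right ht hs)
  ode := hϑ.ode.mono fun _ h s hs i => (h s (Icc_subset_Icc_right ht hs) i).mono
    (Icc_subset_Icc_right ht)

end MeanField

theorem corollary1 {k d n : ℕ} (M : MeanField.Model k d n) (hM : M.Regular)
    -- the initial measure is a compactly supported probability measure on `D`
    (μ₀ : Measure (MeanField.Euc k)) [IsProbabilityMeasure μ₀]
    (hμ₀ : IsCompact μ₀.support) (hμ₀D : μ₀.support ⊆ M.D)
    -- the mean-field characteristic flow on `[0, τ]`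
    (τ : ℝ) (Θ : ℝ → MeanField.Euc k → MeanField.Euc k) (hΘ : M.IsMeanFieldFlow μ₀ τ Θ)
    -- the i.i.d. initial conditions and the particle flows with `m` particles
    {S : Type*} [MeasurableSpace S] (P : Measure S) [IsProbabilityMeasure P]
    (θ₀ : ℕ → S → MeanField.Euc k) (hlaw : ∀ i, HasLaw (θ₀ i) μ₀ P) (hindep : iIndepFun θ₀ P)
    (ϑ : (m : ℕ) → Fin m → ℝ → S → MeanField.Euc k)
    (hϑ : ∀ m, M.IsParticleFlow P τ θ₀ m (ϑ m))
    -- the Gaussian random measure `ω₀`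
    {S' : Type*} [MeasurableSpace S'] (P' : Measure S') [IsProbabilityMeasure P']
    (ω₀ : Lp ℝ 2 μ₀ → Lp ℝ 2 P') (hω₀ : MeanField.IsGaussianFluctuation μ₀ P' ω₀) :
    (∃ T, M.IsTangentFlow μ₀ τ Θ ω₀ T) ∧
    ∀ T, M.IsTangentFlow μ₀ τ Θ ω₀ T → ∀ t ∈ Icc 0 τ, ∀ x ∈ M.Ω, ∃ g : Lp ℝ 2 P',
      g = MeanField.limitFluctuation Θ ω₀ T t (fun θ => M.φ θ x) ∧
      g = MeanField.noiseIntegral ω₀ (fun θ => M.φ (Θ t θ) x)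
        + ∫ θ, (innerSL ℝ (gradient (fun η => M.φ η x) (Θ t θ))).compLp (T t θ) ∂μ₀ ∧
      TendstoInDistribution
        (fun (m : ℕ) (s : S) => Real.sqrt m *
          (M.f (MeanField.empiricalMeasure fun i => ϑ m i t s) x - M.f (μ₀.map (Θ t)) x))
        atTop (fun s => g s) (fun _ => P) P' := by
  refine ⟨?_, fun T hT t ht x hx => ?_⟩
  · rcases le_or_gt 0 τ with hτ | hτ
    · exact MeanField.IsSetting.exists_tangentFlow (M := M) ⟨hM, hμ₀, hμ₀D, hτ, hΘ⟩ hω₀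
    -- for `τ < 0` the time interval is empty
    · exact ⟨fun _ _ => 0, continuousOn_const, fun _ _ => rfl,
        fun s hs => absurd (hs.1.trans hs.2) hτ.not_ge⟩
  -- the adjoint flow runs backwards from time `t`, so everything is restricted to `[0, t]`
  have h : MeanField.IsSetting M μ₀ t Θ :=
    MeanField.IsSetting.mono ⟨hM, hμ₀, hμ₀D, ht.1.trans ht.2, hΘ⟩ ht
  obtain ⟨p, hp⟩ := h.exists_adjointFlow hx
  refine ⟨_, rfl, rfl, ?_⟩
  rw [h.limitFluctuation_eq hω₀ hx hp (hT.mono ht.2)]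
  exact h.tendstoInDistribution_output hx hp hlaw hindep (fun m => (hϑ m).mono ht.2)
    (hω₀.hasLaw_noiseIntegral (MeanField.memLp_of_continuousOn h.isCompact
      (MeanField.ae_mem_support μ₀) (h.continuousOn_influence hx hp) 2))
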